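/- For a real $n\times m$ matrix $X$ and $k\ge 1$ let $C_k(X)\in\mathbb R^{\binom nk\times\binom mk}$ be its $k$-th multiplicative compound, i.e. the matrix of all $k\times k$ minors $\det X_{I,J}$, where $I$ and $J$ run through the increasing $k$-tuples of row and column indices in lexicographic order. An algorithm is a single program, the same for all $n,m,k$ and all matrices, for a real random access machine in which each of the following takes unit time: index operations (reading and writing memory, constants, addition, truncated subtraction, comparison), conversion of an index into a real number, and the operations $+,-,\times,\div$, comparison and extraction of $k$-th roots on real numbers. Its input is $n$, $m$, $k$ and the matrix $C_k(A)$, and the constants in $O(\cdot)$ are absolute. Let $A\in\mathbb R^{n\times m}$, $r=\operatorname{rank}(A)$ and $k\ge 1$. 1. If $k<r$ and $B\in\mathbb R^{n\times m}$ satisfies $C_k(A)=C_k(B)$, then $B=A$ if $k$ is odd, and $B=A$ or $B=-A$ if $k$ is even. Moreover, there is an algorithm which, for all $n,m,k,A$ with $1\le k<r$, on the input $C_k(A)$ returns $cA$ for some $c\in\{-1,1\}$ with $c^k=1$, in time (a) $O\Big(\max_{p\in\{m,n\}}\Big[\binom pk^3+\binom pk^2\binom rk\Big]\Big)$ if $k\le\lceil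 r/2\rceil$; (b) $O\Big(\max_{p\in\{m,n\}}\Big[\binom pk^3+\binom pk^2\binom rk+\binom r{\lfloor r/2\rfloor}^2\,p\,k^2\log r\Big]\Big)$ if $k>\lceil r/2\rceil$. 2. There is an algorithm which, for all $n,m,k,A$ with $k=r\ge 1$, on the input $C_k(A)$ returns some matrix $B\in\mathbb R^{n\times m}$ with $C_k(B)=C_k(A)$, in time $O\Big(\max_{p\in\{m,n\}}\Big[\binom pk^2\binom rk\Big]\Big)$ if $k<\max\{n,m\}$, and in time $O(nm)$ in the remaining case $k=n=m$. -/

import Mathlib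

namespace InverseCompound

/-! ### The multiplicative compound -/

/-- The increasing `k`-tuples of elements of `Fin n`, as a subset of the set of all `k`-tuples with
its lexicographic order. -/
def incTuples (n k : ℕ) : Finset (Lex (Fin k → Fin n)) := by
  classical exact Finset.univ.filter fun v => StrictMono (ofLex v)

theorem card_incTuples (n k : ℕ) : (incTuples n k).card = n.choose k := by
  classical
  have e : {v : Lex (Fin k → Fin n) // StrictMono (ofLex v)} ≃ (Fin k ↪o Fin n) :=
    { toFun := fun v => OrderEmbedding.ofStrictMono (ofLex v.1) v.2
      invFun := fun f => ⟨toLex f, f.strictMono⟩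
      left_inv := fun _ => rfl
      right_inv := fun _ => rfl }
  have h1 : (incTuples n k).card =
      Nat.card {v : Lex (Fin k → Fin n) // StrictMono (ofLex v)} := by
    rw [incTuples, ← Fintype.card_subtype, Nat.card_eq_fintype_card]
  rw [h1, Nat.card_congr (e.trans Set.powersetCard.ofFinEmbEquiv), Set.powersetCard.card,
    Nat.card_eq_fintype_card, Fintype.card_fin]

/-- The `i`-th increasing `k`-tuple of elements of `Fin n`, in the lexicographic order. -/
noncomputable def tuple (n k : ℕ) (i : Fin (n.choose k)) : Fin k → Fin n :=
  ofLex ((incTuples n k).orderEmbOfFin (card_incTuples n k) i)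

/-- The `k`-th multiplicative compound of `X`: the matrix of all `k × k` minors of `X`, rows and
columns in lexicographic order. -/
noncomputable def compound {n m : ℕ} (k : ℕ) (X : Matrix (Fin n) (Fin m) ℝ) :
    Matrix (Fin (n.choose k)) (Fin (m.choose k)) ℝ :=
  Matrix.of fun i j => (X.submatrix (tuple n k i) (tuple m k j)).det

/-! ### Algorithms on real matrices

A real random access machine with a structured program. A program is a finite text. It uses index
registers, two-dimensional arrays of natural numbers and two-dimensional arrays of real numbers;
array entries are addressed indirectly, by computed indices. The elementary operations are reading
and writing a register or an array entry; constants, addition, truncated subtraction and comparison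
of natural numbers; conversion of a natural number into a real number; and, on real numbers,
the four field operations, comparison and the extraction of a `k`-th root. Each of them takes one
unit of time. -/

structure State where
  reg : ℕ → ℕ
  narr : ℕ → ℕ → ℕ → ℕ
  rarr : ℕ → ℕ → ℕ → ℝ

/-- Expressions with natural number values. `get a i j` is the entry `(i, j)` of the array `a`. -/
inductive NExpr where
  | lit (c : ℕ)
  | reg (x : ℕ)
  | get (a : ℕ) (i j : NExpr)
  | add (e f : NExpr)
  | sub (e f : NExpr)

namespace NExpr

def eval (s : State) : NExpr → ℕ
  | lit c => c
  | reg x => s.reg x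
  | get a i j => s.narr a (i.eval s) (j.eval s)
  | add e f => e.eval s + f.eval s
  | sub e f => e.eval s - f.eval s

/-- The number of elementary operations in the evaluation of an expression. -/
def cost : NExpr → ℕ
  | lit _ => 1
  | reg _ => 1
  | get _ i j => i.cost + j.cost + 1
  | add e f => e.cost + f.cost + 1
  | sub e f => e.cost + f.cost + 1

end NExpr

/-- Expressions with real values. -/
inductive RExpr where
  | ofNat (e : NExpr)
  | get (a : ℕ) (i j : NExpr)
  | add (e f : RExpr)
  | sub (e f : RExpr)
  | mul (e f : RExpr)
  | div (e f : RExpr)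
  | root (k : NExpr) (e : RExpr)

namespace RExpr

/-- Division by zero returns `0`. For a negative radicand, `root` returns the root of `0`. -/
noncomputable def eval (s : State) : RExpr → ℝ
  | ofNat e => (e.eval s : ℝ)
  | get a i j => s.rarr a (i.eval s) (j.eval s)
  | add e f => e.eval s + f.eval s
  | sub e f => e.eval s - f.eval s
  | mul e f => e.eval s * f.eval s
  | div e f => e.eval s / f.eval s
  | root k e => (max (e.eval s) 0) ^ ((k.eval s : ℝ)⁻¹)

def cost : RExpr → ℕ
  | ofNat e => e.cost + 1
  | get _ i j => i.cost + j.cost + 1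
  | add e f => e.cost + f.cost + 1
  | sub e f => e.cost + f.cost + 1
  | mul e f => e.cost + f.cost + 1
  | div e f => e.cost + f.cost + 1
  | root k e => k.cost + e.cost + 1

end RExpr

inductive Test where
  | nle (e f : NExpr)
  | rle (e f : RExpr)
  | not (b : Test)
  | and (b c : Test)

namespace Test

def Holds (s : State) : Test → Prop
  | nle e f => e.eval s ≤ f.eval s
  | rle e f => e.eval s ≤ f.eval s
  | not b => ¬ b.Holds s
  | and b c => b.Holds s ∧ c.Holds s

def cost : Test → ℕ
  | nle e f => e.cost + f.cost + 1
  | rle e f => e.cost + f.cost + 1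
  | not b => b.cost + 1
  | and b c => b.cost + c.cost + 1

end Test

inductive Prog where
  | skip
  | setReg (x : ℕ) (e : NExpr)
  | setNat (a : ℕ) (i j e : NExpr)
  | setReal (a : ℕ) (i j : NExpr) (e : RExpr)
  | seq (P Q : Prog)
  | ite (b : Test) (P Q : Prog)
  | while (b : Test) (P : Prog)

/-- Replace the entry `(i, j)` of the array `a` by `v`. -/
def update {α : Type} (f : ℕ → ℕ → ℕ → α) (a i j : ℕ) (v : α) : ℕ → ℕ → ℕ → α :=
  fun a' i' j' => if a' = a ∧ i' = i ∧ j' = j then v else f a' i' j'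

/-- `Exec P s t s'`: started in the state `s`, the program `P` halts after `t` elementary
operations, in the state `s'`. -/
inductive Exec : Prog → State → ℕ → State → Prop where
  | skip (s : State) : Exec Prog.skip s 1 s
  | setReg (x : ℕ) (e : NExpr) (s : State) :
      Exec (Prog.setReg x e) s (e.cost + 1)
        { s with reg := Function.update s.reg x (e.eval s) }
  | setNat (a : ℕ) (i j e : NExpr) (s : State) :
      Exec (Prog.setNat a i j e) s (i.cost + j.cost + e.cost + 1)
        { s with narr := update s.narr a (i.eval s) (j.eval s) (e.eval s) }
  | setReal (a : ℕ) (i j : NExpr) (e : RExpr) (s : State) :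
      Exec (Prog.setReal a i j e) s (i.cost + j.cost + e.cost + 1)
        { s with rarr := update s.rarr a (i.eval s) (j.eval s) (e.eval s) }
  | seq {P Q : Prog} {s s' s'' : State} {t t' : ℕ} (hP : Exec P s t s') (hQ : Exec Q s' t' s'') :
      Exec (Prog.seq P Q) s (t + t') s''
  | ite_true {b : Test} {P Q : Prog} {s s' : State} {t : ℕ} (hb : b.Holds s)
      (hP : Exec P s t s') : Exec (Prog.ite b P Q) s (b.cost + t) s'
  | ite_false {b : Test} {P Q : Prog} {s s' : State} {t : ℕ} (hb : ¬ b.Holds s)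
      (hQ : Exec Q s t s') : Exec (Prog.ite b P Q) s (b.cost + t) s'
  | while_true {b : Test} {P : Prog} {s s' s'' : State} {t t' : ℕ} (hb : b.Holds s)
      (hP : Exec P s t s') (hW : Exec (Prog.while b P) s' t' s'') :
      Exec (Prog.while b P) s (b.cost + t + t') s''
  | while_false {b : Test} {P : Prog} {s : State} (hb : ¬ b.Holds s) :
      Exec (Prog.while b P) s b.cost s

/-- The initial state on the input `n`, `m`, `k` and `M`: the registers `0`, `1`, `2` hold
`n`, `m`, `k`, the real array `0` holds the entries of `M`, and everything else is zero. -/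
noncomputable def initial (n m k : ℕ)
    (M : Matrix (Fin (n.choose k)) (Fin (m.choose k)) ℝ) : State where
  reg := fun x => if x = 0 then n else if x = 1 then m else if x = 2 then k else 0
  narr := fun _ _ _ => 0
  rarr := fun a i j =>
    if h : a = 0 ∧ i < n.choose k ∧ j < m.choose k then M ⟨i, h.2.1⟩ ⟨j, h.2.2⟩ else 0

/-- On the input `n`, `m`, `k` and `M`, the program `P` halts after `t` elementary operations, and
then the real array `1` holds the `n × m` matrix `B`. -/
def Returns (P : Prog) (n m k : ℕ) (M : Matrix (Fin (n.choose k)) (Fin (m.choose k)) ℝ)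
    (B : Matrix (Fin n) (Fin m) ℝ) (t : ℕ) : Prop :=
  ∃ s : State, Exec P (initial n m k M) t s ∧
    ∀ (i : Fin n) (j : Fin m), s.rarr 1 (i : ℕ) (j : ℕ) = B i j

/-! ### The time bounds -/

/-- `binom(p,k)^3 + binom(p,k)^2 binom(r,k)`. -/
def smallOrderTime (p k r : ℕ) : ℝ :=
  (p.choose k : ℝ) ^ 3 + (p.choose k : ℝ) ^ 2 * (r.choose k : ℝ)

/-- `binom(p,k)^3 + binom(p,k)^2 binom(r,k) + binom(r,⌊r/2⌋)^2 p k^2 log r`. -/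
noncomputable def largeOrderTime (p k r : ℕ) : ℝ :=
  (p.choose k : ℝ) ^ 3 + (p.choose k : ℝ) ^ 2 * (r.choose k : ℝ) +
    (r.choose (r / 2) : ℝ) ^ 2 * (p : ℝ) * (k : ℝ) ^ 2 * Real.log r

/-- `binom(p,k)^2 binom(r,k)`. -/
def fullOrderTime (p k r : ℕ) : ℝ :=
  (p.choose k : ℝ) ^ 2 * (r.choose k : ℝ)

end InverseCompound

/-! Let F = A[I,J] be a k × k submatrix with det F ≠ 0. By Cramer's rule the entries of Y = A[·,J]
F⁻¹ and Z = F⁻¹ A[I,·] are quotients of minors of order k, so they can be read off C_k(A). What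
remains unknown is F itself and the residue R = A − Y F Z. Both are reached through the minors in
which one row of I is exchanged for x and one column of J for y, by the identity `exchange_eq`: det
A[I with a → x, J with b → y] / det F − Y_{xa} Z_{by} = R_{xy} (F⁻¹)_{ba}.

If k < rank A, then R ≠ 0, so the left side is nonzero for some x₀, a₀, y₀, b₀. Put ρ = R_{x₀y₀}.
Fixing x₀, y₀ yields the matrix W = ρ F⁻¹; fixing a₀, b₀ and dividing yields R/ρ. Hence A = ρ (Y W⁻¹
Z + R/ρ), where the bracket depends on minors of order k only, and ρ^k = det F · det W
(`eq_smul_direction`). This determines A up to a real k-th root of unity, and it is also the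
algorithm.

If k = rank A, then R = 0 and A = Y F Z. Each minor of order k of Y G Z is a product of three
determinants, so only det G matters, and G = diag(det F, 1, …, 1) will do.

The programs enumerate the increasing tuples in lexicographic order, search for a nonzero entry of
C_k(A), and scan all tuples for those that differ from the base tuple in one entry. This tabulates
the index and the sign of every exchanged minor. Below the rank a Gauss–Jordan inversion and two
matrix products follow. With p = max(n,m) and k < p one has p ≤ C(p,k), so the total is O(C(p,k)³),
a summand of both bounds (a) and (b). At the rank O(C(p,k)²) is required: the rows I of Y form the
identity and are only copied, and the other n − k rows are affordable because 1 + k(p − k) ≤ C(p,k).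

Correctness and running time are proved together by the Hoare triples `Runs`, with `Keep` as frame
condition. -/

namespace InverseCompound

/-! ### Execution with a time bound -/

/-- Started in the state `s`, the program `P` halts after at most `c` elementary operations, in a
state satisfying `Q`. -/
def Runs (P : Prog) (s : State) (c : ℕ) (Q : State → Prop) : Prop :=
  ∃ t s', t ≤ c ∧ Exec P s t s' ∧ Q s'

namespace State

def setR (s : State) (x v : ℕ) : State := { s with reg := Function.update s.reg x v }

def setN (s : State) (a i j v : ℕ) : State := { s with narr := update s.narr a i j v }

def setX (s : State) (a i j : ℕ) (v : ℝ) : State := { s with rarr := update s.rarr a i j v }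

@[simp] theorem setR_reg (s : State) (x v y : ℕ) :
    (s.setR x v).reg y = if y = x then v else s.reg y := by
  simp [setR, Function.update_apply]

@[simp] theorem setR_narr (s : State) (x v : ℕ) : (s.setR x v).narr = s.narr := rfl

@[simp] theorem setR_rarr (s : State) (x v : ℕ) : (s.setR x v).rarr = s.rarr := rfl

@[simp] theorem setN_reg (s : State) (a i j v : ℕ) : (s.setN a i j v).reg = s.reg := rfl

@[simp] theorem setN_narr (s : State) (a i j v a' i' j' : ℕ) :
    (s.setN a i j v).narr a' i' j' =
      if a' = a ∧ i' = i ∧ j' = j then v else s.narr a' i' j' := rfl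

@[simp] theorem setN_rarr (s : State) (a i j v : ℕ) : (s.setN a i j v).rarr = s.rarr := rfl

@[simp] theorem setX_reg (s : State) (a i j : ℕ) (v : ℝ) : (s.setX a i j v).reg = s.reg := rfl

@[simp] theorem setX_narr (s : State) (a i j : ℕ) (v : ℝ) : (s.setX a i j v).narr = s.narr := rfl

@[simp] theorem setX_rarr (s : State) (a i j : ℕ) (v : ℝ) (a' i' j' : ℕ) :
    (s.setX a i j v).rarr a' i' j' =
      if a' = a ∧ i' = i ∧ j' = j then v else s.rarr a' i' j' := rfl

end State

-- Loop-free programs and the frame condition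

attribute [simp] NExpr.eval RExpr.eval Test.Holds

namespace Prog

/-- A program without loops. -/
def LoopFree : Prog → Prop
  | skip => True
  | setReg _ _ => True
  | setNat _ _ _ _ => True
  | setReal _ _ _ _ => True
  | seq P Q => P.LoopFree ∧ Q.LoopFree
  | ite _ P Q => P.LoopFree ∧ Q.LoopFree
  | .while _ _ => False

/-- The effect of a loop-free program. -/
noncomputable def run : Prog → State → State
  | skip, s => s
  | setReg x e, s => s.setR x (e.eval s)
  | setNat a i j e, s => s.setN a (i.eval s) (j.eval s) (e.eval s)
  | setReal a i j e, s => s.setX a (i.eval s) (j.eval s) (e.eval s)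
  | seq P Q, s => Q.run (P.run s)
  | ite b P Q, s => open Classical in if b.Holds s then P.run s else Q.run s
  | .while _ _, s => s

/-- A bound for the running time of a loop-free program. -/
def steps : Prog → ℕ
  | skip => 1
  | setReg _ e => e.cost + 1
  | setNat _ i j e => i.cost + j.cost + e.cost + 1
  | setReal _ i j e => i.cost + j.cost + e.cost + 1
  | seq P Q => P.steps + Q.steps
  | ite b P Q => b.cost + (P.steps + Q.steps)
  | .while _ _ => 0

attribute [simp] LoopFree run

/-- The program may write the register `x`. -/
def ModR (x : ℕ) : Prog → Prop
  | setReg y _ => x = y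
  | seq P Q => P.ModR x ∨ Q.ModR x
  | ite _ P Q => P.ModR x ∨ Q.ModR x
  | .while _ P => P.ModR x
  | _ => False

/-- The program may write the natural number array `a`. -/
def ModN (a : ℕ) : Prog → Prop
  | setNat b _ _ _ => a = b
  | seq P Q => P.ModN a ∨ Q.ModN a
  | ite _ P Q => P.ModN a ∨ Q.ModN a
  | .while _ P => P.ModN a
  | _ => False

/-- The program may write the real array `a`. -/
def ModX (a : ℕ) : Prog → Prop
  | setReal b _ _ _ => a = b
  | seq P Q => P.ModX a ∨ Q.ModX a
  | ite _ P Q => P.ModX a ∨ Q.ModX a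
  | .while _ P => P.ModX a
  | _ => False

attribute [simp] ModR ModN ModX

end Prog

/-- The states `s` and `s'` agree on everything that `P` does not write. -/
structure Keep (P : Prog) (s s' : State) : Prop where
  reg : ∀ x, ¬ P.ModR x → s'.reg x = s.reg x
  narr : ∀ a, ¬ P.ModN a → s'.narr a = s.narr a
  rarr : ∀ a, ¬ P.ModX a → s'.rarr a = s.rarr a

/-- The frame rule, by induction on the execution. Since `ModR`, `ModN` and `ModX` are syntactic,
`simp` decides them for concrete programs. -/
theorem Exec.keep {P : Prog} {s s' : State} {t : ℕ} (h : Exec P s t s') : Keep P s s' := by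
  induction h with
  | skip s => exact ⟨fun _ _ => rfl, fun _ _ => rfl, fun _ _ => rfl⟩
  | setReg x e s =>
    refine ⟨fun y hy => ?_, fun _ _ => rfl, fun _ _ => rfl⟩
    simp only [Prog.ModR] at hy
    simp [hy]
  | setNat a i j e s =>
    refine ⟨fun _ _ => rfl, fun b hb => ?_, fun _ _ => rfl⟩
    simp only [Prog.ModN] at hb
    funext i' j'
    simp [update, hb]
  | setReal a i j e s =>
    refine ⟨fun _ _ => rfl, fun _ _ => rfl, fun b hb => ?_⟩
    simp only [Prog.ModX] at hb
    funext i' j'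
    simp [update, hb]
  | seq _ _ hP hQ =>
    refine ⟨fun x hx => ?_, fun x hx => ?_, fun x hx => ?_⟩ <;>
      simp only [Prog.ModR, Prog.ModN, Prog.ModX, not_or] at hx
    · rw [hQ.reg x hx.2, hP.reg x hx.1]
    · rw [hQ.narr x hx.2, hP.narr x hx.1]
    · rw [hQ.rarr x hx.2, hP.rarr x hx.1]
  | ite_true _ _ hP =>
    refine ⟨fun x hx => ?_, fun x hx => ?_, fun x hx => ?_⟩ <;>
      simp only [Prog.ModR, Prog.ModN, Prog.ModX, not_or] at hx
    exacts [hP.reg x hx.1, hP.narr x hx.1, hP.rarr x hx.1]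
  | ite_false _ _ hP =>
    refine ⟨fun x hx => ?_, fun x hx => ?_, fun x hx => ?_⟩ <;>
      simp only [Prog.ModR, Prog.ModN, Prog.ModX, not_or] at hx
    exacts [hP.reg x hx.2, hP.narr x hx.2, hP.rarr x hx.2]
  | while_true _ _ _ hP hW =>
    refine ⟨fun x hx => ?_, fun x hx => ?_, fun x hx => ?_⟩
    · rw [hW.reg x hx, hP.reg x hx]
    · rw [hW.narr x hx, hP.narr x hx]
    · rw [hW.rarr x hx, hP.rarr x hx]
  | while_false _ => exact ⟨fun _ _ => rfl, fun _ _ => rfl, fun _ _ => rfl⟩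

theorem Prog.exec_run (P : Prog) (h : P.LoopFree) (s : State) :
    ∃ t, t ≤ P.steps ∧ Exec P s t (P.run s) := by
  classical
  induction P generalizing s with
  | skip => exact ⟨1, le_rfl, Exec.skip s⟩
  | setReg x e => exact ⟨_, le_rfl, Exec.setReg x e s⟩
  | setNat a i j e => exact ⟨_, le_rfl, Exec.setNat a i j e s⟩
  | setReal a i j e => exact ⟨_, le_rfl, Exec.setReal a i j e s⟩
  | seq P Q hP hQ =>
    obtain ⟨t, ht, h1⟩ := hP h.1 s
    obtain ⟨t', ht', h2⟩ := hQ h.2 (P.run s)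
    exact ⟨_, add_le_add ht ht', Exec.seq h1 h2⟩
  | ite b P Q hP hQ =>
    by_cases hb : b.Holds s
    · obtain ⟨t, ht, h1⟩ := hP h.1 s
      refine ⟨b.cost + t, by simp only [Prog.steps]; omega, ?_⟩
      simpa [hb] using Exec.ite_true hb h1
    · obtain ⟨t, ht, h1⟩ := hQ h.2 s
      refine ⟨b.cost + t, by simp only [Prog.steps]; omega, ?_⟩
      simpa [hb] using Exec.ite_false hb h1
  | _ => exact h.elim

/-! ### Composition rules for timed triples -/

namespace Runs

theorem loopFree {P : Prog} {s : State} {c : ℕ} {Q : State → Prop} (h : P.LoopFree)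
    (hc : P.steps ≤ c) (hQ : Q (P.run s)) : Runs P s c Q :=
  let ⟨t, ht, he⟩ := P.exec_run h s
  ⟨t, _, ht.trans hc, he, hQ⟩

/-- The new postcondition may use `Keep P s s'`, so that a triple only has to describe what its
program writes. -/
theorem mono {P : Prog} {s : State} {c c' : ℕ} {Q Q' : State → Prop} (h : Runs P s c Q)
    (hc : c ≤ c') (hQ : ∀ s', Keep P s s' → Q s' → Q' s') : Runs P s c' Q' :=
  let ⟨t, s', ht, he, hq⟩ := h
  ⟨t, s', ht.trans hc, he, hQ s' he.keep hq⟩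

theorem seq {P P' : Prog} {s : State} {c c' : ℕ} {Q Q' : State → Prop} (h : Runs P s c Q)
    (h' : ∀ s', Keep P s s' → Q s' → Runs P' s' c' Q') : Runs (P.seq P') s (c + c') Q' :=
  let ⟨_, s', ht, he, hq⟩ := h
  let ⟨_, s'', ht', he', hq'⟩ := h' s' he.keep hq
  ⟨_, s'', add_le_add ht ht', he.seq he', hq'⟩

theorem ite {P P' : Prog} {b : Test} {s : State} {c c' : ℕ} {Q : State → Prop}
    (h : b.Holds s → Runs P s c Q) (h' : ¬ b.Holds s → Runs P' s c' Q) :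
    Runs (Prog.ite b P P') s (b.cost + (c + c')) Q := by
  by_cases hb : b.Holds s
  · obtain ⟨t, s', ht, he, hq⟩ := h hb
    exact ⟨_, s', by omega, he.ite_true hb, hq⟩
  · obtain ⟨t, s', ht, he, hq⟩ := h' hb
    exact ⟨_, s', by omega, he.ite_false hb, hq⟩

theorem ite_true {P P' : Prog} {b : Test} {s : State} {c : ℕ} {Q : State → Prop}
    (hb : b.Holds s) (h : Runs P s c Q) : Runs (Prog.ite b P P') s (b.cost + c) Q :=
  let ⟨_, s', ht, he, hq⟩ := h
  ⟨_, s', by omega, he.ite_true hb, hq⟩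

theorem ite_false {P P' : Prog} {b : Test} {s : State} {c : ℕ} {Q : State → Prop}
    (hb : ¬ b.Holds s) (h : Runs P' s c Q) : Runs (Prog.ite b P P') s (b.cost + c) Q :=
  let ⟨_, s', ht, he, hq⟩ := h
  ⟨_, s', by omega, he.ite_false hb, hq⟩

/-- A loop that is executed exactly `N` times. -/
theorem while_count {P : Prog} {b : Test} (N : ℕ) (I : ℕ → State → Prop) (c : ℕ → ℕ) {s : State}
    (h0 : I 0 s) (hstep : ∀ i < N, ∀ s', I i s' → b.Holds s' ∧ Runs P s' (c i) (I (i + 1)))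
    (hend : ∀ s', I N s' → ¬ b.Holds s') :
    Runs (Prog.while b P) s (∑ i ∈ Finset.range N, (b.cost + c i) + b.cost) (I N) := by
  induction N generalizing s I c with
  | zero => exact ⟨_, s, by simp, Exec.while_false (hend s h0), h0⟩
  | succ N ih =>
    obtain ⟨hb, t, s', ht, he, hs'⟩ := hstep 0 N.succ_pos s h0
    -- The first iteration is peeled off; the remaining ones start from the shifted invariant.
    obtain ⟨t', s'', ht', he', hs''⟩ := ih (fun i => I (i + 1)) (fun i => c (i + 1)) hs'
      (fun i hi s' h => hstep (i + 1) (by omega) s' h) hend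
    refine ⟨b.cost + t + t', s'', ?_, Exec.while_true hb he he', hs''⟩
    rw [Finset.sum_range_succ']
    omega

end Runs

/-- `for x in 0, …, reg y - 1 do P`. -/
def loop (x y : ℕ) (P : Prog) : Prog :=
  .seq (.setReg x (.lit 0))
    (.while (.not (.nle (.reg y) (.reg x)))
      (.seq P (.setReg x (.add (.reg x) (.lit 1)))))

@[simp] theorem modR_loop (z x y : ℕ) (P : Prog) :
    (loop x y P).ModR z ↔ z = x ∨ P.ModR z := by
  simp only [loop, Prog.ModR]; tauto

@[simp] theorem modN_loop (z x y : ℕ) (P : Prog) : (loop x y P).ModN z ↔ P.ModN z := by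
  simp [loop]

@[simp] theorem modX_loop (z x y : ℕ) (P : Prog) : (loop x y P).ModX z ↔ P.ModX z := by
  simp [loop]

/-- The counter is incremented between iterations, hence the invariant must be insensitive to the
register `x`. Each iteration pays 4 for the test and 4 for the increment; the final 6 is 2 for the
initialization and 4 for the failing test. -/
theorem Runs.loop_sum {x y : ℕ} {P : Prog} {s : State} (I : ℕ → State → Prop) (c : ℕ → ℕ)
    (hxy : x ≠ y) (hx : ¬ P.ModR x) (hy : ¬ P.ModR y)
    (hI : ∀ i s v, I i s → I i (s.setR x v)) (h0 : I 0 s)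
    (hstep : ∀ i < s.reg y, ∀ s', Keep (loop x y P) s s' → s'.reg x = i → I i s' →
      Runs P s' (c i) (I (i + 1))) :
    Runs (loop x y P) s (∑ i ∈ Finset.range (s.reg y), (c i + 8) + 6) (I (s.reg y)) := by
  have h1 := Runs.while_count (P := .seq P (.setReg x (.add (.reg x) (.lit 1))))
    (b := .not (.nle (.reg y) (.reg x))) (s.reg y)
    (fun i s' => (Keep (loop x y P) s s' ∧ s'.reg x = i) ∧ I i s') (fun i => c i + 4)
    (s := s.setR x 0) ?_ ?_ ?_
  · obtain ⟨t, s', ht, he, hs'⟩ := h1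
    refine ⟨_, s', ?_, Exec.seq (Exec.setReg x (.lit 0) s) he, hs'.2⟩
    have : ∑ i ∈ Finset.range (s.reg y),
        ((Test.not (.nle (.reg y) (.reg x))).cost + (c i + 4)) =
        ∑ i ∈ Finset.range (s.reg y), (c i + 8) :=
      Finset.sum_congr rfl fun i _ => by simp only [Test.cost, NExpr.cost]; omega
    rw [this] at ht
    simp only [Test.cost, NExpr.cost] at ht ⊢
    omega
  · refine ⟨⟨⟨fun z hz => ?_, fun _ _ => rfl, fun _ _ => rfl⟩, by simp⟩, hI _ _ _ h0⟩
    simp only [modR_loop, not_or] at hz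
    simp [hz.1]
  · rintro i hi s' ⟨⟨hk, hix⟩, hIi⟩
    have hy' : s'.reg y = s.reg y := hk.reg y (by simp [hxy.symm, hy])
    refine ⟨by simp [hix, hy', hi], ?_⟩
    refine Runs.seq (hstep i hi s' hk hix hIi) fun s'' hk'' hI'' => ?_
    refine ⟨_, _, le_rfl, Exec.setReg _ _ _, ⟨⟨fun z hz => ?_, fun z hz => ?_, fun z hz => ?_⟩, ?_⟩, ?_⟩
    · simp only [modR_loop, not_or] at hz
      simp only [Function.update_apply, hz.1, if_false]
      rw [hk''.reg z hz.2, hk.reg z (by simp [hz])]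
    · simp only [modN_loop] at hz
      exact (hk''.narr z hz).trans (hk.narr z (by simp [hz]))
    · simp only [modX_loop] at hz
      exact (hk''.rarr z hz).trans (hk.rarr z (by simp [hz]))
    · simp [hk''.reg x hx, hix]
    · exact hI _ _ _ hI''
  · rintro s' ⟨⟨hk, hix⟩, -⟩
    have hy' : s'.reg y = s.reg y := hk.reg y (by simp [hxy.symm, hy])
    simp [hix, hy']

/-- A loop with a uniform bound for the cost of its iterations. -/
theorem Runs.loop {x y : ℕ} {P : Prog} {s : State} {C : ℕ} {Q : State → Prop} (N : ℕ)
    (I : ℕ → State → Prop) (c : ℕ) (hN : s.reg y = N)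
    (hxy : x ≠ y) (hx : ¬ P.ModR x) (hy : ¬ P.ModR y)
    (hI : ∀ i s v, I i s → I i (s.setR x v)) (h0 : I 0 s)
    (hstep : ∀ i < N, ∀ s', Keep (InverseCompound.loop x y P) s s' → s'.reg x = i →
      I i s' → Runs P s' c (I (i + 1)))
    (hC : N * (c + 8) + 6 ≤ C)
    (hQ : ∀ s', Keep (InverseCompound.loop x y P) s s' → I N s' → Q s') :
    Runs (InverseCompound.loop x y P) s C Q := by
  subst hN
  refine (Runs.loop_sum I (fun _ => c) hxy hx hy hI h0 hstep).mono ?_ hQ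
  simpa using hC

/-- A loop with a loop-free body. -/
theorem Runs.simpleLoop {x y : ℕ} {P : Prog} {s : State} {C : ℕ} {Q : State → Prop} (N : ℕ)
    (I : ℕ → State → Prop) (hN : s.reg y = N) (hP : P.LoopFree)
    (hxy : x ≠ y) (hx : ¬ P.ModR x) (hy : ¬ P.ModR y)
    (hI : ∀ i s v, I i s → I i (s.setR x v)) (h0 : I 0 s)
    (hstep : ∀ i < N, ∀ s', Keep (InverseCompound.loop x y P) s s' → s'.reg x = i →
      I i s' → I (i + 1) (P.run s'))
    (hC : N * (P.steps + 8) + 6 ≤ C)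
    (hQ : ∀ s', Keep (InverseCompound.loop x y P) s s' → I N s' → Q s') :
    Runs (InverseCompound.loop x y P) s C Q :=
  Runs.loop N I P.steps hN hxy hx hy hI h0
    (fun i hi s' hk hx h => Runs.loopFree hP le_rfl (hstep i hi s' hk hx h)) hC hQ

theorem Runs.loopFree_seq {P P' : Prog} {s : State} {c : ℕ} {Q : State → Prop} (hP : P.LoopFree)
    (h : Runs P' (P.run s) c Q) : Runs (P.seq P') s (P.steps + c) Q :=
  let ⟨_, ht, he⟩ := P.exec_run hP s
  let ⟨_, s', ht', he', hq⟩ := h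
  ⟨_, s', add_le_add ht ht', he.seq he', hq⟩

theorem Runs.le {P : Prog} {s : State} {c c' : ℕ} {Q : State → Prop} (h : Runs P s c Q)
    (hc : c ≤ c') : Runs P s c' Q :=
  h.mono hc fun _ _ h => h

end InverseCompound

namespace MinorExchange

/-! ### Minors and the structure of a matrix around a nonzero minor -/

open Matrix Function

section Minors

variable {n m k : ℕ}

/-- A basis of the row space can be chosen among the rows; any `k` of its members, listed in
increasing order, stay independent. -/
theorem exists_strictMono_rank_rows (A : Matrix (Fin n) (Fin m) ℝ) (h : k ≤ A.rank) :
    ∃ I : Fin k → Fin n, StrictMono I ∧ LinearIndependent ℝ (A.submatrix I id).row := by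
  obtain ⟨κ, a, ha, hspan, hli⟩ := exists_linearIndependent' ℝ A.row
  have : Finite κ := Finite.of_injective a ha
  have := Fintype.ofFinite κ
  have hcard : Fintype.card κ = A.rank := by
    rw [A.rank_eq_finrank_span_row, ← hspan, finrank_span_eq_card hli]
  obtain ⟨t, ht⟩ := Finset.exists_subset_card_eq (s := Finset.univ.map ⟨a, ha⟩)
    (n := k) (by simpa [hcard] using h)
  refine ⟨t.orderEmbOfFin ht.2, (t.orderEmbOfFin ht.2).strictMono, ?_⟩
  have hmem : ∀ i, ∃ j, a j = t.orderEmbOfFin ht.2 i := fun i => by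
    simpa using ht.1 (t.orderEmbOfFin_mem ht.2 i)
  choose g hg using hmem
  have hginj : Injective g := fun i j hij => (t.orderEmbOfFin ht.2).injective <| by
    rw [← hg, ← hg, hij]
  have := hli.comp g hginj
  have heq : (A.submatrix (t.orderEmbOfFin ht.2) id).row = (A.row ∘ a) ∘ g := by
    funext i
    simp only [Function.comp_apply, hg]
    rfl
  rw [heq]
  exact this

/-- Independent rows are selected first, and then independent columns of these rows, by the same
lemma for the transpose. -/
theorem exists_minor_ne_zero (A : Matrix (Fin n) (Fin m) ℝ) (h : k ≤ A.rank) :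
    ∃ (I : Fin k → Fin n) (J : Fin k → Fin m), StrictMono I ∧ StrictMono J ∧
      (A.submatrix I J).det ≠ 0 := by
  obtain ⟨I, hI, hli⟩ := exists_strictMono_rank_rows A h
  have hr : ((A.submatrix I id)ᵀ).rank = k := by
    rw [rank_transpose, hli.rank_matrix, Fintype.card_fin]
  obtain ⟨J, hJ, hli'⟩ := exists_strictMono_rank_rows (A.submatrix I id)ᵀ hr.ge
  refine ⟨I, J, hI, hJ, ?_⟩
  have h2 := (linearIndependent_rows_iff_isUnit (A := (A.submatrix I J)ᵀ)).1 hli'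
  rw [isUnit_iff_isUnit_det, det_transpose] at h2
  exact h2.ne_zero

variable (A : Matrix (Fin n) (Fin m) ℝ) (I : Fin k → Fin n) (J : Fin k → Fin m)

/-- The coordinates of the rows of `A` restricted to the columns `J`, relative to the rows `I`. -/
noncomputable def rowCoord : Matrix (Fin n) (Fin k) ℝ :=
  of fun x a => (A.submatrix (update I a x) J).det / (A.submatrix I J).det

/-- The coordinates of the columns of `A` restricted to the rows `I`, relative to the columns
`J`. -/
noncomputable def colCoord : Matrix (Fin k) (Fin m) ℝ :=
  of fun b y => (A.submatrix I (update J b y)).det / (A.submatrix I J).det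

/-- The deviation of `A` from the matrix of rank `k` with the same rows `I` and columns `J`. -/
noncomputable def residue : Matrix (Fin n) (Fin m) ℝ :=
  A - rowCoord A I J * A.submatrix I J * colCoord A I J

/-- A combination of minors of order `k` that factorizes, see `exchange_eq`. -/
noncomputable def exchange (x : Fin n) (a : Fin k) (y : Fin m) (b : Fin k) : ℝ :=
  (A.submatrix (update I a x) (update J b y)).det / (A.submatrix I J).det -
    rowCoord A I J x a * colCoord A I J b y

theorem colCoord_eq_transpose : colCoord A I J = (rowCoord Aᵀ J I)ᵀ := by
  ext b y
  simp only [colCoord, rowCoord, of_apply, transpose_apply]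
  rw [← det_transpose, transpose_submatrix, ← det_transpose (A.submatrix I J),
    transpose_submatrix]

variable {A I J}

/-- Cramer's rule: the numerator is the determinant of F = A[I,J] with row `a` replaced by row `x`
of A[·,J], so `rowCoord` is A[·,J] F⁻¹. -/
theorem rowCoord_mul (hD : (A.submatrix I J).det ≠ 0) :
    rowCoord A I J * A.submatrix I J = A.submatrix id J := by
  have h : rowCoord A I J = A.submatrix id J * (A.submatrix I J)⁻¹ := by
    ext x a
    have h1 : A.submatrix (update I a x) J = (A.submatrix I J).updateRow a (fun l => A x (J l)) := by
      ext i j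
      by_cases h : i = a
      · subst h; simp
      · simp [h]
    rw [rowCoord, of_apply, h1, ← cramer_transpose_apply, cramer_eq_adjugate_mulVec,
      ← adjugate_transpose, mulVec_transpose, inv_def, Matrix.mul_smul, Matrix.smul_apply,
      Ring.inverse_eq_inv', smul_eq_mul, div_eq_inv_mul]
    rfl
  rw [h, Matrix.mul_assoc, nonsing_inv_mul _ (isUnit_iff_ne_zero.2 hD), Matrix.mul_one]

theorem mul_colCoord (hD : (A.submatrix I J).det ≠ 0) :
    A.submatrix I J * colCoord A I J = A.submatrix I id := by
  have h := rowCoord_mul (A := Aᵀ) (I := J) (J := I)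
    (by rwa [← transpose_submatrix, det_transpose])
  rw [colCoord_eq_transpose, ← transpose_inj, transpose_mul, transpose_transpose,
    transpose_submatrix, h, transpose_submatrix]

theorem residue_of_mem_rows (hD : (A.submatrix I J).det ≠ 0) (c : Fin k) (y : Fin m) :
    residue A I J (I c) y = 0 := by
  have h1 : (A.submatrix I J * colCoord A I J) c y = A (I c) y := by rw [mul_colCoord hD]; rfl
  rw [residue, rowCoord_mul hD, Matrix.sub_apply, sub_eq_zero, ← h1]
  rfl

theorem residue_of_mem_cols (hD : (A.submatrix I J).det ≠ 0) (x : Fin n) (c : Fin k) :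
    residue A I J x (J c) = 0 := by
  have h1 : (rowCoord A I J * A.submatrix I J) x c = A x (J c) := by rw [rowCoord_mul hD]; rfl
  rw [residue, Matrix.mul_assoc, mul_colCoord hD, Matrix.sub_apply, sub_eq_zero, ← h1]
  rfl

/-- This entry is the cofactor obtained by deleting row `a` and column `b`, so it does not see
column `b`. -/
theorem adjugate_updateCol_self (F : Matrix (Fin k) (Fin k) ℝ) (a b : Fin k) (v : Fin k → ℝ) :
    (F.updateCol b v).adjugate b a = F.adjugate b a := by
  rw [← transpose_apply (F.updateCol b v).adjugate, ← transpose_apply F.adjugate,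
    adjugate_transpose, adjugate_transpose, adjugate_apply, adjugate_apply,
    ← updateRow_transpose, updateRow_idem]

/-- The product `M₀` of F with two modified identity matrices has determinant Y_{xa} · det F ·
Z_{by}. The exchanged submatrix differs from `M₀` only in the position (a, b), where it is larger by
the residue at (x, y). The determinant is affine in this entry, with slope the cofactor of F, and
dividing by det F gives the claim. -/
theorem exchange_eq (hD : (A.submatrix I J).det ≠ 0) (x : Fin n) (a : Fin k) (y : Fin m)
    (b : Fin k) :
    exchange A I J x a y b = residue A I J x y * (A.submatrix I J)⁻¹ b a := by
  set F := A.submatrix I J with hF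
  set Y := rowCoord A I J
  set Z := colCoord A I J
  have hY := rowCoord_mul hD
  have hZ := mul_colCoord hD
  set M₀ := (1 : Matrix (Fin k) (Fin k) ℝ).updateRow a (Y x) * F *
    (1 : Matrix (Fin k) (Fin k) ℝ).updateCol b (fun c => Z c y) with hM₀
  have hE : (1 : Matrix (Fin k) (Fin k) ℝ).updateRow a (Y x) * F =
      F.updateRow a (fun d => A x (J d)) := by
    rw [updateRow_mul, Matrix.one_mul]
    congr 1
    funext d
    exact congrFun (congrFun hY x) d
  -- The entry (a, b) of `M₀` is that of Y F Z at (x, y), hence `A x y` minus the residue.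
  have hE' : M₀ = (F.updateRow a (fun d => A x (J d))).updateCol b
      (fun c => if c = a then A x y - residue A I J x y else A (I c) y) := by
    rw [hM₀, hE, mul_updateCol, Matrix.mul_one]
    congr 1
    funext c
    by_cases h : c = a
    · subst h
      simp only [if_true, residue, Matrix.sub_apply, sub_sub_cancel, hY]
      simp [mulVec, dotProduct, Matrix.mul_apply]
      rfl
    · simp only [h, if_false]
      have := congrFun (congrFun hZ c) y
      simp only [submatrix_apply, id_eq] at this
      rw [← this, Matrix.mul_apply]
      simp [mulVec, dotProduct, h]
      rfl
  have hdet : M₀.det = Y x a * F.det * Z b y := by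
    rw [hM₀, det_mul, det_mul]
    congr 1
    · congr 1
      rw [← cramer_transpose_apply]; simp
    · rw [← cramer_apply]; simp
  have hM : A.submatrix (update I a x) (update J b y) =
      M₀.updateRow a (M₀ a + residue A I J x y • Pi.single b 1) := by
    rw [hE']
    ext i j
    by_cases h : i = a <;> by_cases h' : j = b
    · subst h; subst h'; simp
    · subst h; simp [h']
    · subst h'; simp [h]
    · simp [h, h', hF]
  -- `M₀` and F agree outside row `a` and column `b`, which the cofactor ignores.
  have hadj : M₀.adjugate b a = F.adjugate b a := by
    rw [hE', adjugate_updateCol_self, ← adjugate_updateCol_self F a b 0, adjugate_updateCol_self,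
      adjugate_apply, adjugate_apply, updateRow_idem]
  rw [exchange, hM, det_updateRow_add, det_updateRow_smul, updateRow_eq_self,
    ← adjugate_apply, hadj, hdet, inv_def, Matrix.smul_apply, Ring.inverse_eq_inv', smul_eq_mul]
  change (Y x a * F.det * Z b y + residue A I J x y * F.adjugate b a) / F.det - Y x a * Z b y =
    residue A I J x y * (F.det⁻¹ * F.adjugate b a)
  field_simp
  ring

/-- The columns `J` already span the column space, so A = A[·,J] X for some X. Restricting to the
rows `I` gives F X = A[I,·], which forces X = Z, and then Y F Z = A[·,J] Z = A. -/
theorem residue_eq_zero (hD : (A.submatrix I J).det ≠ 0) (hr : A.rank = k) :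
    residue A I J = 0 := by
  have hdet : IsUnit (A.submatrix I J).det := isUnit_iff_ne_zero.2 hD
  have hJ : (A.submatrix id J).rank = k := by
    refine le_antisymm (by simpa using (A.submatrix id J).rank_le_card_width) ?_
    have h := (A.submatrix id J).rank_submatrix_le I (Equiv.refl _)
    rw [submatrix_submatrix] at h
    simpa [rank_of_det_ne_zero hD] using h
  have hspan : Submodule.span ℝ (Set.range (A.submatrix id J).col) =
      Submodule.span ℝ (Set.range A.col) := by
    refine Submodule.eq_of_le_of_finrank_le (Submodule.span_mono ?_) ?_
    · rintro _ ⟨b, rfl⟩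
      exact ⟨J b, rfl⟩
    · rw [← rank_eq_finrank_span_cols, ← rank_eq_finrank_span_cols, hJ, hr]
  have hX : ∀ y, ∃ v, A.submatrix id J *ᵥ v = A.col y := fun y => by
    have h : A.col y ∈ Submodule.span ℝ (Set.range (A.submatrix id J).col) := by
      rw [hspan]; exact Submodule.subset_span ⟨y, rfl⟩
    rw [← range_mulVecLin] at h
    exact h
  choose X hX using hX
  have hAX : A.submatrix id J * (of X)ᵀ = A := by
    ext x y
    exact congrFun (hX y) x
  have hZX : colCoord A I J = (of X)ᵀ := by
    have h : A.submatrix I J * (of X)ᵀ = A.submatrix I id := by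
      conv_rhs => rw [← hAX]
      rfl
    rw [← mul_colCoord hD] at h
    rw [← nonsing_inv_mul_cancel_left _ (of X)ᵀ hdet, h, nonsing_inv_mul_cancel_left _ _ hdet]
  rw [residue, rowCoord_mul hD, hZX, hAX, sub_self]

/-- A vanishing residue would factor A through dimension `k`, against the rank; F⁻¹ is nonzero
because `k` is positive. By `exchange_eq` a nonzero entry of each can be picked independently. -/
theorem exists_exchange_ne_zero (hD : (A.submatrix I J).det ≠ 0) (hk : 0 < k) (hr : k < A.rank) :
    ∃ x a y b, exchange A I J x a y b ≠ 0 := by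
  have h1 : residue A I J ≠ 0 := fun h => by
    rw [residue, sub_eq_zero, Matrix.mul_assoc] at h
    have h2 := (rank_mul_le_left (rowCoord A I J) (A.submatrix I J * colCoord A I J)).trans
      (rank_le_card_width _)
    rw [← h, Fintype.card_fin] at h2
    omega
  obtain ⟨x, y, hxy⟩ : ∃ x y, residue A I J x y ≠ 0 := by
    by_contra! h; exact h1 (by ext x y; simp [h])
  obtain ⟨b, a, hba⟩ : ∃ b a, (A.submatrix I J)⁻¹ b a ≠ 0 := by
    by_contra! h
    have h0 : (A.submatrix I J)⁻¹ = 0 := by ext x y; simp [h]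
    have h2 := mul_nonsing_inv _ (isUnit_iff_ne_zero.2 hD)
    have h3 := congrFun (congrFun h2 ⟨0, hk⟩) ⟨0, hk⟩
    simp [h0] at h3
  exact ⟨x, a, y, b, by rw [exchange_eq hD]; exact mul_ne_zero hxy hba⟩

/-! ### Reconstruction from minors -/

/-- The matrix `residue · (F⁻¹)ᵦₐ`, as a matrix in `b`, `a`. -/
noncomputable def exchangeBlock (A : Matrix (Fin n) (Fin m) ℝ) (I : Fin k → Fin n)
    (J : Fin k → Fin m) (x : Fin n) (y : Fin m) : Matrix (Fin k) (Fin k) ℝ :=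
  of fun b a => exchange A I J x a y b

/-- A matrix proportional to `A`. -/
noncomputable def direction (A : Matrix (Fin n) (Fin m) ℝ) (I : Fin k → Fin n)
    (J : Fin k → Fin m) (x₀ : Fin n) (a₀ : Fin k) (y₀ : Fin m) (b₀ : Fin k) :
    Matrix (Fin n) (Fin m) ℝ :=
  rowCoord A I J * (exchangeBlock A I J x₀ y₀)⁻¹ * colCoord A I J +
    of fun x y => exchange A I J x a₀ y b₀ / exchange A I J x₀ a₀ y₀ b₀

/-- Take ρ to be the residue R at (x₀, y₀). The block is ρ F⁻¹, with inverse ρ⁻¹ F and determinant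
ρ^k / det F; quotients of exchanges with common a₀, b₀ cancel F⁻¹ and leave R/ρ. So `direction` is
ρ⁻¹ (Y F Z + R) = ρ⁻¹ A, although it is built from minors of order `k` alone. -/
theorem eq_smul_direction (hD : (A.submatrix I J).det ≠ 0) {x₀ : Fin n} {a₀ : Fin k}
    {y₀ : Fin m} {b₀ : Fin k} (h₀ : exchange A I J x₀ a₀ y₀ b₀ ≠ 0) :
    (exchangeBlock A I J x₀ y₀).det ≠ 0 ∧ ∃ ρ : ℝ, ρ ≠ 0 ∧
      ρ ^ k = (A.submatrix I J).det * (exchangeBlock A I J x₀ y₀).det ∧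
      A = ρ • direction A I J x₀ a₀ y₀ b₀ := by
  have hu : IsUnit (A.submatrix I J).det := isUnit_iff_ne_zero.2 hD
  have hW : exchangeBlock A I J x₀ y₀ = residue A I J x₀ y₀ • (A.submatrix I J)⁻¹ := by
    ext b a
    simp [exchangeBlock, exchange_eq hD]
  have h₁ := h₀
  rw [exchange_eq hD] at h₁
  have hρ : residue A I J x₀ y₀ ≠ 0 := left_ne_zero_of_mul h₁
  have hba := right_ne_zero_of_mul h₁
  have hdet : (exchangeBlock A I J x₀ y₀).det =
      residue A I J x₀ y₀ ^ k * (A.submatrix I J).det⁻¹ := by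
    rw [hW, det_smul, det_nonsing_inv, Fintype.card_fin, Ring.inverse_eq_inv']
  refine ⟨by rw [hdet]; positivity, _, hρ, by rw [hdet]; field_simp, ?_⟩
  have hinv : (exchangeBlock A I J x₀ y₀)⁻¹ = (residue A I J x₀ y₀)⁻¹ • A.submatrix I J := by
    apply inv_eq_right_inv
    rw [hW, Matrix.smul_mul, Matrix.mul_smul, smul_smul, mul_inv_cancel₀ hρ, one_smul,
      nonsing_inv_mul _ hu]
  have hQ : (of fun x y => exchange A I J x a₀ y b₀ / exchange A I J x₀ a₀ y₀ b₀) =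
      (residue A I J x₀ y₀)⁻¹ • residue A I J := by
    ext x y
    simp only [of_apply, exchange_eq hD, Matrix.smul_apply, smul_eq_mul]
    field_simp
  rw [direction, hinv, hQ, Matrix.mul_smul, Matrix.smul_mul, ← smul_add, smul_smul,
    mul_inv_cancel₀ hρ, one_smul, residue]
  abel

end Minors

end MinorExchange

namespace InverseCompound

/-! ### Compounds -/

open Matrix

section Compound

variable {n m k : ℕ}

theorem mem_incTuples {v : Lex (Fin k → Fin n)} :
    v ∈ incTuples n k ↔ StrictMono (ofLex v) := by
  simp [incTuples]

theorem tuple_strictMono (i : Fin (n.choose k)) : StrictMono (tuple n k i) :=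
  mem_incTuples.1 ((incTuples n k).orderEmbOfFin_mem (card_incTuples n k) i)

theorem exists_tuple_eq {v : Fin k → Fin n} (hv : StrictMono v) : ∃ i, tuple n k i = v := by
  have h : toLex v ∈ Set.range ((incTuples n k).orderEmbOfFin (card_incTuples n k)) := by
    rw [Finset.range_orderEmbOfFin]
    exact mem_incTuples.2 hv
  obtain ⟨i, hi⟩ := h
  exact ⟨i, by rw [tuple, hi]; rfl⟩

theorem det_submatrix_eq_zero_of_not_injective {R : Type*} [CommRing R]
    (A : Matrix (Fin n) (Fin m) R) {I : Fin k → Fin n} (hI : ¬ Function.Injective I)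
    (J : Fin k → Fin m) : (A.submatrix I J).det = 0 := by
  rw [Function.not_injective_iff] at hI
  obtain ⟨a, b, hab, hne⟩ := hI
  exact det_zero_of_row_eq hne (by ext j; simp [hab])

theorem exists_perm_strictMono {I : Fin k → Fin n} (hI : Function.Injective I) :
    ∃ σ : Equiv.Perm (Fin k), StrictMono (I ∘ σ) :=
  ⟨Tuple.sort I, (Tuple.monotone_sort I).strictMono_of_injective
    (hI.comp (Tuple.sort I).injective)⟩

/-- Exchanged tuples need not be increasing. A repeated index makes the minor vanish; otherwise
sorting rows and columns reduces it, up to sign, to an entry of the compound. -/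
theorem minor_eq_of_compound_eq {A B : Matrix (Fin n) (Fin m) ℝ}
    (h : compound k A = compound k B) (I : Fin k → Fin n) (J : Fin k → Fin m) :
    (A.submatrix I J).det = (B.submatrix I J).det := by
  by_cases hI : Function.Injective I
  swap
  · rw [det_submatrix_eq_zero_of_not_injective _ hI, det_submatrix_eq_zero_of_not_injective _ hI]
  by_cases hJ : Function.Injective J
  swap
  · rw [← det_transpose, transpose_submatrix, ← det_transpose (B.submatrix I J),
      transpose_submatrix, det_submatrix_eq_zero_of_not_injective _ hJ,
      det_submatrix_eq_zero_of_not_injective _ hJ]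
  obtain ⟨σ, hσ⟩ := exists_perm_strictMono hI
  obtain ⟨τ, hτ⟩ := exists_perm_strictMono hJ
  obtain ⟨i, hi⟩ := exists_tuple_eq hσ
  obtain ⟨j, hj⟩ := exists_tuple_eq hτ
  have key : ∀ X : Matrix (Fin n) (Fin m) ℝ, (X.submatrix I J).det =
      (Equiv.Perm.sign σ : ℝ) * ((Equiv.Perm.sign τ : ℝ) * compound k X i j) := fun X => by
    have h1 : compound k X i j = (((X.submatrix I J).submatrix σ id).submatrix id τ).det := by
      simp [compound, hi, hj, Function.comp_def]
    rw [h1, det_permute', det_permute, ← mul_assoc, ← mul_assoc]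
    rcases Int.units_eq_one_or (Equiv.Perm.sign σ) with h | h <;>
    rcases Int.units_eq_one_or (Equiv.Perm.sign τ) with h' | h' <;> simp [h, h']
  rw [key, key, h]

theorem eq_one_or_neg_one_of_pow_eq {k : ℕ} (hk : k ≠ 0) {c : ℝ} (hc : c ^ k = 1) :
    (c = 1 ∨ c = -1) ∧ (Odd k → c = 1) := by
  have h1 : |c| ^ k = 1 := by rw [← abs_pow, hc, abs_one]
  have h2 : |c| = 1 := (pow_eq_one_iff_of_nonneg (abs_nonneg c) hk).1 h1
  have h3 := eq_or_eq_neg_of_abs_eq h2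
  refine ⟨h3, fun hodd => ?_⟩
  rcases h3 with h | h
  · exact h
  · rw [h, hodd.neg_one_pow] at hc
    norm_num at hc

/-- All ingredients of `eq_smul_direction` agree for A and B, so both are multiples ρ, ρ' of one
matrix with ρ^k = ρ'^k, and ρ'/ρ is a real root of unity. -/
theorem compound_unique {A B : Matrix (Fin n) (Fin m) ℝ} (hk : 1 ≤ k) (hr : k < A.rank)
    (h : compound k A = compound k B) :
    (Odd k → B = A) ∧ (Even k → B = A ∨ B = -A) := by
  obtain ⟨I, J, -, -, hD⟩ := MinorExchange.exists_minor_ne_zero A hr.le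
  obtain ⟨x, a, y, b, h0⟩ := MinorExchange.exists_exchange_ne_zero hD hk hr
  have hAB := minor_eq_of_compound_eq h
  have hrow : MinorExchange.rowCoord A I J = MinorExchange.rowCoord B I J := by
    ext x a; simp [MinorExchange.rowCoord, hAB]
  have hcol : MinorExchange.colCoord A I J = MinorExchange.colCoord B I J := by
    ext x a; simp [MinorExchange.colCoord, hAB]
  have hex : MinorExchange.exchange A I J = MinorExchange.exchange B I J := by
    ext x a y b; simp [MinorExchange.exchange, hAB, hrow, hcol]
  have hdir : MinorExchange.direction A I J = MinorExchange.direction B I J := by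
    ext x a; simp [MinorExchange.direction, MinorExchange.exchangeBlock, hex, hrow, hcol]
  have hblock : MinorExchange.exchangeBlock A I J = MinorExchange.exchangeBlock B I J := by
    ext x a; simp [MinorExchange.exchangeBlock, hex]
  obtain ⟨hW, ρ, hρ, hpow, hA⟩ := MinorExchange.eq_smul_direction hD h0
  obtain ⟨-, ρ', hρ', hpow', hB⟩ := MinorExchange.eq_smul_direction
    (A := B) (by rwa [← hAB]) (by rwa [← hex])
  rw [← hAB, ← hblock, ← hpow] at hpow'
  rw [← hdir] at hB
  have hc : (ρ' / ρ) ^ k = 1 := by rw [div_pow, hpow', div_self (pow_ne_zero _ hρ)]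
  obtain ⟨h1, h2⟩ := eq_one_or_neg_one_of_pow_eq (by omega) hc
  have hB' : B = (ρ' / ρ) • A := by
    conv_rhs => rw [hA]
    rw [smul_smul, div_mul_cancel₀ _ hρ]
    exact hB
  refine ⟨fun hodd => by rw [hB', h2 hodd, one_smul], fun _ => ?_⟩
  rcases h1 with h | h
  · left; rw [hB', h, one_smul]
  · right; rw [hB', h, neg_one_smul]

/-- Here A = Y F Z. A minor of order `k` of Y X Z is a product of three `k × k` determinants, in
which X enters only through its own. -/
theorem compound_eq_of_rank_eq {A : Matrix (Fin n) (Fin m) ℝ} (hr : A.rank = k)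
    {I : Fin k → Fin n} {J : Fin k → Fin m} (hD : (A.submatrix I J).det ≠ 0)
    {G : Matrix (Fin k) (Fin k) ℝ} (hG : G.det = (A.submatrix I J).det) :
    compound k (MinorExchange.rowCoord A I J * G * MinorExchange.colCoord A I J) =
      compound k A := by
  have hA := MinorExchange.residue_eq_zero hD hr
  rw [MinorExchange.residue, sub_eq_zero] at hA
  have key : ∀ (X : Matrix (Fin k) (Fin k) ℝ) (i : Fin (n.choose k)) (j : Fin (m.choose k)),
      compound k (MinorExchange.rowCoord A I J * X * MinorExchange.colCoord A I J) i j =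
      ((MinorExchange.rowCoord A I J).submatrix (tuple n k i) id).det * X.det *
      ((MinorExchange.colCoord A I J).submatrix id (tuple m k j)).det := fun X i j => by
    rw [compound, of_apply, ← det_mul, ← det_mul]
    rfl
  ext i j
  conv_rhs => rw [hA]
  rw [key, key, hG]

/-- The increasing tuple `I` arises from the increasing tuple `I₀` by exchanging the entry number
`a` for `x`, which becomes the entry number `b`. -/
structure Exchanged (I₀ I : Fin k → Fin n) (a : Fin k) (x : Fin n) (b : Fin k) : Prop where
  new : I b = x
  notMem : ∀ c, I₀ c ≠ x
  old : ∀ c, c ≠ b → ∃ d, d ≠ a ∧ I₀ d = I c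

/-- After deletion of the new and of the lost entry, both tuples are increasing, and one range is
contained in the other of equal size. -/
theorem Exchanged.comp_succAbove {k : ℕ} {I₀ I : Fin (k + 1) → Fin n} {a b : Fin (k + 1)}
    {x : Fin n} (hI₀ : StrictMono I₀) (hI : StrictMono I) (h : Exchanged I₀ I a x b) :
    I ∘ b.succAbove = I₀ ∘ a.succAbove := by
  have hsub : Set.range (I ∘ b.succAbove) ⊆ Set.range (I₀ ∘ a.succAbove) := by
    rintro _ ⟨c, rfl⟩
    obtain ⟨d, hd, hdc⟩ := h.old _ (Fin.succAbove_ne b c)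
    obtain ⟨e, rfl⟩ := Fin.exists_succAbove_eq hd
    exact ⟨e, hdc⟩
  have h1 : StrictMono (I ∘ b.succAbove) := hI.comp (Fin.strictMono_succAbove b)
  have h2 : StrictMono (I₀ ∘ a.succAbove) := hI₀.comp (Fin.strictMono_succAbove a)
  refine (h1.range_inj h2).1 (Set.eq_of_subset_of_ncard_le hsub ?_)
  rw [← Set.image_univ, ← Set.image_univ, Set.ncard_image_of_injective _ h1.injective,
    Set.ncard_image_of_injective _ h2.injective]

theorem Exchanged.ne {I₀ I : Fin k → Fin n} {a b : Fin k} {x : Fin n} (hI₀ : StrictMono I₀)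
    (h : Exchanged I₀ I a x b) (c : Fin k) : I c ≠ I₀ a := by
  by_cases hc : c = b
  · rw [hc, h.new]
    exact (h.notMem a).symm
  · obtain ⟨d, hd, hdc⟩ := h.old c hc
    rw [← hdc]
    exact fun h' => hd (hI₀.injective h')

/-- Thus one tuple contributes at most one cell to the tables of exchanges. -/
theorem Exchanged.unique {I₀ I : Fin k → Fin n} {a b a' b' : Fin k} {x x' : Fin n}
    (hI₀ : StrictMono I₀) (hI : StrictMono I) (h : Exchanged I₀ I a x b)
    (h' : Exchanged I₀ I a' x' b') : a' = a ∧ x' = x ∧ b' = b := by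
  have hb : b' = b := by
    by_contra hne
    obtain ⟨d, -, hd⟩ := h.old b' hne
    exact h'.notMem d (hd.trans h'.new)
  refine ⟨?_, by rw [← h.new, ← h'.new, hb], hb⟩
  by_contra hne
  obtain _ | k := k
  · exact a.elim0
  obtain ⟨e, he⟩ := Fin.exists_succAbove_eq hne
  have := congrFun (h.comp_succAbove hI₀ hI) e
  simp only [Function.comp_apply, he] at this
  exact h'.ne hI₀ _ this

/-- The criterion used by the program to recognize exchanges: if exactly one entry is new, then by
cardinality some base entry is lost, and any lost entry is the one exchanged. -/
theorem Exchanged.of_unique_new {I₀ I : Fin k → Fin n} (hI₀ : StrictMono I₀) (hI : StrictMono I)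
    {b : Fin k} (hb : ∀ c, I₀ c ≠ I b) (hold : ∀ c, c ≠ b → ∃ d, I₀ d = I c) :
    (∃ a, ∀ c, I c ≠ I₀ a) ∧ ∀ a, (∀ c, I c ≠ I₀ a) → Exchanged I₀ I a (I b) b := by
  refine ⟨?_, fun a ha => ⟨rfl, hb, fun c hc => ?_⟩⟩
  · by_contra! h
    have hsub : Set.range I₀ ⊆ Set.range I := by
      rintro _ ⟨a, rfl⟩
      obtain ⟨c, hc⟩ := h a
      exact ⟨c, hc⟩
    have heq := Set.eq_of_subset_of_ncard_le hsub (by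
      rw [← Set.image_univ, ← Set.image_univ, Set.ncard_image_of_injective _ hI.injective,
        Set.ncard_image_of_injective _ hI₀.injective])
    obtain ⟨c, hc⟩ : I b ∈ Set.range I₀ := heq ▸ ⟨b, rfl⟩
    exact hb c hc
  · obtain ⟨d, hd⟩ := hold c hc
    exact ⟨d, fun h => ha c (by rw [← h, hd]), hd⟩

/-- Laplace expansion along row `a` of one matrix and row `b` of the other: the complementary minors
coincide by `Exchanged.comp_succAbove`, so only the two position signs remain. -/
theorem Exchanged.det_eq {I₀ I : Fin k → Fin n} {a b : Fin k} {x : Fin n} (hI₀ : StrictMono I₀)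
    (hI : StrictMono I) (h : Exchanged I₀ I a x b) (A : Matrix (Fin n) (Fin m) ℝ)
    (J : Fin k → Fin m) :
    (A.submatrix (Function.update I₀ a x) J).det =
      ((-1) ^ (a : ℕ) * (-1) ^ (b : ℕ)) * (A.submatrix I J).det := by
  obtain _ | k := k
  · exact a.elim0
  have hcomp := h.comp_succAbove hI₀ hI
  rw [det_succ_row _ a, det_succ_row _ b, Finset.mul_sum]
  refine Finset.sum_congr rfl fun j _ => ?_
  have h3 : (A.submatrix (Function.update I₀ a x) J).submatrix a.succAbove j.succAbove =
      (A.submatrix I J).submatrix b.succAbove j.succAbove := by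
    ext c d
    have := congrFun hcomp c
    simp only [Function.comp_apply] at this
    simp [Fin.succAbove_ne, this]
  rw [h3]
  simp only [submatrix_apply, Function.update_self, h.new]
  have : ((-1 : ℝ) ^ (b : ℕ)) * (-1) ^ (b : ℕ) = 1 := by
    rw [← mul_pow]; norm_num
  rw [pow_add, pow_add]
  linear_combination (-(-1) ^ (a : ℕ) * (-1) ^ (j : ℕ) * A x (J j) *
    ((A.submatrix I J).submatrix b.succAbove j.succAbove).det) * this

/-- Every exchange can be carried out. -/
theorem exists_exchanged {I₀ : Fin k → Fin n} (hI₀ : StrictMono I₀) (a : Fin k) {x : Fin n}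
    (hx : ∀ c, I₀ c ≠ x) :
    ∃ (i : Fin (n.choose k)) (b : Fin k), Exchanged I₀ (tuple n k i) a x b := by
  have hinj : Function.Injective (Function.update I₀ a x) := by
    intro c d hcd
    by_cases hc : c = a <;> by_cases hd : d = a <;>
      simp only [Function.update_apply, hc, hd, if_true, if_false] at hcd ⊢
    · exact (hx _ hcd.symm).elim
    · exact (hx _ hcd).elim
    · exact hI₀.injective hcd
  obtain ⟨σ, hσ⟩ := exists_perm_strictMono hinj
  obtain ⟨i, hi⟩ := exists_tuple_eq hσ
  refine ⟨i, σ.symm a, by simp [hi], hx, fun c hc => ⟨σ c, fun h => hc (by simp [← h]), ?_⟩⟩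
  rw [hi, Function.comp_apply, Function.update_of_ne]
  exact fun h => hc (by simp [← h])

end Compound

end InverseCompound

namespace InverseCompound

/-! ### The lexicographic successor -/

section Successor

variable {n k : ℕ}

theorem strictMono_fin_add_le {v : Fin k → Fin n} (hv : StrictMono v) {c d : Fin k} (h : c ≤ d) :
    (v c : ℕ) + (d - c : ℕ) ≤ v d := by
  obtain ⟨e, he⟩ := Nat.exists_eq_add_of_le (Fin.le_def.1 h)
  obtain ⟨d, hd⟩ := d
  simp only at he
  subst he
  simp only [Nat.add_sub_cancel_left]
  induction e with
  | zero => rfl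
  | succ e ih =>
    have h1 := ih (by omega) (by simp [Fin.le_def])
    have h2 : v ⟨c + e, by omega⟩ < v ⟨c + (e + 1), hd⟩ := hv (by simp [Fin.lt_def])
    rw [Fin.lt_def] at h2
    omega

theorem strictMono_fin_add_card_le {v : Fin k → Fin n} (hv : StrictMono v) (c : Fin k) :
    (v c : ℕ) + k ≤ n + c := by
  have hc := c.2
  have h1 := strictMono_fin_add_le hv (c := c) (d := ⟨k - 1, by omega⟩) (by rw [Fin.le_def]; simp; omega)
  have h2 := (v ⟨k - 1, by omega⟩).2
  simp only at h1
  omega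

theorem tuple_lt_iff {i j : Fin (n.choose k)} :
    toLex (tuple n k i) < toLex (tuple n k j) ↔ i < j :=
  ((incTuples n k).orderEmbOfFin (card_incTuples n k)).lt_iff_lt

theorem tuple_le_iff {i j : Fin (n.choose k)} :
    toLex (tuple n k i) ≤ toLex (tuple n k j) ↔ i ≤ j :=
  ((incTuples n k).orderEmbOfFin (card_incTuples n k)).le_iff_le

theorem tuple_succ_eq {i : Fin (n.choose k)} {w : Fin k → Fin n} (hw : StrictMono w)
    (hlt : toLex (tuple n k i) < toLex w)
    (hle : ∀ u : Fin k → Fin n, StrictMono u → toLex (tuple n k i) < toLex u →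
      toLex w ≤ toLex u) :
    ∃ h : (i : ℕ) + 1 < n.choose k, tuple n k ⟨i + 1, h⟩ = w := by
  obtain ⟨j, rfl⟩ := exists_tuple_eq hw
  rw [tuple_lt_iff] at hlt
  have hj := j.2
  rw [Fin.lt_def] at hlt
  refine ⟨by omega, ?_⟩
  have h1 := hle (tuple n k ⟨i + 1, by omega⟩) (tuple_strictMono _)
    (tuple_lt_iff.2 (by simp [Fin.lt_def]))
  rw [tuple_le_iff, Fin.le_def] at h1
  congr 1
  ext
  simp only at h1 ⊢
  omega

/-- A later tuple would, at its first difference, exceed an entry that is already at its upper bound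
n − k + q. -/
theorem succ_eq_choose {i : Fin (n.choose k)}
    (hmax : ∀ q : Fin k, n + q ≤ (tuple n k i q : ℕ) + k) : (i : ℕ) + 1 = n.choose k := by
  by_contra hne
  have hi := i.2
  have h1 : toLex (tuple n k i) < toLex (tuple n k ⟨i + 1, by omega⟩) :=
    tuple_lt_iff.2 (by simp [Fin.lt_def])
  obtain ⟨q, -, hq⟩ := h1
  have h2 := strictMono_fin_add_card_le (tuple_strictMono (⟨i + 1, by omega⟩ : Fin (n.choose k))) q
  have h3 := hmax q
  have h4 : (tuple n k i q : ℕ) < tuple n k ⟨i + 1, by omega⟩ q := hq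
  omega

theorem tuple_zero (h : 0 < n.choose k) (c : Fin k) : (tuple n k ⟨0, h⟩ c : ℕ) = c := by
  have hkn : k ≤ n := by
    by_contra hlt
    rw [Nat.choose_eq_zero_of_lt (by omega)] at h
    omega
  obtain ⟨j, hj⟩ := exists_tuple_eq (v := fun c : Fin k => Fin.castLE hkn c)
    (fun c d hcd => by simpa using hcd)
  have h1 : toLex (tuple n k ⟨0, h⟩) ≤ toLex (tuple n k j) :=
    tuple_le_iff.2 (by simp [Fin.le_def])
  have h2 : toLex (tuple n k j) ≤ toLex (tuple n k ⟨0, h⟩) := by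
    rw [hj]
    refine Pi.toLex_monotone fun c => ?_
    have hc := c.2
    have := strictMono_fin_add_le (tuple_strictMono ⟨0, h⟩) (c := ⟨0, by omega⟩) (d := c)
      (by simp [Fin.le_def])
    rw [Fin.le_def]
    simp only [Fin.val_castLE] at this ⊢
    omega
  have h3 : tuple n k ⟨0, h⟩ = tuple n k j := toLex.injective (le_antisymm h1 h2)
  rw [h3, hj]
  rfl

/-- The tuple after the increasing tuple `v`, if the entry number `q` is the last one that can be
increased. -/
theorem tuple_succ {i : Fin (n.choose k)} {q : Fin k}
    (hq : (tuple n k i q : ℕ) + k < n + q)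
    (hmax : ∀ c, q < c → n + c ≤ (tuple n k i c : ℕ) + k) :
    ∃ h : (i : ℕ) + 1 < n.choose k, ∀ c, (tuple n k ⟨i + 1, h⟩ c : ℕ) =
      if c < q then (tuple n k i c : ℕ) else (tuple n k i q : ℕ) + (c - q : ℕ) + 1 := by
  set v := tuple n k i with hv
  have hvm : StrictMono v := tuple_strictMono i
  have hbound : ∀ c : Fin k, (if c < q then (v c : ℕ) else (v q : ℕ) + (c - q : ℕ) + 1) < n := by
    intro c
    have := c.2
    split_ifs
    · exact (v c).2
    · omega
  set w : Fin k → Fin n := fun c => ⟨_, hbound c⟩ with hwdef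
  have hwm : StrictMono w := by
    intro c d hcd
    simp only [hwdef, Fin.lt_def] at hcd ⊢
    by_cases h1 : (d : ℕ) < q
    · have := hvm hcd
      rw [Fin.lt_def] at this
      simp [h1, hcd.trans h1, this]
    · by_cases h2 : (c : ℕ) < q
      · have := hvm (show c < q from h2)
        rw [Fin.lt_def] at this
        simp only [h1, h2, if_true, if_false]
        omega
      · simp only [h1, h2, if_false]
        omega
  have hlt : toLex v < toLex w := by
    refine ⟨q, fun c hc => ?_, ?_⟩
    · change v c = w c
      change c < q at hc
      ext
      simp [hwdef, hc]
    · change v q < w q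
      rw [Fin.lt_def]
      simp [hwdef]
  -- Let `d` be the first place where `u` exceeds the old tuple. Before `q`, already `w` is smaller
  -- there; at `q`, the tuple `w` starts one higher and grows by the minimal step 1; beyond `q`, the
  -- old entry is maximal and cannot be exceeded.
  have hle : ∀ u : Fin k → Fin n, StrictMono u → toLex v < toLex u → toLex w ≤ toLex u := by
    rintro u hu ⟨d, hd1, hd2⟩
    change ∀ j, j < d → v j = u j at hd1
    change v d < u d at hd2
    rcases lt_trichotomy d q with h | h | h
    · refine le_of_lt ⟨d, fun c hc => ?_, ?_⟩
      · change w c = u c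
        rw [← hd1 c hc]
        ext
        simp [hwdef, (show c < d from hc).trans h]
      · change w d < u d
        rw [Fin.lt_def] at hd2 ⊢
        simpa [hwdef, h] using hd2
    · subst h
      refine Pi.toLex_monotone fun c => ?_
      rw [Fin.le_def]
      by_cases hc : c < d
      · simp [hwdef, hc, hd1 c hc]
      · have := strictMono_fin_add_le hu (not_lt.1 hc)
        rw [Fin.lt_def] at hd2
        simp only [hwdef, hc, if_false]
        omega
    · have h1 := hmax d h
      have h2 := strictMono_fin_add_card_le hu d
      rw [Fin.lt_def] at hd2
      omega
  obtain ⟨h, hw⟩ := tuple_succ_eq hwm hlt hle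
  exact ⟨h, fun c => by rw [hw]⟩

end Successor

end InverseCompound

namespace InverseCompound

/-! ### Enumeration of the increasing tuples

The arrays of the side with offset `o` are: the tuples (`o + 1`), their indicator functions
(`o + 2`), the index (`o + 3`) and the sign (real array `o + 10`) of the result of an exchange, and
the exchange with a given result (`o + 4`). Register `10` holds the size of the ground set, `11` the
number of tuples, `12` the index of the base tuple. -/

open NExpr Prog

/-- Find the last entry of the current tuple that can be increased. -/
def findEntry (o : ℕ) : Prog :=
  seq (setReg 14 (lit 0))
    (loop 13 2 (ite (.not (.nle (add (reg 10) (reg 13)) (add (get (o + 1) (reg 11) (reg 13)) (reg 2))))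
      (setReg 14 (add (reg 13) (lit 1))) skip))

/-- Write the next tuple. -/
def writeNext (o : ℕ) : Prog :=
  loop 13 2 (ite (.not (.nle (reg 14) (add (reg 13) (lit 1))))
    (setNat (o + 1) (add (reg 11) (lit 1)) (reg 13) (get (o + 1) (reg 11) (reg 13)))
    (setNat (o + 1) (add (reg 11) (lit 1)) (reg 13)
      (add (get (o + 1) (reg 11) (sub (reg 14) (lit 1))) (sub (add (reg 13) (lit 2)) (reg 14)))))

/-- Register `11` is the index of the current tuple; register `15` is a flag, cleared when there is
no successor. -/
def nextTuple (o : ℕ) : Prog :=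
  seq (findEntry o) (ite (.nle (reg 14) (lit 0)) (setReg 15 (lit 0))
    (seq (writeNext o) (setReg 11 (add (reg 11) (lit 1)))))

def firstTuple (o : ℕ) : Prog :=
  seq (loop 13 2 (setNat (o + 1) (lit 0) (reg 13) (reg 13)))
    (seq (setReg 11 (lit 0)) (setReg 15 (lit 1)))

/-- The last round of the loop only clears the flag, so register `11` ends at the last index; the
increment turns it into the number of tuples. -/
def allTuples (o : ℕ) : Prog :=
  seq (firstTuple o) (seq (.while (.nle (lit 1) (reg 15)) (nextTuple o))
    (setReg 11 (add (reg 11) (lit 1))))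

def indicators (o : ℕ) : Prog :=
  loop 16 11 (loop 13 2 (setNat (o + 2) (reg 16) (get (o + 1) (reg 16) (reg 13)) (lit 1)))

/-- The array `T` holds the increasing tuples of index below `N`. -/
def HoldsTuples (n k N : ℕ) (T : ℕ → ℕ → ℕ) : Prop :=
  ∀ i : Fin (n.choose k), (i : ℕ) < N → ∀ c : Fin k, T i c = tuple n k i c

/-- Register `14` encodes the position `q` as `q + 1`, which leaves 0 to signal that the tuple is
the last one. -/
theorem runs_findEntry (o : ℕ) (s : State) {n k : ℕ} (h10 : s.reg 10 = n) (h2 : s.reg 2 = k) :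
    Runs (findEntry o) s (40 * (k + 1)) (fun s' =>
      (s'.reg 14 = 0 ∧ ∀ q < k, n + q ≤ s.narr (o + 1) (s.reg 11) q + k) ∨
      ∃ q, s'.reg 14 = q + 1 ∧ q < k ∧ s.narr (o + 1) (s.reg 11) q + k < n + q ∧
        ∀ c, q < c → c < k → n + c ≤ s.narr (o + 1) (s.reg 11) c + k) := by
  refine (Runs.loopFree_seq (by simp) ?_).le (c := _ + 30 * (k + 1)) ?_
  swap
  · simp [Prog.steps, NExpr.cost]; omega
  refine Runs.simpleLoop k
    (fun t s' => (s'.reg 14 = 0 ∧ ∀ q < t, n + q ≤ s.narr (o + 1) (s.reg 11) q + k) ∨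
      ∃ q, s'.reg 14 = q + 1 ∧ q < t ∧ s.narr (o + 1) (s.reg 11) q + k < n + q ∧
        ∀ c, q < c → c < t → n + c ≤ s.narr (o + 1) (s.reg 11) c + k)
    (by simp [h2]) (by simp) (by decide) (by simp) (by simp) (fun t s' v h => by simpa using h)
    (by simp) ?_ (by simp [Prog.steps, NExpr.cost, Test.cost]; omega) (fun s' _ h => by simpa using h)
  intro t ht s' hk hx hI
  have h10 : s'.reg 10 = n := by rw [hk.reg 10 (by simp)]; simp [h10]
  have h11 : s'.reg 11 = s.reg 11 := by rw [hk.reg 11 (by simp)]; simp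
  have h2 : s'.reg 2 = k := by rw [hk.reg 2 (by simp)]; simp [h2]
  have hT : s'.narr (o + 1) = s.narr (o + 1) := by rw [hk.narr _ (by simp)]; simp
  simp only [Prog.run, Test.Holds, NExpr.eval, h10, h11, h2, hx, hT]
  split_ifs with hc
  · rcases hI with ⟨h1, h3⟩ | ⟨q, h1, h3, h4, h5⟩
    · left
      refine ⟨h1, fun q hq => ?_⟩
      rcases Nat.lt_succ_iff_lt_or_eq.1 hq with h | rfl
      · exact h3 q h
      · omega
    · right
      refine ⟨q, h1, by omega, h4, fun c hc1 hc2 => ?_⟩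
      rcases Nat.lt_succ_iff_lt_or_eq.1 hc2 with h | rfl
      · exact h5 c hc1 h
      · omega
  · right
    exact ⟨t, by simp, by omega, by omega, fun c _ _ => by omega⟩

/-- Since register `14` holds `q + 1`, the branch test reads c < q, and the added offset (c + 2) −
(q + 1) is exact in the branch c ≥ q, where it equals (c − q) + 1. -/
theorem runs_writeNext (o : ℕ) (s : State) {k q : ℕ} (h2 : s.reg 2 = k) (h14 : s.reg 14 = q + 1) :
    Runs (writeNext o) s (60 * (k + 1)) (fun s' =>
      (∀ c < k, s'.narr (o + 1) (s.reg 11 + 1) c = if c < q then s.narr (o + 1) (s.reg 11) c else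
        s.narr (o + 1) (s.reg 11) q + (c - q) + 1) ∧
      ∀ i, i ≠ s.reg 11 + 1 → s'.narr (o + 1) i = s.narr (o + 1) i) := by
  refine Runs.simpleLoop k
    (fun t s' => (∀ c < t, s'.narr (o + 1) (s.reg 11 + 1) c =
      if c < q then s.narr (o + 1) (s.reg 11) c else
        s.narr (o + 1) (s.reg 11) q + (c - q) + 1) ∧
      ∀ i, i ≠ s.reg 11 + 1 → s'.narr (o + 1) i = s.narr (o + 1) i)
    h2 (by simp) (by decide) (by simp) (by simp) (fun t s' v h => by simpa using h)
    (by simp) ?_ (by simp [Prog.steps, NExpr.cost, Test.cost]; omega) (fun s' _ h => h)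
  rintro t ht s' hk hx ⟨hI, hI'⟩
  have h11 : s'.reg 11 = s.reg 11 := hk.reg 11 (by simp)
  have h14 : s'.reg 14 = q + 1 := by rw [hk.reg 14 (by simp), h14]
  have hT := hI' (s.reg 11) (by omega)
  simp only [Prog.run, Test.Holds, NExpr.eval, h11, h14, hx, hT]
  split_ifs with hc
  all_goals
    refine ⟨fun c hc' => ?_, fun i hi => ?_⟩
    · rcases Nat.lt_succ_iff_lt_or_eq.1 hc' with h | rfl
      · simpa [h.ne] using hI c h
      · simp
        try first | (split_ifs <;> omega) | (intros; omega)
    · funext j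
      simp [hi, hI' i hi]

theorem runs_nextTuple (o : ℕ) (s : State) {n k : ℕ} (h10 : s.reg 10 = n) (h2 : s.reg 2 = k)
    (h15 : s.reg 15 = 1) (i : Fin (n.choose k)) (h11 : s.reg 11 = i)
    (hT : HoldsTuples n k (i + 1) (s.narr (o + 1))) :
    Runs (nextTuple o) s (120 * (k + 1)) (fun s' =>
      if (i : ℕ) + 1 < n.choose k then s'.reg 15 = 1 ∧ s'.reg 11 = i + 1 ∧
        HoldsTuples n k (i + 2) (s'.narr (o + 1))
      else s'.reg 15 = 0 ∧ s'.reg 11 = i ∧ HoldsTuples n k (i + 1) (s'.narr (o + 1))) := by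
  refine ((runs_findEntry o s h10 h2).seq (c' := 70 * (k + 1)) fun s₁ hk h => ?_).le (by omega)
  have h11' : s₁.reg 11 = i := by rw [hk.reg 11 (by simp [findEntry]), h11]
  have h2' : s₁.reg 2 = k := by rw [hk.reg 2 (by simp [findEntry]), h2]
  have h15' : s₁.reg 15 = 1 := by rw [hk.reg 15 (by simp [findEntry]), h15]
  have hT' : s₁.narr (o + 1) = s.narr (o + 1) := hk.narr _ (by simp [findEntry])
  have hTi : ∀ c : Fin k, s.narr (o + 1) i c = tuple n k i c := hT i (by omega)
  rw [h11] at h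
  refine (Runs.ite (c := 2) (c' := 60 * (k + 1) + 4) (fun hb => ?_) (fun hb => ?_)).le
    (by simp [Test.cost, NExpr.cost]; omega)
  · simp only [Test.Holds, NExpr.eval] at hb
    rcases h with ⟨-, hmax⟩ | ⟨q, h14, -⟩
    swap
    · omega
    have hend := succ_eq_choose (i := i) fun q => by rw [← hTi]; exact hmax q q.2
    refine Runs.loopFree (by simp) (by simp [Prog.steps, NExpr.cost]) ?_
    rw [if_neg (by omega)]
    simp [h11', hT', hT]
  · simp only [Test.Holds, NExpr.eval] at hb
    rcases h with ⟨h14, -⟩ | ⟨q, h14, hqk, hq, hmax⟩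
    · omega
    obtain ⟨hlt, hsucc⟩ := tuple_succ (i := i) (q := ⟨q, hqk⟩) (by rw [← hTi]; exact hq)
      (fun c hc => by rw [← hTi]; exact hmax c hc c.2)
    refine (runs_writeNext o s₁ h2' h14).seq fun s₂ hk₂ h₂ => ?_
    have h11'' : s₂.reg 11 = i := by rw [hk₂.reg 11 (by simp [writeNext]), h11']
    have h15'' : s₂.reg 15 = 1 := by rw [hk₂.reg 15 (by simp [writeNext]), h15']
    refine Runs.loopFree (by simp) (by simp [Prog.steps, NExpr.cost]) ?_
    rw [if_pos hlt]
    simp only [Prog.run, NExpr.eval, State.setR_reg, State.setR_narr, h11'', h15'']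
    refine ⟨by simp, by simp, fun j hj c => ?_⟩
    rw [h11', hT'] at h₂
    by_cases hji : (j : ℕ) = i + 1
    · rw [hji, h₂.1 c c.2]
      have hj' : j = ⟨i + 1, hlt⟩ := Fin.ext hji
      rw [hj', hsucc c, hTi, hTi ⟨q, hqk⟩]
      simp [Fin.lt_def]
    · rw [h₂.2 j hji]
      exact hT j (by omega) c

theorem runs_firstTuple (o : ℕ) (s : State) {n k : ℕ} (h2 : s.reg 2 = k) :
    Runs (firstTuple o) s (20 * (k + 1)) (fun s' => s'.reg 15 = 1 ∧ s'.reg 11 = 0 ∧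
      HoldsTuples n k 1 (s'.narr (o + 1))) := by
  refine (Runs.seq (c := 14 * (k + 1)) (c' := 4)
    (Q := fun s' => HoldsTuples n k 1 (s'.narr (o + 1))) ?_ fun s₁ _ h => ?_).le (by omega)
  · refine Runs.simpleLoop k (fun t s' => ∀ c < t, s'.narr (o + 1) 0 c = c) h2 (by simp)
      (by decide) (by simp) (by simp) (fun t s' v h => by simpa using h) (by simp) ?_
      (by simp [Prog.steps, NExpr.cost]; omega) ?_
    · intro t ht s' _ hx h c hc
      by_cases h' : c = t
      · simp [hx, h']
      · simpa [hx, h'] using h c (by omega)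
    · intro s' _ h i hi c
      have hi0 : i = ⟨0, i.pos⟩ := Fin.ext (by simpa using hi)
      rw [hi0, tuple_zero]
      exact h c c.2
  · exact Runs.loopFree (by simp) (by simp [Prog.steps, NExpr.cost]) (by simpa using h)

theorem runs_allTuples (o : ℕ) (s : State) {n k : ℕ} (h10 : s.reg 10 = n) (h2 : s.reg 2 = k)
    (hkn : k ≤ n) :
    Runs (allTuples o) s (200 * (n.choose k * (k + 1))) (fun s' =>
      s'.reg 11 = n.choose k ∧ HoldsTuples n k (n.choose k) (s'.narr (o + 1))) := by
  have hpos : 0 < n.choose k := Nat.choose_pos hkn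
  set N := n.choose k with hN
  have hNk : k + 1 ≤ N * (k + 1) := Nat.le_mul_of_pos_left _ hpos
  have hN1 : N ≤ N * (k + 1) := Nat.le_mul_of_pos_right _ (by omega)
  refine ((runs_firstTuple o s h2 (n := n)).seq (c' := N * (3 + 120 * (k + 1)) + 7)
    fun s₁ hk₁ h₁ => ?_).le (by rw [mul_add]; nlinarith)
  have h10' : s₁.reg 10 = n := by rw [hk₁.reg 10 (by simp [firstTuple]), h10]
  have h2' : s₁.reg 2 = k := by rw [hk₁.reg 2 (by simp [firstTuple]), h2]
  refine Runs.seq (c := N * (3 + 120 * (k + 1)) + 3) (c' := 4) (Q := fun s' =>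
    s'.reg 11 + 1 = N ∧ HoldsTuples n k N (s'.narr (o + 1))) ?_ fun s₂ _ h₂ => ?_
  swap
  · refine Runs.loopFree (by simp) (by simp [Prog.steps, NExpr.cost]) ?_
    simpa using h₂
  have hw := Runs.while_count (s := s₁) (P := nextTuple o) (b := .nle (lit 1) (reg 15)) N
    (fun i s' => (s'.reg 2 = k ∧ s'.reg 10 = n) ∧ if i < N then s'.reg 15 = 1 ∧ s'.reg 11 = i ∧
      HoldsTuples n k (i + 1) (s'.narr (o + 1)) else s'.reg 15 = 0 ∧ s'.reg 11 + 1 = N ∧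
      HoldsTuples n k N (s'.narr (o + 1))) (fun _ => 120 * (k + 1))
    ⟨⟨h2', h10'⟩, by simpa [hpos] using h₁⟩ ?_ ?_
  · refine hw.mono ?_ fun s' _ h => ?_
    · simp [Test.cost, NExpr.cost]
    · have h' := h.2
      rw [if_neg (lt_irrefl _)] at h'
      exact h'.2
  · rintro i hi s' ⟨⟨e2, e10⟩, h⟩
    rw [if_pos hi] at h
    refine ⟨by simp [h.1], ?_⟩
    refine (runs_nextTuple o s' e10 e2 h.1 ⟨i, hi⟩ h.2.1 h.2.2).mono le_rfl fun s'' hk'' h'' => ?_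
    refine ⟨⟨by rw [hk''.reg 2 (by simp [nextTuple, findEntry, writeNext]), e2],
      by rw [hk''.reg 10 (by simp [nextTuple, findEntry, writeNext]), e10]⟩, ?_⟩
    simp only [← hN] at h''
    split_ifs at h'' ⊢ with hc
    · exact h''
    · have : N = i + 1 := by omega
      rw [this]
      exact ⟨h''.1, by rw [h''.2.1], h''.2.2⟩
  · rintro s' ⟨-, h⟩
    simp only [lt_irrefl, if_false] at h
    simp [h.1]

/-- The array `S` holds the indicator functions of the increasing tuples of index below `N`. -/
def HoldsIndicators (n k : ℕ) (S : ℕ → ℕ → ℕ) : Prop :=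
  ∀ (i : Fin (n.choose k)) (x : ℕ), S i x = 0 ↔ ∀ c, (tuple n k i c : ℕ) ≠ x

theorem runs_indicators (o : ℕ) (s : State) {n k : ℕ} (h11 : s.reg 11 = n.choose k)
    (h2 : s.reg 2 = k) (hT : HoldsTuples n k (n.choose k) (s.narr (o + 1)))
    (h0 : ∀ i j, s.narr (o + 2) i j = 0) :
    Runs (indicators o) s (40 * (n.choose k * (k + 1)) + 6) (fun s' =>
      HoldsIndicators n k (s'.narr (o + 2))) := by
  set N := n.choose k with hN
  refine Runs.loop N (fun t s' => ∀ (i : Fin N) (x : ℕ), s'.narr (o + 2) i x = 0 ↔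
      ∀ c, (i : ℕ) < t → (tuple n k i c : ℕ) ≠ x)
    (20 * (k + 1)) h11 (by decide) (by simp) (by simp)
    (fun t s' v h => by simpa using h) (by simp [h0]) ?_ (by rw [mul_add]; nlinarith)
    (fun s' _ h i x => by simpa using h i x)
  intro t ht s₁ hk hx hI
  have h2' : s₁.reg 2 = k := by rw [hk.reg 2 (by simp), h2]
  have hT' : s₁.narr (o + 1) = s.narr (o + 1) := hk.narr _ (by simp)
  -- Invariant of the inner loop: the rows below `t` are complete, and row `t` has received its
  -- first `t'` marks.
  refine Runs.simpleLoop k (fun t' s' => ∀ (i : Fin N) (x : ℕ), s'.narr (o + 2) i x = 0 ↔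
      ∀ c : Fin k, ((i : ℕ) < t ∨ (i : ℕ) = t ∧ (c : ℕ) < t') → (tuple n k i c : ℕ) ≠ x)
    h2' (by simp) (by decide) (by simp) (by simp) (fun t s' v h => by simpa using h)
    (by simpa using hI) ?_ (by simp [Prog.steps, NExpr.cost]; omega) ?_
  · intro c hc s₂ hk₂ hx₂ hI₂ i x
    have hT₂ : s₂.narr (o + 1) = s.narr (o + 1) := by rw [hk₂.narr _ (by simp), hT']
    have hx' : s₂.reg 16 = t := by rw [hk₂.reg 16 (by simp), hx]
    have hTt := hT ⟨t, ht⟩ ht ⟨c, hc⟩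
    simp only [Prog.run, NExpr.eval, State.setN_narr, hT₂, hx', hx₂, hTt, true_and]
    split_ifs with hif
    · simp only [false_iff, not_forall]
      exact ⟨⟨c, hc⟩, Or.inr ⟨hif.1, by simp⟩, by
        have : i = ⟨t, ht⟩ := Fin.ext hif.1
        subst this
        simpa using hif.2.symm⟩
    · rw [hI₂ i x]
      refine forall_congr' fun d => ?_
      constructor
      · intro h hd
        rcases hd with hd | ⟨hd, hd'⟩
        · exact h (Or.inl hd)
        · rcases Nat.lt_succ_iff_lt_or_eq.1 hd' with h1 | h1
          · exact h (Or.inr ⟨hd, h1⟩)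
          · intro hdx
            refine hif ⟨hd, ?_⟩
            have e1 : i = ⟨t, ht⟩ := Fin.ext hd
            have e2 : d = ⟨c, hc⟩ := Fin.ext h1
            subst e1
            rw [← hdx, e2]
      · intro h hd
        exact h (by omega)
  · intro s' _ h i x
    rw [h i x]
    refine forall_congr' fun c => ?_
    have := c.2
    constructor <;> intro h1 h2 <;> exact h1 (by omega)

end InverseCompound

namespace InverseCompound

open NExpr Prog

/-! ### Tables of exchanges -/

/-- Count the entries of the tuple number `reg 16` that are not in the base tuple. -/
def newEntries (o : ℕ) : Prog :=
  seq (setReg 17 (lit 0))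
    (loop 13 2 (ite (.nle (get (o + 2) (reg 12) (get (o + 1) (reg 16) (reg 13))) (lit 0))
      (seq (setReg 17 (add (reg 17) (lit 1)))
        (seq (setReg 18 (get (o + 1) (reg 16) (reg 13))) (setReg 19 (reg 13)))) skip))

/-- Find an entry of the base tuple that is not in the tuple number `reg 16`. -/
def lostEntry (o : ℕ) : Prog :=
  loop 13 2 (ite (.nle (get (o + 2) (reg 16) (get (o + 1) (reg 12) (reg 13))) (lit 0))
    (setReg 20 (reg 13)) skip)

/-- The two inequalities express that exactly one entry is new. The sign of the exchange is the
product of the signs of the old and the new position. -/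
def recordExchange (o : ℕ) : Prog :=
  ite (.and (.nle (reg 17) (lit 1)) (.nle (lit 1) (reg 17)))
    (seq (setNat (o + 3) (reg 20) (reg 18) (reg 16))
      (seq (setReal (o + 10) (reg 20) (reg 18)
          (.mul (.get 2 (lit 0) (reg 20)) (.get 2 (lit 0) (reg 19))))
        (seq (setNat (o + 4) (lit 0) (reg 16) (reg 20))
          (setNat (o + 4) (lit 1) (reg 16) (reg 18))))) skip

def examine (o : ℕ) : Prog :=
  seq (newEntries o) (seq (lostEntry o) (recordExchange o))

/-- Exchanging a base entry for itself gives the base tuple with sign 1. Exchanging it for another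
base entry repeats a row, so the initial sign 0 in that cell is already correct. -/
def trivialExchanges (o : ℕ) : Prog :=
  loop 13 2 (seq (setNat (o + 3) (reg 13) (get (o + 1) (reg 12) (reg 13)) (reg 12))
    (setReal (o + 10) (reg 13) (get (o + 1) (reg 12) (reg 13)) (.ofNat (lit 1))))

def exchangeTables (o : ℕ) : Prog :=
  seq (loop 16 11 (examine o)) (trivialExchanges o)

/-- The real array `2` holds the powers of `-1`. -/
def signs : Prog :=
  seq (setReal 2 (lit 0) (lit 0) (.ofNat (lit 1)))
    (loop 13 2 (setReal 2 (lit 0) (add (reg 13) (lit 1))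
      (.sub (.ofNat (lit 0)) (.get 2 (lit 0) (reg 13)))))

theorem runs_signs (s : State) {k : ℕ} (h2 : s.reg 2 = k) :
    Runs signs s (30 * (k + 1)) (fun s' => ∀ c ≤ k, s'.rarr 2 0 c = (-1) ^ c) := by
  refine (Runs.loopFree_seq (by simp) ?_).le (c := _ + 24 * (k + 1)) ?_
  swap
  · simp [Prog.steps, NExpr.cost, RExpr.cost]; omega
  refine Runs.simpleLoop k (fun t s' => ∀ c ≤ t, s'.rarr 2 0 c = (-1) ^ c) (by simp [h2]) (by simp)
    (by decide) (by simp) (by simp) (fun t s' v h => by simpa using h) (by simp) ?_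
    (by simp [Prog.steps, NExpr.cost, RExpr.cost]; omega) (fun s' _ h => h)
  intro t ht s' _ hx h c hc
  by_cases h' : c = t + 1
  · simp [hx, h', h t le_rfl, pow_succ]
  · simpa [hx, h'] using h c (by omega)

/-- Only zero, one and at least two new entries are distinguished. Registers `18` and `19` are
overwritten by each new entry, so they are meaningful only in the middle case. -/
theorem runs_newEntries (o : ℕ) (s : State) {k : ℕ} (h2 : s.reg 2 = k) :
    let v := fun c => s.narr (o + 1) (s.reg 16) c
    let P := fun c => s.narr (o + 2) (s.reg 12) (v c) = 0
    Runs (newEntries o) s (40 * (k + 1)) (fun s' =>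
      (s'.reg 17 = 0 ∧ ∀ c < k, ¬ P c) ∨
      (s'.reg 17 = 1 ∧ s'.reg 19 < k ∧ P (s'.reg 19) ∧ s'.reg 18 = v (s'.reg 19) ∧
        ∀ c < k, P c → c = s'.reg 19) ∨
      (2 ≤ s'.reg 17 ∧ ∃ b < k, ∃ b' < k, b ≠ b' ∧ P b ∧ P b')) := by
  intro v P
  refine (Runs.loopFree_seq (by simp) ?_).le (c := _ + 34 * (k + 1)) ?_
  swap
  · simp [Prog.steps, NExpr.cost]; omega
  refine Runs.simpleLoop k (fun t s' => (s'.reg 17 = 0 ∧ ∀ c < t, ¬ P c) ∨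
      (s'.reg 17 = 1 ∧ s'.reg 19 < t ∧ P (s'.reg 19) ∧ s'.reg 18 = v (s'.reg 19) ∧
        ∀ c < t, P c → c = s'.reg 19) ∨
      (2 ≤ s'.reg 17 ∧ ∃ b < t, ∃ b' < t, b ≠ b' ∧ P b ∧ P b')) (by simp [h2]) (by simp)
    (by decide) (by simp) (by simp) (fun t s' v h => by simpa using h) (by simp) ?_
    (by simp [Prog.steps, NExpr.cost, Test.cost]; omega) (fun s' _ h => h)
  intro t ht s' hk hx h
  have h16 : s'.reg 16 = s.reg 16 := by rw [hk.reg 16 (by simp)]; simp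
  have h12 : s'.reg 12 = s.reg 12 := by rw [hk.reg 12 (by simp)]; simp
  have hN : s'.narr = s.narr := funext fun a => by rw [hk.narr a (by simp)]; simp
  simp only [Prog.run, Test.Holds, NExpr.eval, h16, h12, hx, hN]
  have hP : (s.narr (o + 2) (s.reg 12) (s.narr (o + 1) (s.reg 16) t) ≤ 0) ↔ P t := by
    simp [P, v]
  split_ifs with hc <;> rw [hP] at hc
  · rcases h with ⟨h1, h3⟩ | ⟨h1, h3, h4, h5, h6⟩ | ⟨h1, b, hb, b', hb', h3⟩
    · right; left
      simp only [State.setR_reg, h1, hx, h16]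
      refine ⟨by simp, by simp, by simpa using hc, by simp [v, hN], fun c hct hPc => ?_⟩
      rcases Nat.lt_succ_iff_lt_or_eq.1 hct with h' | h'
      · exact (h3 c h' hPc).elim
      · simpa using h'
    · right; right
      exact ⟨by simp [h1], _, h3.trans t.lt_succ_self, t, t.lt_succ_self, by omega, h4, hc⟩
    · right; right
      exact ⟨by simp; omega, b, by omega, b', by omega, h3⟩
  · rcases h with ⟨h1, h3⟩ | ⟨h1, h3, h4, h5, h6⟩ | ⟨h1, b, hb, b', hb', h3⟩
    · left
      refine ⟨h1, fun c hct => ?_⟩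
      rcases Nat.lt_succ_iff_lt_or_eq.1 hct with h' | rfl
      · exact h3 c h'
      · exact hc
    · right; left
      refine ⟨h1, by omega, h4, h5, fun c hct hPc => ?_⟩
      rcases Nat.lt_succ_iff_lt_or_eq.1 hct with h' | rfl
      · exact h6 c h' hPc
      · exact (hc hPc).elim
    · right; right
      exact ⟨h1, b, by omega, b', by omega, h3⟩

theorem runs_lostEntry (o : ℕ) (s : State) {k : ℕ} (h2 : s.reg 2 = k) :
    let P := fun c => s.narr (o + 2) (s.reg 16) (s.narr (o + 1) (s.reg 12) c) = 0
    Runs (lostEntry o) s (30 * (k + 1)) (fun s' => (∃ c < k, P c) →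
      s'.reg 20 < k ∧ P (s'.reg 20)) := by
  intro P
  refine Runs.simpleLoop k (fun t s' => (∃ c < t, P c) → s'.reg 20 < t ∧ P (s'.reg 20)) h2
    (by simp) (by decide) (by simp) (by simp) (fun t s' v h => by simpa using h) (by simp) ?_
    (by simp [Prog.steps, NExpr.cost, Test.cost]; omega) (fun s' _ h => h)
  intro t ht s' hk hx h
  have h16 : s'.reg 16 = s.reg 16 := by rw [hk.reg 16 (by simp)]
  have h12 : s'.reg 12 = s.reg 12 := by rw [hk.reg 12 (by simp)]
  have hN : s'.narr = s.narr := funext fun a => by rw [hk.narr a (by simp)]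
  simp only [Prog.run, Test.Holds, NExpr.eval, h16, h12, hx, hN]
  have hP : (s.narr (o + 2) (s.reg 16) (s.narr (o + 1) (s.reg 12) t) ≤ 0) ↔ P t := by
    simp [P]
  split_ifs with hc <;> rw [hP] at hc
  · intro _
    simpa using hc
  · rintro ⟨c, hct, hPc⟩
    rcases Nat.lt_succ_iff_lt_or_eq.1 hct with h' | rfl
    · obtain ⟨h1, h3⟩ := h ⟨c, h', hPc⟩
      exact ⟨by omega, h3⟩
    · exact (hc hPc).elim

/-- The outcome of `examine` for the tuple number `i`. -/
def Examined {n k : ℕ} (o : ℕ) (i₀ i : Fin (n.choose k)) (s s' : State) : Prop :=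
  (∃ a x b, Exchanged (tuple n k i₀) (tuple n k i) a x b ∧
    (∀ a' x', s'.narr (o + 3) a' x' =
      if a' = a ∧ x' = x then (i : ℕ) else s.narr (o + 3) a' x') ∧
    (∀ a' x', s'.rarr (o + 10) a' x' =
      if a' = a ∧ x' = x then (-1) ^ (a : ℕ) * (-1) ^ (b : ℕ) else s.rarr (o + 10) a' x') ∧
    (∀ j, s'.narr (o + 4) 0 j = if j = i then (a : ℕ) else s.narr (o + 4) 0 j) ∧
    (∀ j, s'.narr (o + 4) 1 j = if j = i then (x : ℕ) else s.narr (o + 4) 1 j)) ∨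
  ((∀ a x b, ¬ Exchanged (tuple n k i₀) (tuple n k i) a x b) ∧
    s'.narr (o + 3) = s.narr (o + 3) ∧ s'.rarr (o + 10) = s.rarr (o + 10) ∧
    s'.narr (o + 4) = s.narr (o + 4))

/-- A tuple results from an exchange exactly when one of its entries is new. In that case
`Exchanged.of_unique_new` identifies the base position found in register `20` as the exchanged one.
The indicator functions keep the test linear in `k`. -/
theorem runs_examine (o : ℕ) (s : State) {n k : ℕ} (h2 : s.reg 2 = k)
    (hT : HoldsTuples n k (n.choose k) (s.narr (o + 1)))
    (hS : HoldsIndicators n k (s.narr (o + 2))) (hs : ∀ c ≤ k, s.rarr 2 0 c = (-1) ^ c)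
    {i₀ i : Fin (n.choose k)} (h12 : s.reg 12 = i₀) (h16 : s.reg 16 = i) :
    Runs (examine o) s (100 * (k + 1)) (Examined o i₀ i s) := by
  have hnew := runs_newEntries o s h2
  have hI₀ := tuple_strictMono i₀
  have hI := tuple_strictMono i
  have hval : ∀ (j : Fin (n.choose k)) (c : ℕ) (hc : c < k),
      s.narr (o + 1) j c = tuple n k j ⟨c, hc⟩ := fun j c hc => hT j j.2 ⟨c, hc⟩
  refine (hnew.seq (c' := 60 * (k + 1)) fun s₁ hk₁ h₁ => ?_).le (by omega)
  have h2₁ : s₁.reg 2 = k := by rw [hk₁.reg 2 (by simp [newEntries]), h2]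
  have h12₁ : s₁.reg 12 = i₀ := by rw [hk₁.reg 12 (by simp [newEntries]), h12]
  have h16₁ : s₁.reg 16 = i := by rw [hk₁.reg 16 (by simp [newEntries]), h16]
  have hN₁ : s₁.narr = s.narr := funext fun a => hk₁.narr a (by simp [newEntries])
  have hX₁ : s₁.rarr = s.rarr := funext fun a => hk₁.rarr a (by simp [newEntries])
  refine ((runs_lostEntry o s₁ h2₁).seq (c' := 30) fun s₂ hk₂ h₂ => ?_).le (by omega)
  have h16₂ : s₂.reg 16 = i := by rw [hk₂.reg 16 (by simp [lostEntry]), h16₁]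
  have hN₂ : s₂.narr = s.narr := by
    rw [← hN₁]; exact funext fun a => hk₂.narr a (by simp [lostEntry])
  have hX₂ : s₂.rarr = s.rarr := by
    rw [← hX₁]; exact funext fun a => hk₂.rarr a (by simp [lostEntry])
  have h17 : s₂.reg 17 = s₁.reg 17 := hk₂.reg 17 (by simp [lostEntry])
  have h18 : s₂.reg 18 = s₁.reg 18 := hk₂.reg 18 (by simp [lostEntry])
  have h19 : s₂.reg 19 = s₁.reg 19 := hk₂.reg 19 (by simp [lostEntry])
  rw [hN₁, h16₁, h12₁] at h₂
  rw [h12, h16] at h₁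
  have hP : ∀ c (hc : c < k), s.narr (o + 2) i₀ (s.narr (o + 1) i c) = 0 ↔
      ∀ d, tuple n k i₀ d ≠ tuple n k i ⟨c, hc⟩ := fun c hc => by
    rw [hval i c hc, hS i₀]
    simp [Fin.ext_iff]
  have hQ : ∀ c (hc : c < k), s.narr (o + 2) i (s.narr (o + 1) i₀ c) = 0 ↔
      ∀ d, tuple n k i d ≠ tuple n k i₀ ⟨c, hc⟩ := fun c hc => by
    rw [hval i₀ c hc, hS i]
    simp [Fin.ext_iff]
  have hnot : s₁.reg 17 ≠ 1 → ∀ a x b, ¬ Exchanged (tuple n k i₀) (tuple n k i) a x b := by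
    intro hne a x b hex
    rcases h₁ with ⟨-, h⟩ | ⟨h, -⟩ | ⟨-, c, hc, c', hc', hcc', h, h'⟩
    · refine h b b.2 ((hP b b.2).2 fun d => ?_)
      rw [Fin.eta, hex.new]
      exact hex.notMem d
    · exact hne h
    · rw [hP c hc] at h
      rw [hP c' hc'] at h'
      have key : ∀ e : Fin k, (∀ d, tuple n k i₀ d ≠ tuple n k i e) → e = b := by
        intro e he
        by_contra hb
        obtain ⟨d, -, hd⟩ := hex.old e hb
        exact he d hd
      have := (key _ h).trans (key _ h').symm
      exact hcc' (by simpa using this)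
  refine Runs.loopFree (by simp [recordExchange])
    (by simp [recordExchange, Prog.steps, NExpr.cost, RExpr.cost, Test.cost]) ?_
  simp only [recordExchange, Prog.run, Test.Holds, NExpr.eval, h17]
  split_ifs with hif
  · left
    rcases h₁ with ⟨h, -⟩ | ⟨-, hb, hPb, hx, huniq⟩ | ⟨h, -⟩
    · omega
    · set b := s₁.reg 19
      obtain ⟨⟨a, ha⟩, hall⟩ := Exchanged.of_unique_new hI₀ hI (b := ⟨b, hb⟩) ((hP b hb).1 hPb)
        (fun c hc => by
          by_contra! h
          exact hc (Fin.ext (huniq c c.2 ((hP c c.2).2 h))))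
      obtain ⟨ha', hQa⟩ := h₂ ⟨a, a.2, (hQ a a.2).2 ha⟩
      have hex := hall ⟨_, ha'⟩ ((hQ _ ha').1 hQa)
      refine ⟨_, _, _, hex, ?_⟩
      have hx' : s₁.reg 18 = tuple n k i ⟨b, hb⟩ := hx.trans (hval i b hb)
      have hsa := hs (s₂.reg 20) ha'.le
      have hsb := hs b hb.le
      simp [h18, h19, hx', h16₂, hN₂, hX₂, hsa, hsb]
    · omega
  · right
    exact ⟨hnot (by omega), by rw [hN₂], by rw [hX₂], by rw [hN₂]⟩

/-- The tables for all exchanges in the tuple number `i₀`. -/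
structure HoldsExchanges (n k : ℕ) (i₀ : Fin (n.choose k)) (IDX : ℕ → ℕ → ℕ) (SGN : ℕ → ℕ → ℝ)
    (INFO : ℕ → ℕ → ℕ) : Prop where
  minor : ∀ (a : Fin k) (x : Fin n), ∃ i : Fin (n.choose k), IDX a x = i ∧
    ∀ (m : ℕ) (A : Matrix (Fin n) (Fin m) ℝ) (J : Fin k → Fin m),
      (A.submatrix (Function.update (tuple n k i₀) a x) J).det =
        SGN a x * (A.submatrix (tuple n k i) J).det
  entry_lt : ∀ i : Fin (n.choose k), INFO 0 i < k
  elem_lt : ∀ i : Fin (n.choose k), INFO 1 i < n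
  complete : ∀ (a : Fin k) (x : Fin n), (∀ c, tuple n k i₀ c ≠ x) →
    ∃ i : Fin (n.choose k), INFO 0 i = a ∧ INFO 1 i = x

/-- The tables after `t` tuples have been examined. -/
structure ExchangesUpTo (n k : ℕ) (i₀ : Fin (n.choose k)) (t : ℕ) (IDX : ℕ → ℕ → ℕ)
    (SGN : ℕ → ℕ → ℝ) (INFO : ℕ → ℕ → ℕ) : Prop where
  entry : ∀ (a : Fin k) (x : Fin n),
    (∃ (i : Fin (n.choose k)) (b : Fin k), Exchanged (tuple n k i₀) (tuple n k i) a x b ∧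
      IDX a x = i ∧ SGN a x = (-1) ^ (a : ℕ) * (-1) ^ (b : ℕ)) ∨
    (IDX a x = 0 ∧ SGN a x = 0 ∧
      ∀ (i : Fin (n.choose k)) (b : Fin k), (i : ℕ) < t →
        ¬ Exchanged (tuple n k i₀) (tuple n k i) a x b)
  entry_lt : ∀ i : Fin (n.choose k), INFO 0 i < k
  elem_lt : ∀ i : Fin (n.choose k), INFO 1 i < n
  info : ∀ (i : Fin (n.choose k)) (a : Fin k) (x : Fin n) (b : Fin k), (i : ℕ) < t →
    Exchanged (tuple n k i₀) (tuple n k i) a x b → INFO 0 i = a ∧ INFO 1 i = x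

/-- By `Exchanged.unique` the tuple number `t` concerns a single cell, so every other cell keeps its
status when the bound moves to `t + 1`. -/
theorem ExchangesUpTo.step {n k o t : ℕ} {i₀ : Fin (n.choose k)} {s s' : State}
    (h : ExchangesUpTo n k i₀ t (s.narr (o + 3)) (s.rarr (o + 10)) (s.narr (o + 4)))
    (ht : t < n.choose k) (h' : Examined o i₀ ⟨t, ht⟩ s s') :
    ExchangesUpTo n k i₀ (t + 1) (s'.narr (o + 3)) (s'.rarr (o + 10)) (s'.narr (o + 4)) := by
  rcases h' with ⟨a, x, b, hex, h3, h10, h40, h41⟩ | ⟨hno, h3, h10, h4⟩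
  · refine ⟨fun a' x' => ?_, fun i => ?_, fun i => ?_, fun i a' x' b' hi hex' => ?_⟩
    · rw [h3, h10]
      by_cases hax : (a' : ℕ) = a ∧ (x' : ℕ) = x
      · left
        obtain ⟨h1, h2⟩ := hax
        rw [Fin.val_inj] at h1 h2
        subst h1 h2
        exact ⟨⟨t, ht⟩, b, hex, by simp, by simp⟩
      · rw [if_neg hax, if_neg hax]
        refine (h.entry a' x').imp id fun ⟨e1, e2, e3⟩ => ⟨e1, e2, fun i b' hi hex' => ?_⟩
        rcases Nat.lt_succ_iff_lt_or_eq.1 hi with hlt | heq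
        · exact e3 i b' hlt hex'
        · have : i = ⟨t, ht⟩ := Fin.ext heq
          subst this
          have := hex.unique (tuple_strictMono _) (tuple_strictMono _) hex'
          exact hax ⟨by rw [this.1], by rw [this.2.1]⟩
    · rw [h40]
      split_ifs
      · exact a.2
      · exact h.entry_lt i
    · rw [h41]
      split_ifs
      · exact x.2
      · exact h.elem_lt i
    · rw [h40, h41]
      rcases Nat.lt_succ_iff_lt_or_eq.1 hi with hlt | heq
      · rw [if_neg (by simp; omega), if_neg (by simp; omega)]
        exact h.info i a' x' b' hlt hex'
      · have : i = ⟨t, ht⟩ := Fin.ext heq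
        subst this
        have := hex.unique (tuple_strictMono _) (tuple_strictMono _) hex'
        simp [this.1, this.2.1]
  · rw [h3, h10, h4]
    refine ⟨fun a' x' => (h.entry a' x').imp id fun ⟨e1, e2, e3⟩ =>
      ⟨e1, e2, fun i b' hi hex' => ?_⟩, h.entry_lt, h.elem_lt, fun i a' x' b' hi hex' => ?_⟩
    swap
    · rcases Nat.lt_succ_iff_lt_or_eq.1 hi with hlt | heq
      · exact e3 i b' hlt hex'
      · have : i = ⟨t, ht⟩ := Fin.ext heq
        exact hno _ _ _ (this ▸ hex')
    rcases Nat.lt_succ_iff_lt_or_eq.1 hi with hlt | heq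
    · exact h.info i a' x' b' hlt hex'
    · have : i = ⟨t, ht⟩ := Fin.ext heq
      exact (hno _ _ _ (this ▸ hex')).elim

/-- Folds the cell just written into the region already described by a loop invariant. -/
theorem ite_ite_eq {α : Type*} {p q r : Prop} [Decidable p] [Decidable q] [Decidable r]
    (h : p ∨ q ↔ r) (u v : α) :
    (if p then u else if q then u else v) = if r then u else v := by
  by_cases hp : p <;> by_cases hq : q <;> simp_all

theorem runs_exchangeTables (o : ℕ) (s : State) {n k : ℕ} (hk0 : 0 < k) (hkn : k ≤ n)
    (h2 : s.reg 2 = k) (h11 : s.reg 11 = n.choose k)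
    (hT : HoldsTuples n k (n.choose k) (s.narr (o + 1)))
    (hS : HoldsIndicators n k (s.narr (o + 2))) (hs : ∀ c ≤ k, s.rarr 2 0 c = (-1) ^ c)
    (i₀ : Fin (n.choose k)) (h12 : s.reg 12 = i₀) (h3 : ∀ i j, s.narr (o + 3) i j = 0)
    (h4 : ∀ i j, s.narr (o + 4) i j = 0) (h10 : ∀ i j, s.rarr (o + 10) i j = 0) :
    Runs (exchangeTables o) s (200 * (n.choose k * (k + 1))) (fun s' =>
      HoldsExchanges n k i₀ (s'.narr (o + 3)) (s'.rarr (o + 10)) (s'.narr (o + 4))) := by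
  have hpos : 0 < n.choose k := i₀.pos
  have hNk : k + 1 ≤ (n.choose k) * (k + 1) := Nat.le_mul_of_pos_left _ hpos
  have hN1 : (n.choose k) ≤ (n.choose k) * (k + 1) := Nat.le_mul_of_pos_right _ (by omega)
  have hmod : ∀ x, x < 13 → ¬ (examine o).ModR x := fun x hx => by
    simp [examine, newEntries, lostEntry, recordExchange]; omega
  have hmodN : ∀ x, x < 3 → ¬ (examine o).ModN (o + x) := fun x hx => by
    simp [examine, newEntries, lostEntry, recordExchange]; omega
  have hmodX : ∀ x, x < 3 → ¬ (examine o).ModX x := fun x hx => by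
    simp [examine, newEntries, lostEntry, recordExchange]; omega
  refine Runs.le (c := (108 * ((n.choose k) * (k + 1)) + 6) + 40 * (k + 1)) (Runs.seq (Q := fun s' => ExchangesUpTo n k i₀ (n.choose k)
      (s'.narr (o + 3)) (s'.rarr (o + 10)) (s'.narr (o + 4))) ?_ ?_) (by omega)
  · refine Runs.loop (n.choose k) (fun t s' => ExchangesUpTo n k i₀ t
      (s'.narr (o + 3)) (s'.rarr (o + 10)) (s'.narr (o + 4))) (100 * (k + 1)) h11 (by decide)
      (by simp [examine, newEntries, lostEntry, recordExchange]) (hmod _ (by omega))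
      (fun t s' v h => by simpa using h) ?_ ?_ (by rw [mul_add]; nlinarith) (fun s' _ h => h)
    -- Zero entries are legitimate initial values: 0 is a valid position and a valid element because
    -- 0 < k ≤ n.
    · exact ⟨fun a x => Or.inr ⟨h3 _ _, h10 _ _, fun i b hi => by omega⟩,
        fun i => by rw [h4]; exact hk0, fun i => by rw [h4]; omega, fun i _ _ _ hi => by omega⟩
    · intro t ht s' hk hx h
      refine (runs_examine o s' (n := n) (by rw [hk.reg 2 (by simp [hmod]), h2])
        (by rw [hk.narr _ (by simp [hmodN])]; exact hT)
        (by rw [hk.narr _ (by simp [hmodN])]; exact hS)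
        (by rw [hk.rarr _ (by simp [hmodX])]; exact hs) (i₀ := i₀) (i := ⟨t, ht⟩)
        (by rw [hk.reg 12 (by simp [hmod]), h12]) hx).mono le_rfl fun s'' _ h' => h.step ht h'
  · intro s₁ hk₁ h₁
    have hT' : ∀ c (hc : c < k), s₁.narr (o + 1) i₀ c = tuple n k i₀ ⟨c, hc⟩ := fun c hc => by
      rw [hk₁.narr _ (by simp [hmodN])]
      exact hT i₀ i₀.2 ⟨c, hc⟩
    have h12' : s₁.reg 12 = i₀ := by rw [hk₁.reg 12 (by simp [hmod]), h12]
    have hI₀ := tuple_strictMono i₀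
    refine Runs.simpleLoop k (fun t s' => s'.narr (o + 1) = s₁.narr (o + 1) ∧
      s'.narr (o + 4) = s₁.narr (o + 4) ∧ ∀ (a : ℕ) (x : ℕ),
      (s'.narr (o + 3) a x = if a < t ∧ x = s₁.narr (o + 1) i₀ a then (i₀ : ℕ)
        else s₁.narr (o + 3) a x) ∧
      (s'.rarr (o + 10) a x = if a < t ∧ x = s₁.narr (o + 1) i₀ a then 1
        else s₁.rarr (o + 10) a x)) (by rw [hk₁.reg 2 (by simp [hmod]), h2])
      (by simp) (by decide) (by simp) (by simp) (fun t s' v h => by simpa using h) (by simp) ?_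
      (by simp [Prog.steps, NExpr.cost, RExpr.cost]; omega) ?_
    · rintro t ht s' hk hx ⟨h1, h2, h3⟩
      have h12'' : s'.reg 12 = i₀ := by rw [hk.reg 12 (by simp), h12']
      have hne : ∀ a x : ℕ, (a = t ∧ x = s₁.narr (o + 1) i₀ t) ∨ (a < t ∧ x = s₁.narr (o + 1) i₀ a) ↔
          (a < t + 1 ∧ x = s₁.narr (o + 1) i₀ a) := fun a x => by
        constructor
        · rintro (⟨rfl, h⟩ | ⟨h, h'⟩)
          · exact ⟨by omega, h⟩
          · exact ⟨by omega, h'⟩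
        · rintro ⟨h, h'⟩
          rcases Nat.lt_succ_iff_lt_or_eq.1 h with h | rfl
          · exact Or.inr ⟨h, h'⟩
          · exact Or.inl ⟨rfl, h'⟩
      refine ⟨by funext i j; simp [h1], by funext i j; simp [h2], fun a x => ?_⟩
      rw [← ite_ite_eq (hne a x), ← ite_ite_eq (hne a x)]
      simp [h12'', hx, h1, h3]
    · rintro s' - ⟨hs1, hs4, hs3⟩
      refine ⟨fun a x => ?_, by rw [hs4]; exact h₁.entry_lt, by rw [hs4]; exact h₁.elem_lt,
        fun a x hx => ?_⟩
      · rw [(hs3 a x).1, (hs3 a x).2, hT' a a.2]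
        by_cases hax : x = tuple n k i₀ a
        · exact ⟨i₀, by simp [hax], fun m A J => by simp [hax]⟩
        · rw [if_neg (by simpa [Fin.val_inj] using hax), if_neg (by simpa [Fin.val_inj] using hax)]
          rcases h₁.entry a x with ⟨i, b, hex, h1, h2⟩ | ⟨h1, h2, hno⟩
          · exact ⟨i, h1, fun m A J => by
              rw [h2, hex.det_eq hI₀ (tuple_strictMono i)]⟩
          -- With no exchange recorded, `x` must repeat a base entry, so the minor vanishes; sign 0
          -- makes the default index 0 harmless.
          · refine ⟨⟨0, hpos⟩, h1, fun m A J => ?_⟩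
            rw [h2, zero_mul]
            apply det_submatrix_eq_zero_of_not_injective
            by_contra hinj
            have hx : ∀ c, tuple n k i₀ c ≠ x := fun c hc => by
              by_cases hca : c = a
              · exact hax (by rw [← hc, hca])
              · exact hca (hinj (by simp [hca, hc]))
            obtain ⟨i, b, hex⟩ := exists_exchanged hI₀ a hx
            exact hno i b i.2 hex
      · obtain ⟨i, b, hex⟩ := exists_exchanged hI₀ a hx
        exact ⟨i, by rw [hs4]; exact h₁.info i a x b i.2 hex⟩

end InverseCompound

namespace InverseCompound

open NExpr Prog

/-! ### Double loops -/

/-- Fill the array `a` with the values of an expression in the registers `7` and `8`. -/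
def fill (a y y' : ℕ) (e : RExpr) : Prog :=
  loop 7 y (loop 8 y' (setReal a (reg 7) (reg 8) e))

/-- The value of `e` is required in every state that differs from `s` only in what the loops write,
so it must not depend on the array `a` while that is being filled. -/
theorem runs_fill {a y y' N M : ℕ} {e : RExpr} {s : State} (f : ℕ → ℕ → ℝ) (hy : s.reg y = N)
    (hy' : s.reg y' = M) (hN : 1 ≤ N) (hM : 1 ≤ M) (h7 : y ≠ 7 := by decide)
    (h8 : y ≠ 8 := by decide) (h7' : y' ≠ 7 := by decide) (h8' : y' ≠ 8 := by decide)
    (he : ∀ i < N, ∀ j < M, ∀ s', Keep (fill a y y' e) s s' → s'.reg 7 = i → s'.reg 8 = j →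
      e.eval s' = f i j) :
    Runs (fill a y y' e) s ((e.cost + 31) * (N * M)) (fun s' =>
      ∀ i < N, ∀ j < M, s'.rarr a i j = f i j) := by
  have hNM : N ≤ N * M := Nat.le_mul_of_pos_right _ hM
  refine Runs.loop N (fun t s' => ∀ i < t, ∀ j < M, s'.rarr a i j = f i j)
    (M * (e.cost + 11) + 6) hy h7.symm (by simp) (by simp [h8])
    (fun t s' v h => by simpa using h) (by simp) ?_ (by nlinarith) (fun s' _ h => h)
  intro t ht s₁ hk₁ hx₁ h₁
  refine Runs.simpleLoop M (fun t' s' => ∀ i j, (i < t ∧ j < M ∨ i = t ∧ j < t') →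
    s'.rarr a i j = f i j) (by rw [hk₁.reg y' (by simp [h7', h8']), hy']) (by simp) h8'.symm
    (by simp) (by simp) (fun t s' v h => by simpa using h) ?_ ?_
    (by simp [Prog.steps, NExpr.cost, add_comm, add_left_comm]; ring_nf; omega) ?_
  · intro i j h
    exact h₁ i (by omega) j (by omega)
  · intro t' ht' s₂ hk₂ hx₂ h₂ i j hij
    have h7₂ : s₂.reg 7 = t := by rw [hk₂.reg 7 (by simp), hx₁]
    have hkeep : Keep (fill a y y' e) s s₂ := by
      refine ⟨fun x hx => ?_, fun x hx => ?_, fun x hx => ?_⟩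
      · rw [hk₂.reg x (by simp [fill] at hx ⊢; tauto), hk₁.reg x (by simp [fill] at hx ⊢; tauto)]
      · rw [hk₂.narr x (by simp), hk₁.narr x (by simp)]
      · rw [hk₂.rarr x (by simpa [fill] using hx), hk₁.rarr x (by simpa [fill] using hx)]
    simp only [Prog.run, NExpr.eval, State.setX_rarr, h7₂, hx₂,
      he t ht t' ht' s₂ hkeep h7₂ hx₂, true_and]
    split_ifs with h
    · rw [h.1, h.2]
    · exact h₂ i j (by omega)
  · intro s' _ h i hi j hj
    exact h i j (by omega)

/-- Search for indices with a nonzero value of an expression in the registers `7` and `8`. -/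
def search (z z' y y' : ℕ) (e : RExpr) : Prog :=
  loop 7 y (loop 8 y' (ite (.not (.and (.rle e (.ofNat (lit 0))) (.rle (.ofNat (lit 0)) e)))
    (seq (setReg z (reg 7)) (setReg z' (reg 8))) skip))

/-- There is no early exit: the registers end up with the last hit. A value is tested for zero by
two comparisons. -/
theorem runs_search {z z' y y' N M : ℕ} {e : RExpr} {s : State} (f : ℕ → ℕ → ℝ) (hy : s.reg y = N)
    (hy' : s.reg y' = M) (hN : 1 ≤ N) (hM : 1 ≤ M)
    (hyz : y ∉ [7, 8, z, z'] := by decide) (hyz' : y' ∉ [7, 8, z, z'] := by decide)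
    (hz : z' ∉ [7, 8, z] := by decide) (hz' : z ∉ [7, 8] := by decide)
    (he : ∀ i < N, ∀ j < M, ∀ s', Keep (search z z' y y' e) s s' → s'.reg 7 = i → s'.reg 8 = j →
      e.eval s' = f i j) :
    Runs (search z z' y y' e) s ((2 * e.cost + 60) * (N * M)) (fun s' =>
      (∃ i < N, ∃ j < M, f i j ≠ 0) →
        s'.reg z < N ∧ s'.reg z' < M ∧ f (s'.reg z) (s'.reg z') ≠ 0) := by
  simp only [List.mem_cons, List.not_mem_nil, or_false, not_or] at hyz hyz' hz hz'
  have hNM : N ≤ N * M := Nat.le_mul_of_pos_right _ hM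
  have hMe : M * (2 * e.cost + 22) + 6 + 8 ≤ M * (2 * e.cost + 36) := by nlinarith
  have hNMe := Nat.mul_le_mul_left N hMe
  refine Runs.loop N (fun t s' => (∃ i < t, ∃ j < M, f i j ≠ 0) →
      s'.reg z < N ∧ s'.reg z' < M ∧ f (s'.reg z) (s'.reg z') ≠ 0)
    (M * (2 * e.cost + 22) + 6) hy (Ne.symm hyz.1) (by simp; tauto) (by simp; tauto)
    (fun t s' v h => by simpa [hz, hz'] using h) (by simp) ?_ (by nlinarith) (fun s' _ h => h)
  intro t ht s₁ hk₁ hx₁ h₁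
  refine Runs.simpleLoop M (fun t' s' => (∃ i j, (i < t ∧ j < M ∨ i = t ∧ j < t') ∧ f i j ≠ 0) →
      s'.reg z < N ∧ s'.reg z' < M ∧ f (s'.reg z) (s'.reg z') ≠ 0)
    (by rw [hk₁.reg y' (by simp; tauto), hy']) (by simp) (Ne.symm hyz'.2.1)
    (by simp; tauto) (by simp; tauto) (fun t s' v h => by simpa [hz, hz'] using h) ?_ ?_
    (by simp [Prog.steps, NExpr.cost, Test.cost, RExpr.cost]; ring_nf; omega) ?_
  · rintro ⟨i, j, h, hf⟩
    exact h₁ ⟨i, by omega, j, by omega, hf⟩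
  · intro t' ht' s₂ hk₂ hx₂ h₂
    have h7₂ : s₂.reg 7 = t := by rw [hk₂.reg 7 (by simp; tauto), hx₁]
    have hkeep : Keep (search z z' y y' e) s s₂ := by
      refine ⟨fun x hx => ?_, fun x hx => ?_, fun x hx => ?_⟩
      · rw [hk₂.reg x (by simp [search] at hx ⊢; tauto),
          hk₁.reg x (by simp [search] at hx ⊢; tauto)]
      · rw [hk₂.narr x (by simp), hk₁.narr x (by simp)]
      · rw [hk₂.rarr x (by simp), hk₁.rarr x (by simp)]
    have hv := he t ht t' ht' s₂ hkeep h7₂ hx₂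
    simp only [Prog.run, Test.Holds, NExpr.eval, RExpr.eval, hv, Nat.cast_zero]
    split_ifs with h
    · rintro ⟨i, j, hij, hf⟩
      refine h₂ ⟨i, j, ?_, hf⟩
      by_contra hcon
      have h1 : i = t := by omega
      have h2 : j = t' := by omega
      subst h1 h2
      exact hf (le_antisymm h.1 h.2)
    · intro _
      have hne : f t t' ≠ 0 := fun h0 => h (by simp [h0])
      simpa [h7₂, hx₂, hz, hz', Ne.symm hz.2.2, Ne.symm hz'.2] using ⟨ht, ht', hne⟩
  · rintro s' - h ⟨i, hi, j, hj, hf⟩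
    exact h ⟨i, j, by omega, hf⟩

/-! ### Coordinates -/

def oneSide (o : ℕ) : Prog := seq (allTuples o) (indicators o)

/-- Offset 0 serves the rows, offset 20 the columns. Registers `3` and `4` keep the two numbers of
tuples; registers `5` and `6` will hold the base tuples. -/
def bothSides : Prog :=
  seq (setReg 10 (reg 0)) <| seq (oneSide 0) <|
  seq (seq (setReg 3 (reg 11)) (setReg 10 (reg 1))) <| seq (oneSide 20) <|
  seq (setReg 4 (reg 11)) signs

def bothTables : Prog :=
  seq (seq (setReg 11 (reg 3)) (setReg 12 (reg 5))) <| seq (exchangeTables 0) <|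
  seq (seq (setReg 11 (reg 4)) (setReg 12 (reg 6))) <| exchangeTables 20

/-- Real arrays `3` and `4` receive Y and Z as Cramer quotients; each numerator is a tabulated sign
times an entry of the compound. The natural number arrays `3` and `23` hold the indices of those
entries. -/
def coordinates : Prog :=
  seq (fill 3 0 2 (.div (.mul (.get 10 (reg 8) (reg 7)) (.get 0 (get 3 (reg 8) (reg 7)) (reg 6)))
    (.get 0 (reg 5) (reg 6))))
  (fill 4 2 1 (.div (.mul (.get 30 (reg 7) (reg 8)) (.get 0 (reg 5) (get 23 (reg 7) (reg 8))))
    (.get 0 (reg 5) (reg 6))))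

def prepare : Prog :=
  seq bothSides <| seq (search 5 6 3 4 (.get 0 (reg 7) (reg 8))) <| seq bothTables coordinates

/-- The state after the preparation. -/
structure Prepared {n m k : ℕ} (A : Matrix (Fin n) (Fin m) ℝ) (i₀ : Fin (n.choose k))
    (j₀ : Fin (m.choose k)) (s : State) : Prop where
  reg0 : s.reg 0 = n
  reg1 : s.reg 1 = m
  reg2 : s.reg 2 = k
  reg3 : s.reg 3 = n.choose k
  reg4 : s.reg 4 = m.choose k
  reg5 : s.reg 5 = i₀
  reg6 : s.reg 6 = j₀
  input : ∀ (i : Fin (n.choose k)) (j : Fin (m.choose k)), s.rarr 0 i j = compound k A i j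
  ne_zero : (A.submatrix (tuple n k i₀) (tuple m k j₀)).det ≠ 0
  tuples : HoldsTuples n k (n.choose k) (s.narr 1)
  indicators : HoldsIndicators n k (s.narr 2)
  rows : HoldsExchanges n k i₀ (s.narr 3) (s.rarr 10) (s.narr 4)
  cols : HoldsExchanges m k j₀ (s.narr 23) (s.rarr 30) (s.narr 24)
  rowCoord : ∀ (x : Fin n) (a : Fin k),
    s.rarr 3 x a = MinorExchange.rowCoord A (tuple n k i₀) (tuple m k j₀) x a
  colCoord : ∀ (b : Fin k) (y : Fin m),
    s.rarr 4 b y = MinorExchange.colCoord A (tuple n k i₀) (tuple m k j₀) b y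

theorem runs_oneSide (o : ℕ) (s : State) {n k : ℕ} (h10 : s.reg 10 = n) (h2 : s.reg 2 = k)
    (hkn : k ≤ n) (h0 : ∀ i j, s.narr (o + 2) i j = 0) :
    Runs (oneSide o) s (250 * (n.choose k * (k + 1))) (fun s' =>
      s'.reg 11 = n.choose k ∧ HoldsTuples n k (n.choose k) (s'.narr (o + 1)) ∧
      HoldsIndicators n k (s'.narr (o + 2))) := by
  have hpos : 0 < n.choose k := Nat.choose_pos hkn
  have hNk : 1 ≤ n.choose k * (k + 1) := Nat.mul_pos hpos (by omega)
  refine ((runs_allTuples o s h10 h2 hkn).seq fun s₁ hk₁ h₁ =>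
    (runs_indicators o s₁ h₁.1 ?_ h₁.2 ?_).mono le_rfl fun s₂ hk₂ h₂ => ⟨?_, ?_, h₂⟩).le
    (by omega)
  · rw [hk₁.reg 2 (by simp [allTuples, firstTuple, nextTuple, findEntry, writeNext]), h2]
  · rwa [hk₁.narr _ (by simp [allTuples, firstTuple, nextTuple, findEntry, writeNext])]
  · rw [hk₂.reg 11 (by simp [InverseCompound.indicators]), h₁.1]
  · rw [hk₂.narr _ (by simp [InverseCompound.indicators])]
    exact h₁.2

@[simp] theorem modR_oneSide (o x : ℕ) :
    (oneSide o).ModR x ↔ x = 11 ∨ x = 13 ∨ x = 14 ∨ x = 15 ∨ x = 16 := by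
  simp [oneSide, allTuples, firstTuple, nextTuple, findEntry, writeNext, InverseCompound.indicators]
  omega

@[simp] theorem modN_oneSide (o x : ℕ) : (oneSide o).ModN x ↔ x = o + 1 ∨ x = o + 2 := by
  simp [oneSide, allTuples, firstTuple, nextTuple, findEntry, writeNext, InverseCompound.indicators]

@[simp] theorem modX_oneSide (o x : ℕ) : ¬ (oneSide o).ModX x := by
  simp [oneSide, allTuples, firstTuple, nextTuple, findEntry, writeNext, InverseCompound.indicators]

@[simp] theorem modR_exchangeTables (o x : ℕ) :
    (exchangeTables o).ModR x ↔ x = 13 ∨ x = 16 ∨ x = 17 ∨ x = 18 ∨ x = 19 ∨ x = 20 := by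
  simp [exchangeTables, examine, newEntries, lostEntry, recordExchange, trivialExchanges]
  omega

@[simp] theorem modN_exchangeTables (o x : ℕ) :
    (exchangeTables o).ModN x ↔ x = o + 3 ∨ x = o + 4 := by
  simp [exchangeTables, examine, newEntries, lostEntry, recordExchange, trivialExchanges]
  omega

@[simp] theorem modX_exchangeTables (o x : ℕ) : (exchangeTables o).ModX x ↔ x = o + 10 := by
  simp [exchangeTables, examine, newEntries, lostEntry, recordExchange, trivialExchanges]

@[simp] theorem modR_signs (x : ℕ) : signs.ModR x ↔ x = 13 := by simp [signs]

@[simp] theorem modN_signs (x : ℕ) : ¬ signs.ModN x := by simp [signs]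

@[simp] theorem modX_signs (x : ℕ) : signs.ModX x ↔ x = 2 := by simp [signs]

@[simp] theorem modR_search (z z' y y' x : ℕ) (e : RExpr) :
    (search z z' y y' e).ModR x ↔ x = 7 ∨ x = 8 ∨ x = z ∨ x = z' := by simp [search]

@[simp] theorem modN_search (z z' y y' x : ℕ) (e : RExpr) :
    ¬ (search z z' y y' e).ModN x := by simp [search]

@[simp] theorem modX_search (z z' y y' x : ℕ) (e : RExpr) :
    ¬ (search z z' y y' e).ModX x := by simp [search]

@[simp] theorem modR_fill (a y y' x : ℕ) (e : RExpr) :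
    (fill a y y' e).ModR x ↔ x = 7 ∨ x = 8 := by simp [fill]

@[simp] theorem modN_fill (a y y' x : ℕ) (e : RExpr) : ¬ (fill a y y' e).ModN x := by simp [fill]

@[simp] theorem modX_fill (a y y' x : ℕ) (e : RExpr) :
    (fill a y y' e).ModX x ↔ x = a := by simp [fill]

/-- The state after the enumeration of the tuples. -/
structure Enumerated (n m k : ℕ) (s : State) : Prop where
  reg3 : s.reg 3 = n.choose k
  reg4 : s.reg 4 = m.choose k
  tuples₁ : HoldsTuples n k (n.choose k) (s.narr 1)
  indicators₁ : HoldsIndicators n k (s.narr 2)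
  tuples₂ : HoldsTuples m k (m.choose k) (s.narr 21)
  indicators₂ : HoldsIndicators m k (s.narr 22)
  signs : ∀ c ≤ k, s.rarr 2 0 c = (-1) ^ c

theorem runs_bothSides (s : State) {n m k : ℕ} (h0 : s.reg 0 = n) (h1 : s.reg 1 = m)
    (h2 : s.reg 2 = k) (hkn : k ≤ n) (hkm : k ≤ m) (hz : ∀ a i j, s.narr a i j = 0) :
    Runs bothSides s (300 * (n.choose k * (k + 1)) + 300 * (m.choose k * (k + 1)))
      (Enumerated n m k) := by
  have hpos : 0 < n.choose k := Nat.choose_pos hkn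
  have hNk : k + 1 ≤ n.choose k * (k + 1) := Nat.le_mul_of_pos_left _ hpos
  have hpos' : 0 < m.choose k := Nat.choose_pos hkm
  have hNk' : k + 1 ≤ m.choose k * (k + 1) := Nat.le_mul_of_pos_left _ hpos'
  refine (Runs.loopFree_seq (by simp) <|
    (runs_oneSide 0 _ (n := n) (k := k) (by simp [h0]) (by simp [h2]) hkn (by simp [hz])).seq
      fun s₁ hk₁ h₁ => Runs.loopFree_seq (by simp) <|
    (runs_oneSide 20 _ (n := m) (k := k) ?_ ?_ hkm ?_).seq
      fun s₂ hk₂ h₂ => Runs.loopFree_seq (by simp) <|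
    (runs_signs _ (k := k) ?_).mono le_rfl fun s₃ hk₃ h₃ => ?_).le
      (by simp [Prog.steps, NExpr.cost]; omega)
  · simp [hk₁.reg 1, h1]
  · simp [hk₁.reg 2, h2]
  · simp [hk₁.narr 22, hz]
  · simp [hk₂.reg 2, hk₁.reg 2, h2]
  · refine ⟨?_, ?_, ?_, ?_, ?_, ?_, h₃⟩
    · simp [hk₃.reg 3, hk₂.reg 3, h₁.1]
    · simp [hk₃.reg 4, h₂.1]
    · simpa [hk₃.narr 1, hk₂.narr 1] using h₁.2.1
    · simpa [hk₃.narr 2, hk₂.narr 2] using h₁.2.2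
    · simpa [hk₃.narr 21] using h₂.2.1
    · simpa [hk₃.narr 22] using h₂.2.2

theorem runs_bothTables (s : State) {n m k : ℕ} (hk0 : 0 < k) (hkn : k ≤ n) (hkm : k ≤ m)
    (h2 : s.reg 2 = k) (hs : Enumerated n m k s) (i₀ : Fin (n.choose k)) (j₀ : Fin (m.choose k))
    (h5 : s.reg 5 = i₀) (h6 : s.reg 6 = j₀)
    (h3 : ∀ i j, s.narr 3 i j = 0) (h4 : ∀ i j, s.narr 4 i j = 0)
    (h23 : ∀ i j, s.narr 23 i j = 0) (h24 : ∀ i j, s.narr 24 i j = 0)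
    (h10 : ∀ i j, s.rarr 10 i j = 0) (h30 : ∀ i j, s.rarr 30 i j = 0) :
    Runs bothTables s (210 * (n.choose k * (k + 1)) + 210 * (m.choose k * (k + 1)))
      (fun s' => HoldsExchanges n k i₀ (s'.narr 3) (s'.rarr 10) (s'.narr 4) ∧
        HoldsExchanges m k j₀ (s'.narr 23) (s'.rarr 30) (s'.narr 24)) := by
  have hNk : 1 ≤ n.choose k * (k + 1) := Nat.mul_pos i₀.pos (by omega)
  have hNk' : 1 ≤ m.choose k * (k + 1) := Nat.mul_pos j₀.pos (by omega)
  refine (Runs.loopFree_seq (by simp) <|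
    (runs_exchangeTables 0 _ hk0 hkn (by simp [h2]) (by simp [hs.reg3]) (by simpa using hs.tuples₁)
      (by simpa using hs.indicators₁) (by simpa using hs.signs) i₀ (by simp [h5])
      (by simpa using h3) (by simpa using h4) (by simpa using h10)).seq
      fun s₁ hk₁ h₁ => Runs.loopFree_seq (by simp) <|
    (runs_exchangeTables 20 _ hk0 hkm ?_ ?_ ?_ ?_ ?_ j₀ ?_ ?_ ?_ ?_).mono le_rfl
      fun s₂ hk₂ h₂ => ⟨?_, h₂⟩).le (by simp [Prog.steps, NExpr.cost]; omega)
  · simp [hk₁.reg 2, h2]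
  · simp [hk₁.reg 4, hs.reg4]
  · simpa [hk₁.narr 21] using hs.tuples₂
  · simpa [hk₁.narr 22] using hs.indicators₂
  · simpa [hk₁.rarr 2] using hs.signs
  · simp [hk₁.reg 6, h6]
  · simpa [hk₁.narr 23] using h23
  · simpa [hk₁.narr 24] using h24
  · simpa [hk₁.rarr 30] using h30
  · simpa [hk₂.narr 3, hk₂.narr 4, hk₂.rarr 10] using h₁

/-- The row table applies to any choice of columns; the column table is used through the transpose,
so the two signs multiply. -/
theorem HoldsExchanges.minor_eq {n m k : ℕ} {A : Matrix (Fin n) (Fin m) ℝ} {i₀ : Fin (n.choose k)}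
    {j₀ : Fin (m.choose k)} {IDX IDX' : ℕ → ℕ → ℕ} {SGN SGN' : ℕ → ℕ → ℝ} {INFO INFO' : ℕ → ℕ → ℕ}
    (h : HoldsExchanges n k i₀ IDX SGN INFO) (h' : HoldsExchanges m k j₀ IDX' SGN' INFO')
    {C : ℕ → ℕ → ℝ} (hC : ∀ (i : Fin (n.choose k)) (j : Fin (m.choose k)), C i j = compound k A i j)
    (a b : Fin k) (x : Fin n) (y : Fin m) :
    (A.submatrix (Function.update (tuple n k i₀) a x) (tuple m k j₀)).det =
      SGN a x * C (IDX a x) j₀ ∧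
    (A.submatrix (tuple n k i₀) (Function.update (tuple m k j₀) b y)).det =
      SGN' b y * C i₀ (IDX' b y) ∧
    (A.submatrix (Function.update (tuple n k i₀) a x) (Function.update (tuple m k j₀) b y)).det =
      SGN a x * SGN' b y * C (IDX a x) (IDX' b y) := by
  obtain ⟨i, hi, h1⟩ := h.minor a x
  obtain ⟨j, hj, h2⟩ := h'.minor b y
  have h2' : ∀ I : Fin k → Fin n, (A.submatrix I (Function.update (tuple m k j₀) b y)).det =
      SGN' b y * (A.submatrix I (tuple m k j)).det := fun I => by
    rw [← Matrix.det_transpose, Matrix.transpose_submatrix, h2, ← Matrix.transpose_submatrix,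
      Matrix.det_transpose]
  rw [hi, hj, hC, hC, hC, h1, h2', h1, h2']
  exact ⟨rfl, rfl, (mul_assoc _ _ _).symm⟩

theorem runs_coordinates (s : State) {n m k : ℕ} (hk0 : 0 < k) (hkn : k ≤ n) (hkm : k ≤ m)
    {A : Matrix (Fin n) (Fin m) ℝ} {i₀ : Fin (n.choose k)} {j₀ : Fin (m.choose k)}
    (h0 : s.reg 0 = n) (h1 : s.reg 1 = m) (h2 : s.reg 2 = k) (h5 : s.reg 5 = i₀) (h6 : s.reg 6 = j₀)
    (hC : ∀ (i : Fin (n.choose k)) (j : Fin (m.choose k)), s.rarr 0 i j = compound k A i j)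
    (hr : HoldsExchanges n k i₀ (s.narr 3) (s.rarr 10) (s.narr 4))
    (hc : HoldsExchanges m k j₀ (s.narr 23) (s.rarr 30) (s.narr 24)) :
    Runs coordinates s (50 * (n * k) + 50 * (k * m)) (fun s' =>
      (∀ (x : Fin n) (a : Fin k),
        s'.rarr 3 x a = MinorExchange.rowCoord A (tuple n k i₀) (tuple m k j₀) x a) ∧
      ∀ (b : Fin k) (y : Fin m),
        s'.rarr 4 b y = MinorExchange.colCoord A (tuple n k i₀) (tuple m k j₀) b y) := by
  have hD : s.rarr 0 i₀ j₀ = (A.submatrix (tuple n k i₀) (tuple m k j₀)).det := hC i₀ j₀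
  refine Runs.le (Runs.seq (runs_fill (N := n) (M := k) (fun x a => s.rarr 10 a x *
      s.rarr 0 (s.narr 3 a x) j₀ / s.rarr 0 i₀ j₀) h0 h2 (by omega) (by omega)
      (he := fun x hx a ha s' hk h7 h8 => ?_)) fun s₁ hk₁ h₁ => Runs.mono (runs_fill (N := k) (M := m)
      (fun b y => s.rarr 30 b y * s.rarr 0 i₀ (s.narr 23 b y) / s.rarr 0 i₀ j₀) ?_ ?_
      (by omega) (by omega) (he := fun b hb y hy s' hk h7 h8 => ?_)) le_rfl
      (Q' := _) fun s₂ hk₂ h₂ => ⟨fun x a => ?_, fun b y => ?_⟩) ?_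
  · simp [h7, h8, hk.rarr 10, hk.rarr 0, hk.narr 3, hk.reg 5, hk.reg 6, h5, h6]
  · simp [hk₁.reg 2, h2]
  · simp [hk₁.reg 1, h1]
  · simp [h7, h8, hk.rarr 30, hk.rarr 0, hk.narr 23, hk.reg 5, hk.reg 6, h5, h6,
      hk₁.rarr 30, hk₁.rarr 0, hk₁.narr 23, hk₁.reg 5, hk₁.reg 6]
  -- A dummy column: `HoldsExchanges.minor_eq` treats rows and columns at once.
  · have y : Fin m := ⟨0, by omega⟩
    rw [hk₂.rarr 3 (by simp), h₁ x x.2 a a.2, hD, ← (hr.minor_eq hc hC a a x y).1]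
    rfl
  · have x : Fin n := ⟨0, by omega⟩
    rw [h₂ b b.2 y y.2, hD, ← (hr.minor_eq hc hC b b x y).2.1]
    rfl
  · simp [RExpr.cost, NExpr.cost]
    gcongr <;> norm_num

/-- The cost of the preparation, up to a constant factor. -/
def prepareCost (n m k : ℕ) : ℕ :=
  n.choose k * (k + 1) + m.choose k * (k + 1) + n.choose k * m.choose k + n * k + k * m

@[simp] theorem initial_narr (n m k : ℕ) (M : Matrix (Fin (n.choose k)) (Fin (m.choose k)) ℝ)
    (a i j : ℕ) : (initial n m k M).narr a i j = 0 := rfl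

theorem runs_prepare {n m k : ℕ} (A : Matrix (Fin n) (Fin m) ℝ) (hk0 : 0 < k) (hk : k ≤ A.rank) :
    Runs prepare (initial n m k (compound k A)) (600 * prepareCost n m k)
      (fun s => ∃ i₀ j₀, Prepared A (k := k) i₀ j₀ s) := by
  have hkn : k ≤ n := hk.trans A.rank_le_height
  have hkm : k ≤ m := hk.trans A.rank_le_width
  set s := initial n m k (compound k A) with hs
  have hC : ∀ (i : Fin (n.choose k)) (j : Fin (m.choose k)), s.rarr 0 i j = compound k A i j := by
    intro i j
    simp [hs, initial]
  have hX : ∀ a i j, a ≠ 0 → s.rarr a i j = 0 := fun a i j ha => by simp [hs, initial, ha]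
  have hNn : ∀ a i j, s.narr a i j = 0 := fun a i j => rfl
  have r0 : s.reg 0 = n := rfl
  have r1 : s.reg 1 = m := rfl
  have r2 : s.reg 2 = k := rfl
  clear_value s
  obtain ⟨I, J, hI, hJ, hIJ⟩ := MinorExchange.exists_minor_ne_zero A hk
  obtain ⟨i, rfl⟩ := exists_tuple_eq hI
  obtain ⟨j, rfl⟩ := exists_tuple_eq hJ
  refine Runs.le ((runs_bothSides s r0 r1 r2 hkn hkm hNn).seq fun s₁ hk₁ h₁ =>
    (runs_search (N := n.choose k) (M := m.choose k) (s.rarr 0) h₁.reg3 h₁.reg4 i.pos j.pos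
      (he := fun x hx y hy s' hk h7 h8 => ?_)).seq fun s₂ hk₂ h₂ => ?_)
      (c := 300 * (n.choose k * (k + 1)) + 300 * (m.choose k * (k + 1)) +
        (66 * (n.choose k * m.choose k) + (210 * (n.choose k * (k + 1)) +
          210 * (m.choose k * (k + 1)) + (50 * (n * k) + 50 * (k * m)))))
      (by unfold prepareCost; omega)
  · simp [h7, h8, hk.rarr 0, hk₁.rarr 0, bothSides]
  obtain ⟨hi₀, hj₀, hD⟩ := h₂ ⟨i, i.2, j, j.2, by rw [hC]; exact hIJ⟩
  obtain ⟨i₀, hi₀'⟩ : ∃ i₀ : Fin (n.choose k), s₂.reg 5 = i₀ := ⟨⟨_, hi₀⟩, rfl⟩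
  obtain ⟨j₀, hj₀'⟩ : ∃ j₀ : Fin (m.choose k), s₂.reg 6 = j₀ := ⟨⟨_, hj₀⟩, rfl⟩
  rw [hi₀', hj₀', hC] at hD
  have henum : Enumerated n m k s₂ := by
    refine ⟨?_, ?_, ?_, ?_, ?_, ?_, ?_⟩
    · simp [hk₂.reg 3, h₁.reg3]
    · simp [hk₂.reg 4, h₁.reg4]
    · simpa [hk₂.narr 1] using h₁.tuples₁
    · simpa [hk₂.narr 2] using h₁.indicators₁
    · simpa [hk₂.narr 21] using h₁.tuples₂
    · simpa [hk₂.narr 22] using h₁.indicators₂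
    · simpa [hk₂.rarr 2] using h₁.signs
  refine (runs_bothTables s₂ hk0 hkn hkm ?_ henum i₀ j₀ hi₀' hj₀' ?_ ?_ ?_ ?_ ?_ ?_).seq
    fun s₃ hk₃ h₃ => ?_
  · simp [hk₂.reg 2, hk₁.reg 2, bothSides, r2]
  · simp [hk₂.narr 3, hk₁.narr 3, bothSides, hNn]
  · simp [hk₂.narr 4, hk₁.narr 4, bothSides, hNn]
  · simp [hk₂.narr 23, hk₁.narr 23, bothSides, hNn]
  · simp [hk₂.narr 24, hk₁.narr 24, bothSides, hNn]
  · simp [hk₂.rarr 10, hk₁.rarr 10, bothSides, hX]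
  · simp [hk₂.rarr 30, hk₁.rarr 30, bothSides, hX]
  have q0 : s₃.reg 0 = n := by
    simp [hk₃.reg 0, hk₂.reg 0, hk₁.reg 0, bothSides, bothTables, r0]
  have q1 : s₃.reg 1 = m := by
    simp [hk₃.reg 1, hk₂.reg 1, hk₁.reg 1, bothSides, bothTables, r1]
  have q2 : s₃.reg 2 = k := by
    simp [hk₃.reg 2, hk₂.reg 2, hk₁.reg 2, bothSides, bothTables, r2]
  have q5 : s₃.reg 5 = i₀ := by simp [hk₃.reg 5, bothTables, hi₀']
  have q6 : s₃.reg 6 = j₀ := by simp [hk₃.reg 6, bothTables, hj₀']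
  have qC : ∀ (i : Fin (n.choose k)) (j : Fin (m.choose k)), s₃.rarr 0 i j = compound k A i j := by
    simp [hk₃.rarr 0, hk₂.rarr 0, hk₁.rarr 0, bothSides, bothTables, hC]
  refine (runs_coordinates s₃ hk0 hkn hkm q0 q1 q2 q5 q6 qC h₃.1 h₃.2).mono le_rfl
    fun s₄ hk₄ h₄ => ⟨i₀, j₀, ?_⟩
  constructor
  · simp [hk₄.reg 0, coordinates, q0]
  · simp [hk₄.reg 1, coordinates, q1]
  · simp [hk₄.reg 2, coordinates, q2]
  · simp [hk₄.reg 3, coordinates, hk₃.reg 3, bothTables, henum.reg3]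
  · simp [hk₄.reg 4, coordinates, hk₃.reg 4, bothTables, henum.reg4]
  · simp [hk₄.reg 5, coordinates, q5]
  · simp [hk₄.reg 6, coordinates, q6]
  · simpa [hk₄.rarr 0, coordinates] using qC
  · exact hD
  · simpa [hk₄.narr 1, coordinates, hk₃.narr 1, bothTables] using henum.tuples₁
  · simpa [hk₄.narr 2, coordinates, hk₃.narr 2, bothTables] using henum.indicators₁
  · simpa [hk₄.narr 3, hk₄.narr 4, hk₄.rarr 10, coordinates] using h₃.1
  · simpa [hk₄.narr 23, hk₄.narr 24, hk₄.rarr 30, coordinates] using h₃.2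
  · exact h₄.1
  · exact h₄.2

end InverseCompound

namespace InverseCompound

open NExpr Prog

/-! ### Matrix products -/

/-- Write the entry `(reg 7, reg 8)` of the product of the arrays `b` and `c` into `a`. -/
def dot (a b c y : ℕ) : Prog :=
  seq (setReal a (reg 7) (reg 8) (.ofNat (lit 0)))
    (loop 9 y (setReal a (reg 7) (reg 8) (.add (.get a (reg 7) (reg 8))
      (.mul (.get b (reg 7) (reg 9)) (.get c (reg 9) (reg 8))))))

def mulRow (a b c y' y : ℕ) : Prog := loop 8 y' (dot a b c y)

def mulArray (a b c x y' y : ℕ) : Prog := loop 7 x (mulRow a b c y' y)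

@[simp] theorem modR_dot (a b c y x : ℕ) : (dot a b c y).ModR x ↔ x = 9 := by simp [dot]

@[simp] theorem modN_dot (a b c y x : ℕ) : ¬ (dot a b c y).ModN x := by simp [dot]

@[simp] theorem modX_dot (a b c y x : ℕ) : (dot a b c y).ModX x ↔ x = a := by simp [dot]

@[simp] theorem modR_mulRow (a b c y' y x : ℕ) :
    (mulRow a b c y' y).ModR x ↔ x = 8 ∨ x = 9 := by simp [mulRow]

@[simp] theorem modN_mulRow (a b c y' y x : ℕ) : ¬ (mulRow a b c y' y).ModN x := by simp [mulRow]

@[simp] theorem modX_mulRow (a b c y' y x : ℕ) :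
    (mulRow a b c y' y).ModX x ↔ x = a := by simp [mulRow]

@[simp] theorem modR_mulArray (a b c z y' y x : ℕ) :
    (mulArray a b c z y' y).ModR x ↔ x = 7 ∨ x = 8 ∨ x = 9 := by simp [mulArray]

@[simp] theorem modN_mulArray (a b c z y' y x : ℕ) :
    ¬ (mulArray a b c z y' y).ModN x := by simp [mulArray]

@[simp] theorem modX_mulArray (a b c z y' y x : ℕ) :
    (mulArray a b c z y' y).ModX x ↔ x = a := by simp [mulArray]

theorem runs_dot {a b c y K : ℕ} {s : State} (hab : b ≠ a) (hac : c ≠ a) (hy : s.reg y = K)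
    (hy9 : y ≠ 9) :
    Runs (dot a b c y) s (40 * (K + 1)) (fun s' => ∀ i j, s'.rarr a i j =
      if i = s.reg 7 ∧ j = s.reg 8 then ∑ l ∈ Finset.range K, s.rarr b i l * s.rarr c l j
      else s.rarr a i j) := by
  refine (Runs.loopFree_seq (by simp) ?_).le (c := _ + 34 * (K + 1)) ?_
  swap
  · simp [Prog.steps, NExpr.cost, RExpr.cost]; omega
  refine Runs.simpleLoop K (fun t s' => ∀ i j, s'.rarr a i j =
      if i = s.reg 7 ∧ j = s.reg 8 then ∑ l ∈ Finset.range t, s.rarr b i l * s.rarr c l j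
      else s.rarr a i j) (by simp [hy]) (by simp) hy9.symm (by simp) (by simp)
    (fun t s' v h => by simpa using h) (by simp) ?_
    (by simp [Prog.steps, NExpr.cost, RExpr.cost]; omega) (fun s' _ h => h)
  intro t ht s' hk hx h i j
  have hb : s'.rarr b = s.rarr b := by
    rw [hk.rarr b (by simpa using hab)]; funext i j; simp [hab]
  have hc : s'.rarr c = s.rarr c := by
    rw [hk.rarr c (by simpa using hac)]; funext i j; simp [hac]
  have h7 : s'.reg 7 = s.reg 7 := by rw [hk.reg 7 (by simp)]; simp
  have h8 : s'.reg 8 = s.reg 8 := by rw [hk.reg 8 (by simp)]; simp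
  simp only [Prog.run, NExpr.eval, RExpr.eval, State.setX_rarr, h7, h8, hx, hb, hc, h, true_and]
  split_ifs with hij
  · rw [Finset.sum_range_succ, hij.1, hij.2]
  · rfl

theorem runs_mulRow {a b c y' y M K : ℕ} {s : State} (hab : b ≠ a) (hac : c ≠ a) (hy : s.reg y = K)
    (hy' : s.reg y' = M) (hM : 1 ≤ M) (hyr : y ∉ [8, 9] := by decide)
    (hyr' : y' ∉ [8, 9] := by decide) :
    Runs (mulRow a b c y' y) s (60 * (M * (K + 1))) (fun s' => ∀ i, ∀ j < M, s'.rarr a i j =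
      if i = s.reg 7 then ∑ l ∈ Finset.range K, s.rarr b i l * s.rarr c l j
      else s.rarr a i j) := by
  simp only [List.mem_cons, List.not_mem_nil, or_false, not_or] at hyr hyr'
  refine Runs.loop M (fun t s' => ∀ i j, s'.rarr a i j =
      if i = s.reg 7 ∧ j < t then ∑ l ∈ Finset.range K, s.rarr b i l * s.rarr c l j
      else s.rarr a i j) (40 * (K + 1)) hy' (Ne.symm hyr'.1) (by simp) (by simp [hyr'])
    (fun t s' v h => by simpa using h) (by simp) ?_ (by nlinarith)
    (fun s' _ h i j hj => by simpa [hj] using h i j)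
  intro t ht s₁ hk hx h
  refine (runs_dot hab hac (K := K) (by rw [hk.reg y (by simp [hyr]), hy]) hyr.2).mono le_rfl
    fun s₂ _ h₂ i j => ?_
  have h7 : s₁.reg 7 = s.reg 7 := hk.reg 7 (by simp)
  rw [h₂, h7, hx, hk.rarr b (by simpa using hab), hk.rarr c (by simpa using hac), h]
  refine ite_ite_eq ?_ _ _
  constructor
  · rintro (⟨h, h'⟩ | ⟨h, h'⟩) <;> exact ⟨h, by omega⟩
  · rintro ⟨h, h'⟩
    by_cases hj : j = t
    · exact Or.inl ⟨h, hj⟩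
    · exact Or.inr ⟨h, by omega⟩

theorem runs_mulArray {a b c x y' y N M K : ℕ} {s : State} (hab : b ≠ a) (hac : c ≠ a)
    (hx : s.reg x = N) (hy' : s.reg y' = M) (hy : s.reg y = K) (hM : 1 ≤ M) (hN : 1 ≤ N)
    (hxr : x ∉ [7, 8, 9] := by decide) (hyr : y ∉ [7, 8, 9] := by decide)
    (hyr' : y' ∉ [7, 8, 9] := by decide) :
    Runs (mulArray a b c x y' y) s (80 * (N * (M * (K + 1)))) (fun s' => ∀ i < N, ∀ j < M,
      s'.rarr a i j = ∑ l ∈ Finset.range K, s.rarr b i l * s.rarr c l j) := by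
  simp only [List.mem_cons, List.not_mem_nil, or_false, not_or] at hxr hyr hyr'
  have hMK : 1 ≤ M * (K + 1) := Nat.mul_pos hM (by omega)
  refine Runs.loop N (fun t s' => ∀ i < t, ∀ j < M, s'.rarr a i j =
      ∑ l ∈ Finset.range K, s.rarr b i l * s.rarr c l j)
    (60 * (M * (K + 1))) hx (Ne.symm hxr.1) (by simp) (by simp [hxr])
    (fun t s' v h => by simpa using h) (by simp) ?_ (by nlinarith) (fun s' _ h => h)
  intro t ht s₁ hk hx₁ h
  refine (runs_mulRow hab hac (K := K) (M := M) (by rw [hk.reg y (by simp [hyr]), hy])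
    (by rw [hk.reg y' (by simp [hyr']), hy']) hM (by simp [hyr]) (by simp [hyr'])).mono le_rfl
    fun s₂ _ h₂ i hi j hj => ?_
  rw [h₂ i j hj, hk.rarr b (by simpa using hab), hk.rarr c (by simpa using hac), hx₁]
  split_ifs with h'
  · rfl
  · exact h i (by omega) j hj

/-! ### Order equal to the rank -/

/-- Multiplying the first row of Z by the base minor D forms diag(D, 1, …, 1) · Z in place. -/
def scaleRow : Prog :=
  loop 7 1 (setReal 4 (lit 0) (reg 7) (.mul (.get 0 (reg 5) (reg 6)) (.get 4 (lit 0) (reg 7))))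

/-- The rows of Y at the base tuple form the identity matrix, so these rows of the product are
copies. -/
def baseRows : Prog :=
  loop 7 2 (loop 8 1 (setReal 1 (get 1 (reg 5) (reg 7)) (reg 8) (.get 4 (reg 7) (reg 8))))

/-- Only the n − k rows outside the base tuple are multiplied out; a full product could exceed the
time bound. -/
def otherRows : Prog :=
  loop 7 0 (ite (.nle (get 2 (reg 5) (reg 7)) (lit 0)) (mulRow 1 3 4 1 2) skip)

def fullOrderProg : Prog := seq prepare (seq scaleRow (seq baseRows otherRows))

theorem runs_scaleRow {s : State} {m : ℕ} (h1 : s.reg 1 = m) :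
    Runs scaleRow s (30 * (m + 1)) (fun s' => ∀ b y, s'.rarr 4 b y =
      if b = 0 ∧ y < m then s.rarr 0 (s.reg 5) (s.reg 6) * s.rarr 4 b y else s.rarr 4 b y) := by
  refine Runs.simpleLoop m (fun t s' => ∀ b y, s'.rarr 4 b y =
      if b = 0 ∧ y < t then s.rarr 0 (s.reg 5) (s.reg 6) * s.rarr 4 b y else s.rarr 4 b y)
    h1 (by simp) (by decide) (by simp) (by simp) (fun t s' v h => by simpa using h) (by simp) ?_
    (by simp [Prog.steps, NExpr.cost, RExpr.cost]; omega) (fun s' _ h => h)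
  intro t ht s' hk hx h b y
  simp only [Prog.run, NExpr.eval, RExpr.eval, State.setX_rarr, hx, hk.reg 5 (by simp),
    hk.reg 6 (by simp), hk.rarr 0 (by simp), h, true_and, lt_irrefl, and_false, if_false]
  by_cases hb : b = 0
  · subst hb
    by_cases hy : y = t
    · simp [hy]
    · have : y < t + 1 ↔ y < t := by omega
      simp [hy, this]
  · simp [hb]

theorem runs_baseRows {s : State} {k m : ℕ} (hm : 1 ≤ m) (h2 : s.reg 2 = k) (h1 : s.reg 1 = m)
    (hinj : ∀ c < k, ∀ d < k, s.narr 1 (s.reg 5) c = s.narr 1 (s.reg 5) d → c = d) :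
    Runs baseRows s (60 * ((k + 1) * m)) (fun s' => ∀ c < k, ∀ j < m,
      s'.rarr 1 (s.narr 1 (s.reg 5) c) j = s.rarr 4 c j) := by
  refine Runs.loop k (fun t s' => ∀ c < t, ∀ j < m,
      s'.rarr 1 (s.narr 1 (s.reg 5) c) j = s.rarr 4 c j) (30 * m) h2 (by decide) (by simp)
    (by simp) (fun t s' v h => by simpa using h) (by simp) ?_ (by nlinarith) (fun s' _ h => h)
  intro t ht s₁ hk₁ hx₁ h₁
  refine Runs.simpleLoop m (fun t' s' => ∀ c j, (c < t ∧ j < m ∨ c = t ∧ j < t') →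
      s'.rarr 1 (s.narr 1 (s.reg 5) c) j = s.rarr 4 c j) (by rw [hk₁.reg 1 (by simp), h1])
    (by simp) (by decide) (by simp) (by simp) (fun t s' v h => by simpa using h) ?_ ?_
    (by simp [Prog.steps, NExpr.cost, RExpr.cost]; omega) ?_
  · intro c j h
    exact h₁ c (by omega) j (by omega)
  · intro t' ht' s₂ hk₂ hx₂ h₂ c j hcj
    have h7 : s₂.reg 7 = t := by rw [hk₂.reg 7 (by simp), hx₁]
    have h5 : s₂.reg 5 = s.reg 5 := by rw [hk₂.reg 5 (by simp), hk₁.reg 5 (by simp)]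
    have hT : s₂.narr 1 = s.narr 1 := by rw [hk₂.narr 1 (by simp), hk₁.narr 1 (by simp)]
    have hZ : s₂.rarr 4 = s.rarr 4 := by rw [hk₂.rarr 4 (by simp), hk₁.rarr 4 (by simp)]
    simp only [Prog.run, NExpr.eval, RExpr.eval, State.setX_rarr, h7, hx₂, h5, hT, hZ, true_and]
    split_ifs with h
    · rw [hinj c (by omega) t ht h.1, h.2]
    · refine h₂ c j ?_
      by_contra hcon
      exact h ⟨by rw [show c = t by omega], by omega⟩
  · intro s' _ h c hc j hj
    exact h c j (by omega)

/-- The iterations cost very different amounts, bounded time for base rows and a row product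
otherwise, so the costs are summed by `Runs.loop_sum` and split by a filter. -/
theorem runs_otherRows {s : State} {n m k : ℕ} (hm : 1 ≤ m) (h0 : s.reg 0 = n)
    (h1 : s.reg 1 = m) (h2 : s.reg 2 = k) :
    Runs otherRows s (30 * (n + 1) + 60 * (((Finset.range n).filter
        fun x => s.narr 2 (s.reg 5) x = 0).card * (m * (k + 1)))) (fun s' =>
      ∀ x < n, ∀ j < m, s'.rarr 1 x j = if s.narr 2 (s.reg 5) x = 0 then
        ∑ l ∈ Finset.range k, s.rarr 3 x l * s.rarr 4 l j else s.rarr 1 x j) := by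
  subst h0
  refine (Runs.loop_sum (fun t s' => ∀ x, ∀ j < m, s'.rarr 1 x j =
      if x < t ∧ s.narr 2 (s.reg 5) x = 0 then
        ∑ l ∈ Finset.range k, s.rarr 3 x l * s.rarr 4 l j else s.rarr 1 x j)
    (fun x => 8 + if s.narr 2 (s.reg 5) x = 0 then 60 * (m * (k + 1)) else 0)
    (by decide) (by simp) (by simp) (fun t s' v h => by simpa using h) (by simp) ?_).mono ?_
    fun s' _ h x hx j hj => by simpa [hx] using h x j hj
  · intro t ht s₁ hk₁ hx₁ h₁
    have h5 : s₁.reg 5 = s.reg 5 := hk₁.reg 5 (by simp)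
    have hS : s₁.narr 2 = s.narr 2 := hk₁.narr 2 (by simp)
    have hY : s₁.rarr 3 = s.rarr 3 := hk₁.rarr 3 (by simp)
    have hZ : s₁.rarr 4 = s.rarr 4 := hk₁.rarr 4 (by simp)
    by_cases hb : s.narr 2 (s.reg 5) t = 0
    · refine (Runs.ite_true (by simp [h5, hS, hx₁, hb]) ((runs_mulRow (M := m) (K := k)
        (by decide) (by decide) (by rw [hk₁.reg 2 (by simp), h2])
        (by rw [hk₁.reg 1 (by simp), h1]) hm).mono le_rfl fun s₂ _ h₂ x j hj => ?_)).le
        (by simp [hb, Test.cost, NExpr.cost])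
      rw [h₂ x j hj, h₁ x j hj, hY, hZ, hx₁]
      refine ite_ite_eq ?_ _ _
      constructor
      · rintro (rfl | h)
        · exact ⟨by omega, hb⟩
        · exact ⟨by omega, h.2⟩
      · rintro ⟨h, h'⟩
        by_cases hxt : x = t
        · exact Or.inl hxt
        · exact Or.inr ⟨by omega, h'⟩
    · refine (Runs.ite_false (by simp [h5, hS, hx₁, hb]) (Runs.loopFree (by simp) le_rfl ?_)).le
        (by simp [hb, Test.cost, NExpr.cost, Prog.steps])
      intro x j hj
      simp only [Prog.run, h₁ x j hj]
      refine if_congr ⟨fun h => ⟨by omega, h.2⟩, fun h => ⟨?_, h.2⟩⟩ rfl rfl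
      have : x ≠ t := fun h' => hb (h' ▸ h.2)
      omega
  · have : ∀ x, (8 + (if s.narr 2 (s.reg 5) x = 0 then 60 * (m * (k + 1)) else 0) + 8) =
        16 + if s.narr 2 (s.reg 5) x = 0 then 60 * (m * (k + 1)) else 0 := fun x => by omega
    simp only [this]
    rw [Finset.sum_add_distrib, ← Finset.sum_filter, Finset.sum_const, Finset.sum_const,
      Finset.card_range, smul_eq_mul, smul_eq_mul]
    rw [mul_left_comm]
    omega

/-- For `c ≠ a` the numerator is a minor with the row `I c` taken twice. -/
theorem rowCoord_base {n m k : ℕ} {A : Matrix (Fin n) (Fin m) ℝ} {I : Fin k → Fin n}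
    {J : Fin k → Fin m} (hD : (A.submatrix I J).det ≠ 0) (c a : Fin k) :
    MinorExchange.rowCoord A I J (I c) a = if c = a then 1 else 0 := by
  rw [MinorExchange.rowCoord, Matrix.of_apply]
  split_ifs with h
  · rw [h, Function.update_eq_self, div_self hD]
  · rw [det_submatrix_eq_zero_of_not_injective, zero_div]
    intro hinj
    exact h (hinj (by simp [h]))

theorem card_filter_notMem {n k : ℕ} {I : Fin k → Fin n} (hI : Function.Injective I) {S : ℕ → ℕ}
    (hS : ∀ x, S x = 0 ↔ ∀ c, (I c : ℕ) ≠ x) :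
    ((Finset.range n).filter fun x => S x = 0).card = n - k := by
  have h : ((Finset.range n).filter fun x => S x = 0) =
      Finset.range n \ Finset.univ.image fun c => (I c : ℕ) := by
    ext x
    simp [hS]
  rw [h, Finset.card_sdiff_of_subset, Finset.card_range,
    Finset.card_image_of_injective (f := fun c => (I c : ℕ)) _
      fun c d h => hI (Fin.val_injective h), Finset.card_univ,
    Fintype.card_fin]
  intro x hx
  simp only [Finset.mem_image, Finset.mem_univ, true_and] at hx
  obtain ⟨c, rfl⟩ := hx
  simp

/-- The diagonal matrix with the entry `d` in the first row, and ones below. -/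
def firstDiagonal (k : ℕ) (d : ℝ) : Matrix (Fin k) (Fin k) ℝ :=
  Matrix.diagonal fun b => if (b : ℕ) = 0 then d else 1

theorem det_firstDiagonal {k : ℕ} (hk : 0 < k) (d : ℝ) : (firstDiagonal k d).det = d := by
  obtain ⟨k, rfl⟩ := Nat.exists_eq_succ_of_ne_zero hk.ne'
  rw [firstDiagonal, Matrix.det_diagonal, Fin.prod_univ_succ]
  simp

/-- The cost of the computation for order equal to the rank, up to a constant factor. -/
def fullCost (n m k : ℕ) : ℕ :=
  prepareCost n m k + (m + 1) + (k + 1) * m + (n + 1) + (n - k) * (m * (k + 1))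

theorem runs_fullOrderProg {n m k : ℕ} (A : Matrix (Fin n) (Fin m) ℝ) (hk0 : 0 < k)
    (hk : k = A.rank) :
    ∃ B : Matrix (Fin n) (Fin m) ℝ, compound k B = compound k A ∧
      Runs fullOrderProg (initial n m k (compound k A)) (600 * fullCost n m k)
        (fun s => ∀ (i : Fin n) (j : Fin m), s.rarr 1 i j = B i j) := by
  have hkm : k ≤ m := hk.trans_le A.rank_le_width
  obtain ⟨t, s, ht, he, i₀, j₀, hs⟩ := runs_prepare A hk0 hk.le
  set I := tuple n k i₀
  set J := tuple m k j₀
  set D := (A.submatrix I J).det with hD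
  have hI : Function.Injective I := (tuple_strictMono i₀).injective
  have hT : ∀ c (hc : c < k), s.narr 1 (s.reg 5) c = I ⟨c, hc⟩ := fun c hc => by
    rw [hs.reg5]; exact hs.tuples i₀ i₀.2 ⟨c, hc⟩
  have hS : ∀ x, s.narr 2 (s.reg 5) x = 0 ↔ ∀ c, (I c : ℕ) ≠ x := by
    rw [hs.reg5]; exact hs.indicators i₀
  -- Any middle factor of determinant `D` is admissible; the diagonal one costs a single row
  -- scaling.
  refine ⟨MinorExchange.rowCoord A I J * firstDiagonal k D * MinorExchange.colCoord A I J,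
    compound_eq_of_rank_eq hk.symm hs.ne_zero (det_firstDiagonal hk0 _), ?_⟩
  refine Runs.le (c := 600 * prepareCost n m k + (30 * (m + 1) + (60 * ((k + 1) * m) +
    (30 * (n + 1) + 60 * ((n - k) * (m * (k + 1))))))) ?_ (by unfold fullCost; omega)
  refine Runs.seq ⟨t, s, ht, he, rfl⟩ ?_
  rintro s' - rfl
  refine (runs_scaleRow hs.reg1).seq fun s₁ hk₁ h₁ => ?_
  have hZ : ∀ b y : ℕ, (hb : b < k) → (hy : y < m) → s₁.rarr 4 b y =
      (firstDiagonal k D * MinorExchange.colCoord A I J) ⟨b, hb⟩ ⟨y, hy⟩ := fun b y hb hy => by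
    have hz := hs.colCoord ⟨b, hb⟩ ⟨y, hy⟩
    simp only at hz
    rw [h₁, hs.reg5, hs.reg6, hs.input, firstDiagonal, Matrix.diagonal_mul, hz]
    by_cases hb0 : b = 0
    · rw [if_pos ⟨hb0, hy⟩, if_pos hb0]; rfl
    · rw [if_neg fun h => hb0 h.1, if_neg hb0, one_mul]
  have h5₁ : s₁.reg 5 = s.reg 5 := hk₁.reg 5 (by simp [scaleRow])
  have hT₁ : s₁.narr 1 = s.narr 1 := hk₁.narr 1 (by simp [scaleRow])
  refine (runs_baseRows (k := k) (m := m) (by omega) (by rw [hk₁.reg 2 (by simp [scaleRow]), hs.reg2])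
    (by rw [hk₁.reg 1 (by simp [scaleRow]), hs.reg1]) ?_).seq fun s₂ hk₂ h₂ => ?_
  · rw [h5₁, hT₁]
    intro c hc d hd hcd
    rw [hT c hc, hT d hd, Fin.val_inj] at hcd
    simpa using hI hcd
  rw [h5₁, hT₁] at h₂
  have h5₂ : s₂.reg 5 = s.reg 5 := by rw [hk₂.reg 5 (by simp [baseRows]), h5₁]
  have hS₂ : s₂.narr 2 = s.narr 2 := by
    rw [hk₂.narr 2 (by simp [baseRows]), hk₁.narr 2 (by simp [scaleRow])]
  have hY₂ : s₂.rarr 3 = s.rarr 3 := by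
    rw [hk₂.rarr 3 (by simp [baseRows]), hk₁.rarr 3 (by simp [scaleRow])]
  have hZ₂ : s₂.rarr 4 = s₁.rarr 4 := by rw [hk₂.rarr 4 (by simp [baseRows])]
  refine (runs_otherRows (n := n) (m := m) (k := k) (by omega) ?_ ?_ ?_).mono ?_
    fun s₃ _ h₃ x j => ?_
  · rw [hk₂.reg 0 (by simp [baseRows]), hk₁.reg 0 (by simp [scaleRow]), hs.reg0]
  · rw [hk₂.reg 1 (by simp [baseRows]), hk₁.reg 1 (by simp [scaleRow]), hs.reg1]
  · rw [hk₂.reg 2 (by simp [baseRows]), hk₁.reg 2 (by simp [scaleRow]), hs.reg2]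
  · rw [h5₂, hS₂, card_filter_notMem hI hS]
  · rw [h₃ x x.2 j j.2, h5₂, hS₂, hY₂, hZ₂, Matrix.mul_assoc, Matrix.mul_apply]
    split_ifs with hx
    · rw [Finset.sum_range]
      refine Finset.sum_congr rfl fun l _ => ?_
      rw [hs.rowCoord, hZ l j l.2 j.2]
    · rw [hS] at hx
      push Not at hx
      obtain ⟨c, hc⟩ := hx
      have h := h₂ c c.2 j j.2
      rw [hT c c.2] at h
      have hcx : I c = x := Fin.ext hc
      simp only [Fin.eta] at h
      rw [← hcx, h, hZ c j c.2 j.2]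
      have hrc : ∀ a, MinorExchange.rowCoord A I J (I c) a = if c = a then 1 else 0 :=
        rowCoord_base hs.ne_zero c
      simp [hrc]

end InverseCompound

namespace InverseCompound

open NExpr Prog

/-! ### Elimination -/

section Elimination

open Matrix

variable {k : ℕ}

/-- The `k × k` matrix in an array. -/
def toMatrix (k : ℕ) (X : ℕ → ℕ → ℝ) : Matrix (Fin k) (Fin k) ℝ := of fun i j => X i j

/-- The array `X` arises from `W` by multiplication with `V` from the left, and `det V = 1`. -/
structure Reduced (W : Matrix (Fin k) (Fin k) ℝ) (X V : ℕ → ℕ → ℝ) : Prop where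
  mul_eq : toMatrix k V * W = toMatrix k X
  det_eq : (toMatrix k V).det = 1

/-- The columns of `X` before `j` are those of an invertible diagonal matrix. -/
def Cleared (k j : ℕ) (X : ℕ → ℕ → ℝ) : Prop :=
  ∀ c < j, X c c ≠ 0 ∧ ∀ i < k, i ≠ c → X i c = 0

/-- The array `X'` arises from `X` by adding `q` times the row `u` to the row `p`. -/
def RowAdded (k p u : ℕ) (q : ℝ) (X X' : ℕ → ℕ → ℝ) : Prop :=
  ∀ i, ∀ l < k, X' i l = if i = p then X p l + q * X u l else X i l

theorem RowAdded.toMatrix_eq {p u : ℕ} {q : ℝ} {X X' : ℕ → ℕ → ℝ} (h : RowAdded k p u q X X')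
    (hp : p < k) (hu : u < k) :
    toMatrix k X' = transvection ⟨p, hp⟩ ⟨u, hu⟩ q * toMatrix k X := by
  ext i l
  have h1 := h i l l.2
  by_cases hi : (i : ℕ) = p
  · subst hi
    rw [Fin.eta, transvection_mul_apply_same]
    simpa [toMatrix] using h1
  · rw [transvection_mul_apply_of_ne _ _ _ _ (fun h' => hi (by rw [h']))]
    simpa [toMatrix, hi] using h1

theorem Reduced.rowAdded {W : Matrix (Fin k) (Fin k) ℝ} {X V X' V' : ℕ → ℕ → ℝ}
    (h : Reduced W X V) {p u : ℕ} {q : ℝ} (hp : p < k) (hu : u < k) (hpu : p ≠ u)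
    (hX : RowAdded k p u q X X') (hV : RowAdded k p u q V V') : Reduced W X' V' := by
  refine ⟨?_, ?_⟩
  · rw [hV.toMatrix_eq hp hu, hX.toMatrix_eq hp hu, Matrix.mul_assoc, h.mul_eq]
  · rw [hV.toMatrix_eq hp hu, det_mul, h.det_eq, det_transvection_of_ne _ _ (by simpa using hpu),
      one_mul]

/-- The added row has index `u ≥ j`, so it vanishes in all columns before `j`. -/
theorem Cleared.rowAdded {X X' : ℕ → ℕ → ℝ} {j p u : ℕ} {q : ℝ} (h : Cleared k j X)
    (hju : j ≤ u) (hu : u < k) (hX : RowAdded k p u q X X') : Cleared k j X' := by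
  have key : ∀ c < j, ∀ i, X' i c = X i c := fun c hc i => by
    rw [hX i c (by omega), (h c hc).2 u hu (by omega)]
    split_ifs with h'
    · rw [h']; ring
    · rfl
  exact fun c hc => ⟨by rw [key c hc]; exact (h c hc).1,
    fun i hi hic => by rw [key c hc]; exact (h c hc).2 i hi hic⟩

/-- An explicit kernel vector: 1 at `j`, −X_{cj}/X_{cc} at each `c < j` to cancel column `j` against
the diagonal part, and 0 beyond. -/
theorem det_eq_zero_of_cleared {X : ℕ → ℕ → ℝ} {j : ℕ} (hj : j < k) (h : Cleared k j X)
    (h0 : ∀ i, j ≤ i → i < k → X i j = 0) : (toMatrix k X).det = 0 := by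
  rw [← exists_mulVec_eq_zero_iff]
  refine ⟨fun c => if (c : ℕ) = j then 1 else if (c : ℕ) < j then -X c j / X c c else 0,
    fun hv => ?_, ?_⟩
  · simpa using congrFun hv ⟨j, hj⟩
  · ext i
    have hterm : ∀ c : Fin k, X i c *
        (if (c : ℕ) = j then 1 else if (c : ℕ) < j then -X c j / X c c else 0) =
        (if c = ⟨j, hj⟩ then X i j else 0) +
          (if c = i then (if (i : ℕ) < j then -X i j else 0) else 0) := fun c => by
      by_cases hcj : (c : ℕ) = j
      · have h1 : c = ⟨j, hj⟩ := Fin.ext hcj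
        have h2 : c = i → ¬ (i : ℕ) < j := fun h' => by rw [← h']; omega
        by_cases h3 : c = i
        · simp [h2 h3, h1]
        · simp [h1 ▸ h3, h1]
      · have h1 : c ≠ ⟨j, hj⟩ := fun h' => hcj (by rw [h'])
        by_cases hlt : (c : ℕ) < j
        · by_cases hci : c = i
          · subst hci
            have := (h c hlt).1
            simp only [hcj, h1, hlt, if_true, if_false, zero_add]
            field_simp
          · have := (h c hlt).2 i i.2 (fun h' => hci (Fin.ext h'.symm))
            simp [this, h1, hci]
        · by_cases hci : c = i
          · subst hci
            simp [hcj, h1, hlt]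
          · simp [hcj, h1, hlt, hci]
    simp only [mulVec, dotProduct, toMatrix, of_apply, Pi.zero_apply]
    rw [Finset.sum_congr rfl fun c _ => hterm c, Finset.sum_add_distrib, Finset.sum_ite_eq',
      Finset.sum_ite_eq']
    simp only [Finset.mem_univ, if_true]
    split_ifs with hi
    · ring
    · rw [h0 i (by omega) i.2]; ring

/-- Complete elimination gives V W = diag, so W⁻¹ = diag⁻¹ V; because det V = 1, det W is the
product of the pivots. -/
theorem Reduced.inv_eq {W : Matrix (Fin k) (Fin k) ℝ} {X V : ℕ → ℕ → ℝ} (h : Reduced W X V)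
    (hX : Cleared k k X) :
    W⁻¹ = (of fun i j : Fin k => V i j / X i i) ∧ W.det = ∏ i : Fin k, X i i := by
  have hd : toMatrix k X = diagonal fun i : Fin k => X i i := by
    ext i j
    by_cases hij : i = j
    · subst hij; simp [toMatrix]
    · rw [diagonal_apply_ne _ hij]
      exact (hX j j.2).2 i i.2 (fun h' => hij (Fin.ext h'))
  refine ⟨?_, ?_⟩
  · have hV : (of fun i j : Fin k => V i j / X i i) =
        diagonal (fun i : Fin k => (X i i)⁻¹) * toMatrix k V := by
      ext i j
      rw [diagonal_mul]
      simp [toMatrix, div_eq_inv_mul]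
    rw [hV]
    apply inv_eq_left_inv
    rw [Matrix.mul_assoc, h.mul_eq, hd, diagonal_mul_diagonal, ← diagonal_one]
    congr 1
    funext i
    exact inv_mul_cancel₀ (hX i i.2).1
  · rw [← det_diagonal, ← hd, ← h.mul_eq, det_mul, h.det_eq, one_mul]

end Elimination

/-- Add a multiple of the row `reg 18` to the row `reg 17`, in the arrays `6` and `7`. -/
def addRow : Prog :=
  loop 19 2 (seq
    (setReal 6 (reg 17) (reg 19) (.add (.get 6 (reg 17) (reg 19))
      (.mul (.get 5 (lit 0) (lit 0)) (.get 6 (reg 18) (reg 19)))))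
    (setReal 7 (reg 17) (reg 19) (.add (.get 7 (reg 17) (reg 19))
      (.mul (.get 5 (lit 0) (lit 0)) (.get 7 (reg 18) (reg 19))))))

/-- Instead of swapping rows, later rows are added to the pivot row while the pivot is zero. Only
transvections occur, and the determinant needs no sign bookkeeping. -/
def repair : Prog :=
  loop 16 2 (ite (.and (.not (.nle (reg 16) (reg 15)))
      (.and (.rle (.get 6 (reg 15) (reg 15)) (.ofNat (lit 0)))
        (.rle (.ofNat (lit 0)) (.get 6 (reg 15) (reg 15)))))
    (seq (seq (setReal 5 (lit 0) (lit 0) (.ofNat (lit 1)))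
      (seq (setReg 17 (reg 15)) (setReg 18 (reg 16)))) addRow) skip)

/-- Rows above the pivot are cleared as well (Gauss–Jordan), so the final matrix is diagonal. -/
def clear : Prog :=
  loop 16 2 (ite (.not (.and (.nle (reg 16) (reg 15)) (.nle (reg 15) (reg 16))))
    (seq (seq (setReal 5 (lit 0) (lit 0) (.div (.sub (.ofNat (lit 0)) (.get 6 (reg 16) (reg 15)))
        (.get 6 (reg 15) (reg 15))))
      (seq (setReg 17 (reg 16)) (setReg 18 (reg 15)))) addRow) skip)

def eliminate : Prog := loop 15 2 (seq repair clear)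

@[simp] theorem modR_addRow (x : ℕ) : addRow.ModR x ↔ x = 19 := by simp [addRow]

@[simp] theorem modN_addRow (x : ℕ) : ¬ addRow.ModN x := by simp [addRow]

@[simp] theorem modX_addRow (x : ℕ) : addRow.ModX x ↔ x = 6 ∨ x = 7 := by simp [addRow]

@[simp] theorem modR_repair (x : ℕ) : repair.ModR x ↔ x = 16 ∨ x = 17 ∨ x = 18 ∨ x = 19 := by
  simp [repair]; tauto

@[simp] theorem modN_repair (x : ℕ) : ¬ repair.ModN x := by simp [repair]

@[simp] theorem modX_repair (x : ℕ) : repair.ModX x ↔ x = 5 ∨ x = 6 ∨ x = 7 := by simp [repair]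

@[simp] theorem modR_clear (x : ℕ) : clear.ModR x ↔ x = 16 ∨ x = 17 ∨ x = 18 ∨ x = 19 := by
  simp [clear]; tauto

@[simp] theorem modN_clear (x : ℕ) : ¬ clear.ModN x := by simp [clear]

@[simp] theorem modX_clear (x : ℕ) : clear.ModX x ↔ x = 5 ∨ x = 6 ∨ x = 7 := by simp [clear]

@[simp] theorem modR_eliminate (x : ℕ) :
    eliminate.ModR x ↔ x = 15 ∨ x = 16 ∨ x = 17 ∨ x = 18 ∨ x = 19 := by
  simp [eliminate]

@[simp] theorem modN_eliminate (x : ℕ) : ¬ eliminate.ModN x := by simp [eliminate]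

@[simp] theorem modX_eliminate (x : ℕ) : eliminate.ModX x ↔ x = 5 ∨ x = 6 ∨ x = 7 := by
  simp [eliminate]

theorem runs_addRow {s : State} {k p u : ℕ} (h2 : s.reg 2 = k) (h17 : s.reg 17 = p)
    (h18 : s.reg 18 = u) (hpu : p ≠ u) :
    Runs addRow s (60 * (k + 1)) (fun s' =>
      RowAdded k p u (s.rarr 5 0 0) (s.rarr 6) (s'.rarr 6) ∧
      RowAdded k p u (s.rarr 5 0 0) (s.rarr 7) (s'.rarr 7)) := by
  refine Runs.simpleLoop k (fun t s' => ∀ i l,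
      (s'.rarr 6 i l = if i = p ∧ l < t then s.rarr 6 p l + s.rarr 5 0 0 * s.rarr 6 u l
        else s.rarr 6 i l) ∧
      (s'.rarr 7 i l = if i = p ∧ l < t then s.rarr 7 p l + s.rarr 5 0 0 * s.rarr 7 u l
        else s.rarr 7 i l)) h2 (by simp)
    (by decide) (by simp) (by simp) (fun t s' v h => by simpa using h) (by simp) ?_
    (by simp [Prog.steps, NExpr.cost, RExpr.cost]; omega)
    (fun s' _ h => ⟨fun i l hl => by simpa [hl] using (h i l).1,
      fun i l hl => by simpa [hl] using (h i l).2⟩)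
  intro t ht s' hk hx h i l
  have e17 : s'.reg 17 = p := by rw [hk.reg 17 (by simp), h17]
  have e18 : s'.reg 18 = u := by rw [hk.reg 18 (by simp), h18]
  have e5 : s'.rarr 5 = s.rarr 5 := hk.rarr 5 (by simp)
  have hcond : (i = p ∧ l = t) ∨ (i = p ∧ l < t) ↔ (i = p ∧ l < t + 1) := by
    rw [Nat.lt_succ_iff_lt_or_eq]; tauto
  rw [← ite_ite_eq hcond, ← ite_ite_eq hcond]
  constructor
  · simp only [Prog.run, NExpr.eval, RExpr.eval, State.setX_rarr, State.setX_reg, e17, e18, hx, e5,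
      (h _ _).1]
    by_cases hc : i = p ∧ l = t
    · obtain ⟨rfl, rfl⟩ := hc
      simp [hpu.symm]
    · simp [hc]
  · simp only [Prog.run, NExpr.eval, RExpr.eval, State.setX_rarr, State.setX_reg, e17, e18, hx, e5,
      (h _ _).2]
    by_cases hc : i = p ∧ l = t
    · obtain ⟨rfl, rfl⟩ := hc
      simp [hpu.symm]
    · simp [hc]

/-- If the pivot were still zero after all rows have been tried, column `j` would vanish from row
`j` on, and `det_eq_zero_of_cleared` would contradict det W ≠ 0. -/
theorem runs_repair {s : State} {k j : ℕ} {W : Matrix (Fin k) (Fin k) ℝ} (hW : W.det ≠ 0)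
    (hjk : j < k) (h2 : s.reg 2 = k) (h15 : s.reg 15 = j) (hs : Reduced W (s.rarr 6) (s.rarr 7))
    (hs' : Cleared k j (s.rarr 6)) :
    Runs repair s (130 * ((k + 1) * (k + 1))) (fun s' => Reduced W (s'.rarr 6) (s'.rarr 7) ∧
      Cleared k j (s'.rarr 6) ∧ s'.rarr 6 j j ≠ 0) := by
  refine Runs.loop k (fun t s' => Reduced W (s'.rarr 6) (s'.rarr 7) ∧
      Cleared k j (s'.rarr 6) ∧ (s'.rarr 6 j j = 0 → ∀ i, j < i → i < t → s'.rarr 6 i j = 0))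
    (60 * (k + 1) + 40) h2 (by decide) (by simp) (by simp) (fun t s' v h => by simpa using h)
    ⟨hs, hs', by simp⟩ ?_ (by nlinarith) ?_
  · rintro t ht s₁ hk₁ hx₁ ⟨hr, hc, hz⟩
    have e15 : s₁.reg 15 = j := by rw [hk₁.reg 15 (by simp), h15]
    by_cases hb : j < t ∧ s₁.rarr 6 j j = 0
    · refine (Runs.ite_true (by simp [hx₁, e15, hb]) (Runs.loopFree_seq (by simp)
        ((runs_addRow (k := k) (p := j) (u := t) ?_ ?_ ?_ hb.1.ne).mono le_rfl
          fun s₂ _ h₂ => ?_))).le (by simp [Prog.steps, Test.cost, NExpr.cost, RExpr.cost]; omega)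
      · simp [hk₁.reg 2, h2]
      · simp [e15]
      · simp [hx₁]
      · have e6 : ∀ i l, ((((setReal 5 (lit 0) (lit 0) (.ofNat (lit 1))).seq
            ((setReg 17 (reg 15)).seq (setReg 18 (reg 16)))).run s₁).rarr 6) i l =
            s₁.rarr 6 i l := by simp
        have e7 : ∀ i l, ((((setReal 5 (lit 0) (lit 0) (.ofNat (lit 1))).seq
            ((setReg 17 (reg 15)).seq (setReg 18 (reg 16)))).run s₁).rarr 7) i l =
            s₁.rarr 7 i l := by simp
        obtain ⟨hX, hV⟩ := h₂
        rw [funext fun i => funext (e6 i)] at hX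
        rw [funext fun i => funext (e7 i)] at hV
        refine ⟨hr.rowAdded hjk ht hb.1.ne hX hV, hc.rowAdded hb.1.le ht hX,
          fun h0 i hi hit => ?_⟩
        -- The new pivot is 0 + 1 · X_{tj}; if it is zero again, then X_{tj} = 0.
        rw [hX _ _ hjk, if_pos rfl, hb.2] at h0
        rw [hX _ _ hjk, if_neg hi.ne']
        rcases Nat.lt_succ_iff_lt_or_eq.1 hit with hlt | rfl
        · exact hz hb.2 i hi hlt
        · simpa using h0
    · refine (Runs.ite_false ?_ (Runs.loopFree (by simp) le_rfl ?_)).le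
        (by simp [Prog.steps, Test.cost, NExpr.cost, RExpr.cost])
      · simp only [Test.Holds, NExpr.eval, RExpr.eval, hx₁, e15]
        rintro ⟨h1, h2, h3⟩
        exact hb ⟨by omega, le_antisymm (by simpa using h2) (by simpa using h3)⟩
      · refine ⟨hr, hc, fun h0 i hi hit => ?_⟩
        rcases Nat.lt_succ_iff_lt_or_eq.1 hit with hlt | rfl
        · exact hz h0 i hi hlt
        · exact (hb ⟨hi, h0⟩).elim
  · rintro s' - ⟨hr, hc, hz⟩
    refine ⟨hr, hc, fun h0 => hW ?_⟩
    have hdet := det_eq_zero_of_cleared hjk hc fun i hi hik => by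
      rcases hi.lt_or_eq with h | rfl
      · exact hz h0 i h hik
      · exact h0
    rwa [← hr.mul_eq, Matrix.det_mul, hr.det_eq, one_mul] at hdet

theorem runs_clear {s : State} {k j : ℕ} {W : Matrix (Fin k) (Fin k) ℝ}
    (hjk : j < k) (h2 : s.reg 2 = k) (h15 : s.reg 15 = j) (hs : Reduced W (s.rarr 6) (s.rarr 7))
    (hs' : Cleared k j (s.rarr 6)) (hjj : s.rarr 6 j j ≠ 0) :
    Runs clear s (130 * ((k + 1) * (k + 1))) (fun s' => Reduced W (s'.rarr 6) (s'.rarr 7) ∧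
      Cleared k (j + 1) (s'.rarr 6)) := by
  refine Runs.loop k (fun t s' => Reduced W (s'.rarr 6) (s'.rarr 7) ∧
      Cleared k j (s'.rarr 6) ∧ s'.rarr 6 j j ≠ 0 ∧ ∀ i < t, i ≠ j → s'.rarr 6 i j = 0)
    (60 * (k + 1) + 40) h2 (by decide) (by simp) (by simp) (fun t s' v h => by simpa using h)
    ⟨hs, hs', hjj, by simp⟩ ?_ (by nlinarith) ?_
  · rintro t ht s₁ hk₁ hx₁ ⟨hr, hc, hj, hz⟩
    have e15 : s₁.reg 15 = j := by rw [hk₁.reg 15 (by simp), h15]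
    by_cases hb : t = j
    · refine (Runs.ite_false (by simp [hx₁, e15, hb]) (Runs.loopFree (by simp) le_rfl ?_)).le
        (by simp [Prog.steps, Test.cost, NExpr.cost])
      refine ⟨hr, hc, hj, fun i hi hij => ?_⟩
      exact hz i (by omega) hij
    · refine (Runs.ite_true ?_ (Runs.loopFree_seq (by simp)
        ((runs_addRow (k := k) (p := t) (u := j) ?_ ?_ ?_ hb).mono le_rfl
          fun s₂ _ h₂ => ?_))).le (by simp [Prog.steps, Test.cost, NExpr.cost, RExpr.cost]; omega)
      · simp only [Test.Holds, NExpr.eval, hx₁, e15]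
        omega
      · simp [hk₁.reg 2, h2]
      · simp [hx₁]
      · simp [e15]
      · set P := (setReal 5 (lit 0) (lit 0) (.div (.sub (.ofNat (lit 0)) (.get 6 (reg 16) (reg 15)))
          (.get 6 (reg 15) (reg 15)))).seq ((setReg 17 (reg 16)).seq (setReg 18 (reg 15))) with hP
        have e6 : (P.run s₁).rarr 6 = s₁.rarr 6 := by funext i l; simp [hP]
        have e7 : (P.run s₁).rarr 7 = s₁.rarr 7 := by funext i l; simp [hP]
        have e5 : (P.run s₁).rarr 5 0 0 = (0 - s₁.rarr 6 t j) / s₁.rarr 6 j j := by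
          simp [hP, hx₁, e15]
        rw [e5, e6, e7] at h₂
        obtain ⟨hX, hV⟩ := h₂
        refine ⟨hr.rowAdded ht hjk hb hX hV, hc.rowAdded le_rfl hjk hX, ?_,
          fun i hi hij => ?_⟩
        · rw [hX _ _ hjk, if_neg (Ne.symm hb)]
          exact hj
        · rw [hX _ _ hjk]
          split_ifs with hit
          · field_simp
            ring
          · exact hz i (by omega) hij
  · rintro s' - ⟨hr, hc, hj, hz⟩
    refine ⟨hr, fun c hcj => ?_⟩
    rcases Nat.lt_succ_iff_lt_or_eq.1 hcj with hlt | rfl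
    · exact hc c hlt
    · exact ⟨hj, hz⟩

theorem runs_eliminate {s : State} {k : ℕ} {W : Matrix (Fin k) (Fin k) ℝ} (hW : W.det ≠ 0)
    (h2 : s.reg 2 = k) (hs : Reduced W (s.rarr 6) (s.rarr 7)) :
    Runs eliminate s (300 * ((k + 1) * ((k + 1) * (k + 1)))) (fun s' =>
      Reduced W (s'.rarr 6) (s'.rarr 7) ∧ Cleared k k (s'.rarr 6)) := by
  refine Runs.loop k (fun t s' => Reduced W (s'.rarr 6) (s'.rarr 7) ∧ Cleared k t (s'.rarr 6))
    (260 * ((k + 1) * (k + 1))) h2 (by decide) (by simp) (by simp)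
    (fun t s' v h => by simpa using h) ⟨hs, fun c hc => by omega⟩ ?_ (by nlinarith)
    (fun s' _ h => h)
  rintro t ht s₁ hk₁ hx₁ ⟨hr, hc⟩
  have e2 : s₁.reg 2 = k := by rw [hk₁.reg 2 (by simp), h2]
  refine ((runs_repair hW ht e2 hx₁ hr hc).seq fun s₂ hk₂ h₂ =>
    runs_clear ht ?_ ?_ h₂.1 h₂.2.1 h₂.2.2).le (by omega)
  · rw [hk₂.reg 2 (by simp), e2]
  · rw [hk₂.reg 15 (by simp), hx₁]

end InverseCompound

namespace InverseCompound

open NExpr Prog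

/-! ### Order below the rank -/

/-- The expression for `MinorExchange.exchange`. -/
def exch (a x b y : NExpr) : RExpr :=
  .sub (.div (.mul (.mul (.get 10 a x) (.get 30 b y)) (.get 0 (get 3 a x) (get 23 b y)))
    (.get 0 (reg 5) (reg 6))) (.mul (.get 3 x a) (.get 4 b y))

/-- Find a nonzero exchange. -/
def findExchange : Prog :=
  seq (search 21 22 3 4 (exch (get 4 (lit 0) (reg 7)) (get 4 (lit 1) (reg 7))
    (get 24 (lit 0) (reg 8)) (get 24 (lit 1) (reg 8))))
  (seq (seq (setReg 23 (get 4 (lit 0) (reg 21))) (setReg 24 (get 4 (lit 1) (reg 21))))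
    (seq (setReg 25 (get 24 (lit 0) (reg 22))) (setReg 26 (get 24 (lit 1) (reg 22)))))

/-- Register `7` runs through the row index `b` of the block and register `8` through the column
index `a`. In truncated subtraction the second expression is 1 − |b − c|, the identity matrix.
Dividing by the pivots at the end gives the inverse in array `8`. -/
def invertBlock : Prog :=
  seq (fill 6 2 2 (exch (reg 8) (reg 24) (reg 7) (reg 26)))
  (seq (fill 7 2 2 (.ofNat (sub (lit 1) (add (sub (reg 7) (reg 8)) (sub (reg 8) (reg 7))))))
    (seq eliminate (fill 8 2 2 (.div (.get 7 (reg 7) (reg 8)) (.get 6 (reg 7) (reg 7))))))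

def products : Prog := seq (mulArray 9 8 4 2 1 2) (mulArray 11 3 9 0 1 2)

/-- A real k-th root of det F · det W. A negative radicand occurs only for odd `k`, and is handled
by a root of its negative because `root` truncates at 0. -/
def scalar : Prog :=
  seq (setReal 5 (lit 0) (lit 1) (.get 0 (reg 5) (reg 6)))
  (seq (loop 15 2 (setReal 5 (lit 0) (lit 1) (.mul (.get 5 (lit 0) (lit 1))
      (.get 6 (reg 15) (reg 15)))))
    (ite (.rle (.ofNat (lit 0)) (.get 5 (lit 0) (lit 1)))
      (setReal 5 (lit 0) (lit 2) (.root (reg 2) (.get 5 (lit 0) (lit 1))))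
      (setReal 5 (lit 0) (lit 2) (.sub (.ofNat (lit 0))
        (.root (reg 2) (.sub (.ofNat (lit 0)) (.get 5 (lit 0) (lit 1))))))))

def output : Prog :=
  fill 1 0 1 (.mul (.get 5 (lit 0) (lit 2)) (.add (.get 11 (reg 7) (reg 8))
    (.div (exch (reg 23) (reg 7) (reg 25) (reg 8)) (exch (reg 23) (reg 24) (reg 25) (reg 26)))))

def recoverProg : Prog :=
  seq prepare (seq findExchange (seq invertBlock (seq products (seq scalar output))))

/-! ### Correctness of the recovery below the rank -/

section Recover

variable {n m k : ℕ} {A : Matrix (Fin n) (Fin m) ℝ} {i₀ : Fin (n.choose k)} {j₀ : Fin (m.choose k)}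

theorem Prepared.of_keep {P : Prog} {s s' : State} (h : Prepared A i₀ j₀ s) (hk : Keep P s s')
    (hR : ∀ x < 7, ¬ P.ModR x) (hN : ∀ a, ¬ P.ModN a)
    (hX : ∀ a ∈ [0, 3, 4, 10, 30], ¬ P.ModX a) : Prepared A i₀ j₀ s' := by
  have e0 := hk.rarr 0 (hX 0 (by simp))
  have e3 := hk.rarr 3 (hX 3 (by simp))
  have e4 := hk.rarr 4 (hX 4 (by simp))
  have e10 := hk.rarr 10 (hX 10 (by simp))
  have e30 := hk.rarr 30 (hX 30 (by simp))
  have eN := fun a => hk.narr a (hN a)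
  constructor
  · rw [hk.reg 0 (hR 0 (by omega)), h.reg0]
  · rw [hk.reg 1 (hR 1 (by omega)), h.reg1]
  · rw [hk.reg 2 (hR 2 (by omega)), h.reg2]
  · rw [hk.reg 3 (hR 3 (by omega)), h.reg3]
  · rw [hk.reg 4 (hR 4 (by omega)), h.reg4]
  · rw [hk.reg 5 (hR 5 (by omega)), h.reg5]
  · rw [hk.reg 6 (hR 6 (by omega)), h.reg6]
  · rw [e0]; exact h.input
  · exact h.ne_zero
  · rw [eN]; exact h.tuples
  · rw [eN]; exact h.indicators
  · rw [eN, eN, e10]; exact h.rows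
  · rw [eN, eN, e30]; exact h.cols
  · rw [e3]; exact h.rowCoord
  · rw [e4]; exact h.colCoord

theorem Prepared.setR {s : State} (h : Prepared A i₀ j₀ s) {x v : ℕ} (hx : 7 ≤ x) :
    Prepared A i₀ j₀ (s.setR x v) := by
  refine h.of_keep (P := setReg x (lit v)) (Exec.setReg x (lit v) s).keep (fun y hy => ?_)
    (by simp) (by simp)
  simp only [Prog.ModR]
  omega

theorem Prepared.exch_eval {s : State} (h : Prepared A i₀ j₀ s) {a x b y : NExpr} {a' b' : Fin k}
    {x' : Fin n} {y' : Fin m} (ha : a.eval s = a') (hx : x.eval s = x') (hb : b.eval s = b')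
    (hy : y.eval s = y') :
    (exch a x b y).eval s =
      MinorExchange.exchange A (tuple n k i₀) (tuple m k j₀) x' a' y' b' := by
  have hD : s.rarr 0 i₀ j₀ = (A.submatrix (tuple n k i₀) (tuple m k j₀)).det := h.input i₀ j₀
  simp only [exch, RExpr.eval, NExpr.eval, ha, hx, hb, hy, h.reg5, h.reg6, h.rowCoord, h.colCoord,
    MinorExchange.exchange, hD, (h.rows.minor_eq h.cols h.input a' b' x' y').2.2]

/-- The registers `23` to `26` describe a nonzero exchange. -/
structure Found (A : Matrix (Fin n) (Fin m) ℝ) (i₀ : Fin (n.choose k)) (j₀ : Fin (m.choose k))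
    (a₀ b₀ : Fin k) (x₀ : Fin n) (y₀ : Fin m) (s : State) : Prop extends Prepared A i₀ j₀ s where
  reg23 : s.reg 23 = a₀
  reg24 : s.reg 24 = x₀
  reg25 : s.reg 25 = b₀
  reg26 : s.reg 26 = y₀
  exchange_ne : MinorExchange.exchange A (tuple n k i₀) (tuple m k j₀) x₀ a₀ y₀ b₀ ≠ 0

theorem Found.of_keep {a₀ b₀ : Fin k} {x₀ : Fin n} {y₀ : Fin m} {P : Prog} {s s' : State}
    (h : Found A i₀ j₀ a₀ b₀ x₀ y₀ s) (hk : Keep P s s')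
    (hR : ∀ x, x < 7 ∨ 23 ≤ x → ¬ P.ModR x) (hN : ∀ a, ¬ P.ModN a)
    (hX : ∀ a ∈ [0, 3, 4, 10, 30], ¬ P.ModX a) : Found A i₀ j₀ a₀ b₀ x₀ y₀ s' where
  toPrepared := h.toPrepared.of_keep hk (fun x hx => hR x (Or.inl hx)) hN hX
  reg23 := by rw [hk.reg 23 (hR 23 (by simp)), h.reg23]
  reg24 := by rw [hk.reg 24 (hR 24 (by simp)), h.reg24]
  reg25 := by rw [hk.reg 25 (hR 25 (by simp)), h.reg25]
  reg26 := by rw [hk.reg 26 (hR 26 (by simp)), h.reg26]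
  exchange_ne := h.exchange_ne

/-- The search runs over pairs of tuples, decoded by the arrays `4` and `24`, since the n m k²
quadruples (x, a, y, b) can outnumber C(p,k)³, for instance when n = m = p and k = p − 1 ≥ 2. Tuples
that are no exchange decode to some admissible pair, which does no harm. -/
theorem runs_findExchange {s : State} (hk0 : 0 < k) (hk : k < A.rank) (hs : Prepared A i₀ j₀ s) :
    Runs findExchange s (400 * (n.choose k * m.choose k)) (fun s' =>
      ∃ a₀ b₀ x₀ y₀, Found A i₀ j₀ a₀ b₀ x₀ y₀ s') := by
  set e := exch (get 4 (lit 0) (reg 7)) (get 4 (lit 1) (reg 7))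
    (get 24 (lit 0) (reg 8)) (get 24 (lit 1) (reg 8)) with he
  have hNM : 1 ≤ n.choose k * m.choose k := Nat.mul_pos i₀.pos j₀.pos
  have heval : ∀ (i : Fin (n.choose k)) (j : Fin (m.choose k)),
      e.eval ((s.setR 7 i).setR 8 j) = MinorExchange.exchange A (tuple n k i₀) (tuple m k j₀)
        ⟨_, hs.rows.elem_lt i⟩ ⟨_, hs.rows.entry_lt i⟩ ⟨_, hs.cols.elem_lt j⟩
        ⟨_, hs.cols.entry_lt j⟩ := fun i j =>
    ((hs.setR (by omega)).setR (by omega)).exch_eval (by simp) (by simp) (by simp) (by simp)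
  refine Runs.le ((runs_search (N := n.choose k) (M := m.choose k)
    (fun i j => e.eval ((s.setR 7 i).setR 8 j)) hs.reg3 hs.reg4 i₀.pos j₀.pos
    (he := fun i hi j hj s' hk' h7 h8 => ?_)).seq fun s₁ hk₁ h₁ =>
      Runs.loopFree (by simp) le_rfl ?_) ?_
  · simp [he, exch, h7, h8, hk'.reg 5, hk'.reg 6, hk'.rarr 0, hk'.rarr 3, hk'.rarr 4, hk'.rarr 10,
      hk'.rarr 30, hk'.narr 3, hk'.narr 4, hk'.narr 23, hk'.narr 24]
  · obtain ⟨x, a, y, b, hex⟩ := MinorExchange.exists_exchange_ne_zero hs.ne_zero hk0 hk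
    -- A nonzero exchange needs a nonzero residue, so `x` and `y` lie outside the base tuples and
    -- their exchanges occur in the tables.
    have hex' := hex
    rw [MinorExchange.exchange_eq hs.ne_zero] at hex'
    have hx : ∀ c, tuple n k i₀ c ≠ x := fun c hc => hex' (by
      rw [← hc, MinorExchange.residue_of_mem_rows hs.ne_zero, zero_mul])
    have hy : ∀ c, tuple m k j₀ c ≠ y := fun c hc => hex' (by
      rw [← hc, MinorExchange.residue_of_mem_cols hs.ne_zero, zero_mul])
    obtain ⟨i, hi, hi'⟩ := hs.rows.complete a x hx
    obtain ⟨j, hj, hj'⟩ := hs.cols.complete b y hy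
    obtain ⟨hi₁, hj₁, hne⟩ := h₁ ⟨i, i.2, j, j.2, by
      rw [heval]
      convert hex using 2 <;> exact Fin.ext (by assumption)⟩
    rw [heval ⟨_, hi₁⟩ ⟨_, hj₁⟩] at hne
    refine ⟨_, _, _, _, ⟨?_, ?_, ?_, ?_, ?_, hne⟩⟩
    · simp only [Prog.run]
      exact ((((hs.of_keep hk₁ (fun x hx => by simp; omega) (by simp) (by simp)).setR
        (by omega)).setR (by omega)).setR (by omega)).setR (by omega)
    all_goals simp [hk₁.narr 4, hk₁.narr 24]
  · simp [exch, Prog.steps, RExpr.cost, NExpr.cost]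
    omega

theorem runs_invertBlock {s : State} {a₀ b₀ : Fin k} {x₀ : Fin n} {y₀ : Fin m}
    (hs : Found A i₀ j₀ a₀ b₀ x₀ y₀ s) :
    Runs invertBlock s (1000 * ((k + 1) * ((k + 1) * (k + 1)))) (fun s' =>
      (∀ b c : Fin k, s'.rarr 8 b c =
        (MinorExchange.exchangeBlock A (tuple n k i₀) (tuple m k j₀) x₀ y₀)⁻¹ b c) ∧
      ∏ c ∈ Finset.range k, s'.rarr 6 c c =
        (MinorExchange.exchangeBlock A (tuple n k i₀) (tuple m k j₀) x₀ y₀).det) := by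
  set W := MinorExchange.exchangeBlock A (tuple n k i₀) (tuple m k j₀) x₀ y₀ with hWdef
  have hk0 : 1 ≤ k := a₀.pos
  have hW : W.det ≠ 0 := (MinorExchange.eq_smul_direction hs.ne_zero hs.exchange_ne).1
  have hcost : k * k ≤ (k + 1) * ((k + 1) * (k + 1)) := by nlinarith
  refine Runs.le (Runs.seq (runs_fill (N := k) (M := k) (fun b c =>
      if h : b < k ∧ c < k then W ⟨b, h.1⟩ ⟨c, h.2⟩ else 0) hs.reg2 hs.reg2 hk0 hk0
      (he := fun b hb c hc s' hk' h7 h8 => ?_)) fun s₁ hk₁ h₁ =>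
    Runs.seq (runs_fill (N := k) (M := k) (fun b c => if b = c then 1 else 0)
      (by rw [hk₁.reg 2 (by simp), hs.reg2]) (by rw [hk₁.reg 2 (by simp), hs.reg2]) hk0 hk0
      (he := fun b hb c hc s' hk' h7 h8 => ?_)) fun s₂ hk₂ h₂ =>
    Runs.seq (runs_eliminate (W := W) hW
      (by rw [hk₂.reg 2 (by simp), hk₁.reg 2 (by simp), hs.reg2]) ⟨?_, ?_⟩) fun s₃ hk₃ h₃ =>
    Runs.mono (runs_fill (N := k) (M := k) (fun b c => s₃.rarr 7 b c / s₃.rarr 6 b b)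
      ?_ ?_ hk0 hk0 (he := fun b hb c hc s' hk' h7 h8 => ?_)) le_rfl
      (Q' := _) fun s₄ hk₄ h₄ => ⟨fun b c => ?_, ?_⟩) ?_
  · have hf := hs.of_keep hk' (fun x hx => by simp; omega) (by simp) (by simp)
    rw [dif_pos ⟨hb, hc⟩]
    exact hf.toPrepared.exch_eval (a' := ⟨c, hc⟩) (b' := ⟨b, hb⟩) (by simp [h8])
      (by simp [hf.reg24]) (by simp [h7]) (by simp [hf.reg26])
  · simp only [RExpr.eval, NExpr.eval, h7, h8]
    split_ifs with h
    · simp [h]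
    · have : 1 - (b - c + (c - b)) = 0 := by omega
      rw [this, Nat.cast_zero]
  · have h1 : toMatrix k (s₂.rarr 7) = 1 := by
      ext b c
      simp only [toMatrix, Matrix.of_apply, h₂ b b.2 c c.2, Matrix.one_apply, Fin.ext_iff]
    rw [h1, Matrix.one_mul]
    ext b c
    simp only [toMatrix, Matrix.of_apply]
    rw [hk₂.rarr 6 (by simp), h₁ b b.2 c c.2]
    simp
  · have h1 : toMatrix k (s₂.rarr 7) = 1 := by
      ext b c
      simp only [toMatrix, Matrix.of_apply, h₂ b b.2 c c.2, Matrix.one_apply, Fin.ext_iff]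
    rw [h1, Matrix.det_one]
  · rw [hk₃.reg 2 (by simp), hk₂.reg 2 (by simp), hk₁.reg 2 (by simp), hs.reg2]
  · rw [hk₃.reg 2 (by simp), hk₂.reg 2 (by simp), hk₁.reg 2 (by simp), hs.reg2]
  · simp [h7, h8, hk'.rarr 6, hk'.rarr 7]
  · rw [h₄ b b.2 c c.2, (h₃.1.inv_eq h₃.2).1]
    rfl
  · rw [hk₄.rarr 6 (by simp), (h₃.1.inv_eq h₃.2).2, Finset.prod_range]
  · simp [exch, RExpr.cost, NExpr.cost]
    omega

theorem runs_products {s : State} (hn : 1 ≤ n) (hm : 1 ≤ m) (hk0 : 1 ≤ k)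
    (h0 : s.reg 0 = n) (h1 : s.reg 1 = m) (h2 : s.reg 2 = k)
    {Y : Matrix (Fin n) (Fin k) ℝ} {V : Matrix (Fin k) (Fin k) ℝ} {Z : Matrix (Fin k) (Fin m) ℝ}
    (hY : ∀ x a, s.rarr 3 (x : Fin n) (a : Fin k) = Y x a)
    (hV : ∀ a b, s.rarr 8 (a : Fin k) (b : Fin k) = V a b)
    (hZ : ∀ b y, s.rarr 4 (b : Fin k) (y : Fin m) = Z b y) :
    Runs products s (80 * (k * (m * (k + 1))) + 80 * (n * (m * (k + 1)))) (fun s' =>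
      ∀ (x : Fin n) (y : Fin m), s'.rarr 11 x y = (Y * V * Z) x y) := by
  refine (runs_mulArray (by decide) (by decide) h2 h1 h2 hm hk0).seq fun s₁ hk₁ h₁ =>
    (runs_mulArray (N := n) (M := m) (K := k) (by decide) (by decide) ?_ ?_ ?_ hm hn).mono le_rfl
    fun s₂ hk₂ h₂ x y => ?_
  · rw [hk₁.reg 0 (by simp), h0]
  · rw [hk₁.reg 1 (by simp), h1]
  · rw [hk₁.reg 2 (by simp), h2]
  · rw [h₂ x x.2 y y.2, Finset.sum_range, Matrix.mul_assoc, Matrix.mul_apply]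
    refine Finset.sum_congr rfl fun a _ => ?_
    rw [hk₁.rarr 3 (by simp), hY, h₁ a a.2 y y.2, Finset.sum_range, Matrix.mul_apply]
    congr 1
    exact Finset.sum_congr rfl fun b _ => by rw [hV, hZ]

theorem runs_scalar {s : State} (hk0 : k ≠ 0) (h2 : s.reg 2 = k) {ρ : ℝ}
    (hρ : ρ ^ k = s.rarr 0 (s.reg 5) (s.reg 6) * ∏ c ∈ Finset.range k, s.rarr 6 c c) :
    Runs scalar s (60 * (k + 1)) (fun s' => s'.rarr 5 0 2 ^ k = ρ ^ k) := by
  refine Runs.le (Runs.loopFree_seq (by simp) (Runs.seq (c := 30 * (k + 1)) (c' := 40)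
    (Q := fun s' => s'.rarr 5 0 1 = ρ ^ k) ?_ fun s₁ hk₁ h₁ => ?_))
    (by simp [Prog.steps, NExpr.cost, RExpr.cost]; omega)
  · refine Runs.simpleLoop k (fun t s' => s'.rarr 5 0 1 = s.rarr 0 (s.reg 5) (s.reg 6) *
      ∏ c ∈ Finset.range t, s.rarr 6 c c) (by simp [h2]) (by simp) (by decide) (by simp) (by simp)
      (fun t s' v h => by simpa using h) (by simp) ?_
      (by simp [Prog.steps, NExpr.cost, RExpr.cost]; omega) (fun s' _ h => by rw [h, hρ])
    intro t ht s' hk' hx h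
    have h6 : s'.rarr 6 t t = s.rarr 6 t t := by rw [hk'.rarr 6 (by simp)]; simp
    simp [hx, h, h6, Finset.prod_range_succ, mul_assoc]
  · have e2 : s₁.reg 2 = k := by rw [hk₁.reg 2 (by simp)]; simp [h2]
    refine Runs.loopFree (by simp) (by simp [Prog.steps, NExpr.cost, RExpr.cost, Test.cost]) ?_
    simp only [Prog.run, Test.Holds, RExpr.eval, NExpr.eval, Nat.cast_zero, h₁, e2]
    split_ifs with hpos
    · simp only [State.setX_rarr, true_and, if_true]
      rw [max_eq_left hpos, Real.rpow_inv_natCast_pow hpos hk0]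
    · simp only [State.setX_rarr, true_and, if_true]
      -- An even power of the real number ρ cannot be negative.
      have hodd : Odd k := by
        by_contra heven
        exact hpos ((Nat.not_odd_iff_even.1 heven).pow_nonneg ρ)
      rw [zero_sub, zero_sub, max_eq_left (by linarith), hodd.neg_pow,
        Real.rpow_inv_natCast_pow (by linarith) hk0, neg_neg]

theorem runs_output {s : State} {a₀ b₀ : Fin k} {x₀ : Fin n} {y₀ : Fin m}
    (hs : Found A i₀ j₀ a₀ b₀ x₀ y₀ s)
    (h11 : ∀ (x : Fin n) (y : Fin m), s.rarr 11 x y =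
      (MinorExchange.rowCoord A (tuple n k i₀) (tuple m k j₀) *
        (MinorExchange.exchangeBlock A (tuple n k i₀) (tuple m k j₀) x₀ y₀)⁻¹ *
        MinorExchange.colCoord A (tuple n k i₀) (tuple m k j₀)) x y) :
    Runs output s (200 * (n * m)) (fun s' => ∀ (x : Fin n) (y : Fin m), s'.rarr 1 x y =
      (s.rarr 5 0 2 • MinorExchange.direction A (tuple n k i₀) (tuple m k j₀) x₀ a₀ y₀ b₀) x y) := by
  refine (runs_fill (N := n) (M := m) (fun x y => if h : x < n ∧ y < m then
      (s.rarr 5 0 2 • MinorExchange.direction A (tuple n k i₀) (tuple m k j₀) x₀ a₀ y₀ b₀)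
        ⟨x, h.1⟩ ⟨y, h.2⟩ else 0) hs.reg0 hs.reg1 x₀.pos y₀.pos
      (he := fun x hx y hy s' hk' h7 h8 => ?_)).mono ?_ fun s₁ hk₁ h₁ x y => ?_
  · have hf := hs.of_keep hk' (fun x hx => by simp; omega) (by simp) (by simp)
    rw [dif_pos ⟨hx, hy⟩]
    have e1 := hf.toPrepared.exch_eval (a := reg 23) (x := reg 7) (b := reg 25) (y := reg 8)
      (a' := a₀) (b' := b₀) (x' := ⟨x, hx⟩) (y' := ⟨y, hy⟩) hf.reg23 h7 hf.reg25 h8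
    have e2 := hf.toPrepared.exch_eval (a := reg 23) (x := reg 24) (b := reg 25) (y := reg 26)
      hf.reg23 hf.reg24 hf.reg25 hf.reg26
    have e11 := h11 ⟨x, hx⟩ ⟨y, hy⟩
    simp only at e11
    simp only [RExpr.eval, NExpr.eval, e1, e2, h7, h8, hk'.rarr 5 (by simp), hk'.rarr 11 (by simp),
      e11]
    rfl
  · simp [exch, RExpr.cost, NExpr.cost]
    gcongr
    norm_num
  · rw [h₁ x x.2 y y.2, dif_pos ⟨x.2, y.2⟩]

/-- The cost of the recovery, up to a constant factor. -/
def recoverCost (n m k : ℕ) : ℕ :=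
  prepareCost n m k + n.choose k * m.choose k + (k + 1) * ((k + 1) * (k + 1)) +
    k * (m * (k + 1)) + n * (m * (k + 1)) + (k + 1) + n * m

theorem runs_recoverProg (A : Matrix (Fin n) (Fin m) ℝ) (hk0 : 0 < k) (hk : k < A.rank) :
    ∃ c : ℝ, (c = 1 ∨ c = -1) ∧ c ^ k = 1 ∧
      Runs recoverProg (initial n m k (compound k A)) (1000 * recoverCost n m k)
        (fun s => ∀ (i : Fin n) (j : Fin m), s.rarr 1 i j = (c • A) i j) := by
  have hkm : k ≤ m := hk.le.trans A.rank_le_width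
  have hkn : k ≤ n := hk.le.trans A.rank_le_height
  suffices h : Runs recoverProg (initial n m k (compound k A)) (1000 * recoverCost n m k)
      (fun s => ∃ c : ℝ, c ^ k = 1 ∧ ∀ (i : Fin n) (j : Fin m), s.rarr 1 i j = (c • A) i j) by
    obtain ⟨t, s, ht, he, c, hc, hs⟩ := h
    exact ⟨c, (eq_one_or_neg_one_of_pow_eq hk0.ne' hc).1, hc, t, s, ht, he, hs⟩
  refine Runs.le (c := 600 * prepareCost n m k + (400 * (n.choose k * m.choose k) +
    (1000 * ((k + 1) * ((k + 1) * (k + 1))) + ((80 * (k * (m * (k + 1))) +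
    80 * (n * (m * (k + 1)))) + (60 * (k + 1) + 200 * (n * m)))))) ?_
    (by unfold recoverCost; omega)
  refine (runs_prepare A hk0 hk.le).seq ?_
  rintro s₁ - ⟨i₀, j₀, h₁⟩
  refine (runs_findExchange hk0 hk h₁).seq ?_
  rintro s₂ - ⟨a₀, b₀, x₀, y₀, h₂⟩
  obtain ⟨-, ρ, hρ, hpow, hA⟩ := MinorExchange.eq_smul_direction h₂.ne_zero h₂.exchange_ne
  refine (runs_invertBlock h₂).seq fun s₃ hk₃ h₃ => ?_
  have f₃ := h₂.of_keep hk₃ (fun x hx => by simp [invertBlock]; omega) (by simp [invertBlock])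
    (by simp [invertBlock])
  refine (runs_products (by omega) (by omega) hk0 f₃.reg0 f₃.reg1 f₃.reg2 f₃.rowCoord h₃.1
    f₃.colCoord).seq fun s₄ hk₄ h₄ => ?_
  have f₄ := f₃.of_keep hk₄ (fun x hx => by simp [products]; omega) (by simp [products])
    (by simp [products])
  have hD : s₄.rarr 0 (s₄.reg 5) (s₄.reg 6) = (A.submatrix (tuple n k i₀) (tuple m k j₀)).det := by
    rw [f₄.reg5, f₄.reg6]; exact f₄.input i₀ j₀
  refine (runs_scalar (ρ := ρ) hk0.ne' f₄.reg2 ?_).seq fun s₅ hk₅ h₅ => ?_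
  · rw [hD, hk₄.rarr 6 (by simp [products]), h₃.2, hpow]
  have f₅ := f₄.of_keep hk₅ (fun x hx => by simp [scalar]; omega) (by simp [scalar])
    (by simp [scalar])
  -- The sign `c` is the extracted root divided by the true factor ρ; both have the same k-th power.
  refine (runs_output f₅ ?_).mono le_rfl fun s₆ _ h₆ =>
    ⟨s₅.rarr 5 0 2 / ρ, by rw [div_pow, h₅, div_self (pow_ne_zero _ hρ)], fun i j => ?_⟩
  · rw [hk₅.rarr 11 (by simp [scalar])]
    exact h₄
  · rw [h₆]
    conv_rhs => rw [hA]
    rw [smul_smul, div_mul_cancel₀ _ hρ]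

end Recover

end InverseCompound

/-! ### Estimates of the costs by binomial coefficients -/

namespace InverseCompound

/-- A `k`-subset of a `p`-set has k(p − k) neighbours by a single exchange; with itself they are
distinct `k`-subsets. Formally, a double induction with Pascal's rule. -/
theorem one_add_mul_le_choose {p k : ℕ} (hk : 1 ≤ k) (hp : k ≤ p) :
    1 + k * (p - k) ≤ p.choose k := by
  obtain ⟨d, rfl⟩ := Nat.exists_eq_add_of_le hp
  rw [Nat.add_sub_cancel_left]
  clear hp
  induction k, hk using Nat.le_induction generalizing d with
  | base => rw [Nat.choose_one_right]; omega
  | succ k hk ih =>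
    induction d with
    | zero => simp
    | succ d ihd =>
      have h := Nat.choose_succ_succ (k + 1 + d) k
      have h1 := ih (d + 1)
      rw [show k + (d + 1) = k + 1 + d by ring] at h1
      rw [show k + 1 + (d + 1) = (k + 1 + d).succ by omega, show k + 1 = k.succ from rfl] at *
      rw [h]
      nlinarith

theorem le_choose {p k : ℕ} (hk : 1 ≤ k) (hp : k < p) : p ≤ p.choose k := by
  obtain ⟨d, rfl⟩ := Nat.exists_eq_add_of_lt hp
  have h := one_add_mul_le_choose hk hp.le
  rw [show k + d + 1 - k = d + 1 by omega] at h
  nlinarith [Nat.mul_le_mul hk (Nat.le_refl d)]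

/-- For k < p the number N = C(p,k) bounds n, m, k + 1 and both smaller binomials, and each summand
is a product of at most three of these. -/
theorem recoverCost_le {n m k p : ℕ} (hk : 1 ≤ k) (hp : k < p) (hn : n ≤ p) (hm : m ≤ p) :
    recoverCost n m k ≤ 12 * p.choose k ^ 3 := by
  have hpN := le_choose hk hp
  have h1 := Nat.choose_le_choose k hn
  have h2 := Nat.choose_le_choose k hm
  unfold recoverCost prepareCost
  set N := p.choose k
  have hk1 : k + 1 ≤ N := by omega
  have hkN : k ≤ N := by omega
  have hnN : n ≤ N := by omega
  have hmN : m ≤ N := by omega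
  have hN1 : 1 ≤ N := by omega
  have e1 : n.choose k * (k + 1) ≤ N * N := Nat.mul_le_mul h1 hk1
  have e2 : m.choose k * (k + 1) ≤ N * N := Nat.mul_le_mul h2 hk1
  have e3 : n.choose k * m.choose k ≤ N * N := Nat.mul_le_mul h1 h2
  have e4 : n * k ≤ N * N := Nat.mul_le_mul hnN hkN
  have e5 : k * m ≤ N * N := Nat.mul_le_mul hkN hmN
  have e6 : (k + 1) * ((k + 1) * (k + 1)) ≤ N * (N * N) :=
    Nat.mul_le_mul hk1 (Nat.mul_le_mul hk1 hk1)
  have e7 : k * (m * (k + 1)) ≤ N * (N * N) := Nat.mul_le_mul hkN (Nat.mul_le_mul hmN hk1)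
  have e8 : n * (m * (k + 1)) ≤ N * (N * N) := Nat.mul_le_mul hnN (Nat.mul_le_mul hmN hk1)
  have e9 : n * m ≤ N * N := Nat.mul_le_mul hnN hmN
  have e10 : N * N ≤ N * (N * N) := Nat.le_mul_of_pos_left _ hN1
  have e11 : N ≤ N * N := Nat.le_mul_of_pos_left _ hN1
  have e12 : N ^ 3 = N * (N * N) := by ring
  omega

/-- The critical summand is (n − k) m (k + 1): here (n − k) k ≤ k(p − k) ≤ N and n − k ≤ N, leaving
at most 2N · m. -/
theorem fullCost_le {n m k p : ℕ} (hk : 1 ≤ k) (hp : k < p) (hn : n ≤ p) (hm : m ≤ p) :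
    fullCost n m k ≤ 12 * p.choose k ^ 2 := by
  have hpN := le_choose hk hp
  have h1 := Nat.choose_le_choose k hn
  have h2 := Nat.choose_le_choose k hm
  have h3 := one_add_mul_le_choose hk hp.le
  unfold fullCost prepareCost
  set N := p.choose k
  have hk1 : k + 1 ≤ N := by omega
  have hkN : k ≤ N := by omega
  have hnN : n ≤ N := by omega
  have hmN : m ≤ N := by omega
  have hN1 : 1 ≤ N := by omega
  have e1 : n.choose k * (k + 1) ≤ N * N := Nat.mul_le_mul h1 hk1
  have e2 : m.choose k * (k + 1) ≤ N * N := Nat.mul_le_mul h2 hk1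
  have e3 : n.choose k * m.choose k ≤ N * N := Nat.mul_le_mul h1 h2
  have e4 : n * k ≤ N * N := Nat.mul_le_mul hnN hkN
  have e5 : k * m ≤ N * N := Nat.mul_le_mul hkN hmN
  have e6 : (k + 1) * m ≤ N * N := Nat.mul_le_mul hk1 hmN
  have e7 : (n - k) * (k + 1) ≤ 2 * N := by
    have : (n - k) * k ≤ k * (p - k) := by
      rw [mul_comm]; exact Nat.mul_le_mul_left _ (by omega)
    rw [Nat.mul_succ]
    omega
  have e8 : (n - k) * (m * (k + 1)) ≤ 2 * N * N := by
    rw [Nat.mul_left_comm, mul_comm]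
    exact Nat.mul_le_mul e7 hmN
  have e9 : N ≤ N * N := Nat.le_mul_of_pos_left _ hN1
  have e10 : N ^ 2 = N * N := by ring
  rw [mul_assoc] at e8
  omega

theorem fullCost_self_le {k : ℕ} (hk : 1 ≤ k) : fullCost k k k ≤ 13 * (k * k) := by
  unfold fullCost prepareCost
  have := Nat.le_mul_self k
  rw [Nat.choose_self, Nat.sub_self, zero_mul, add_one_mul k k]
  omega

theorem cube_le_smallOrderTime (p k r : ℕ) : (p.choose k : ℝ) ^ 3 ≤ smallOrderTime p k r :=
  le_add_of_nonneg_right (by positivity)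

theorem smallOrderTime_le_largeOrderTime (p k r : ℕ) :
    smallOrderTime p k r ≤ largeOrderTime p k r :=
  le_add_of_nonneg_right (mul_nonneg (by positivity) (Real.log_natCast_nonneg r))

theorem apply_max_le {f : ℕ → ℝ} (n m : ℕ) : f (max n m) ≤ max (f n) (f m) := by
  rcases max_cases n m with h | h <;> simp [h.1]

end InverseCompound

/-! ### Assembly of uniqueness, recovery and time bounds -/

theorem mainTheorem1 :
    -- uniqueness of the inverse-compound up to sign
    (∀ (n m k : ℕ) (A B : Matrix (Fin n) (Fin m) ℝ), 1 ≤ k → k < A.rank →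
      InverseCompound.compound k A = InverseCompound.compound k B →
        (Odd k → B = A) ∧ (Even k → B = A ∨ B = -A)) ∧
    -- recovery of the matrix from its compound, order below the rank
    (∃ (P : InverseCompound.Prog) (K : ℝ), ∀ (n m k : ℕ) (A : Matrix (Fin n) (Fin m) ℝ),
      1 ≤ k → k < A.rank →
        ∃ (c : ℝ) (t : ℕ), (c = 1 ∨ c = -1) ∧ c ^ k = 1 ∧
          InverseCompound.Returns P n m k (InverseCompound.compound k A) (c • A) t ∧
          (k ≤ (A.rank + 1) / 2 →
            (t : ℝ) ≤ K * max (InverseCompound.smallOrderTime n k A.rank)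
              (InverseCompound.smallOrderTime m k A.rank)) ∧
          ((A.rank + 1) / 2 < k →
            (t : ℝ) ≤ K * max (InverseCompound.largeOrderTime n k A.rank)
              (InverseCompound.largeOrderTime m k A.rank))) ∧
    -- computation of one inverse-compound, order equal to the rank
    (∃ (P : InverseCompound.Prog) (K : ℝ), ∀ (n m k : ℕ) (A : Matrix (Fin n) (Fin m) ℝ),
      1 ≤ k → k = A.rank →
        ∃ (B : Matrix (Fin n) (Fin m) ℝ) (t : ℕ),
          InverseCompound.compound k B = InverseCompound.compound k A ∧
          InverseCompound.Returns P n m k (InverseCompound.compound k A) B t ∧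
          (k < max n m →
            (t : ℝ) ≤ K * max (InverseCompound.fullOrderTime n k A.rank)
              (InverseCompound.fullOrderTime m k A.rank)) ∧
          (k = max n m → (t : ℝ) ≤ K * ((n : ℝ) * (m : ℝ)))) := by
  -- The constants are 1000 · 12 from `recoverCost_le`, and 600 · 13, which covers both
  -- `fullCost_le` and `fullCost_self_le`.
  refine ⟨fun n m k A B hk hr h => InverseCompound.compound_unique hk hr h,
    ⟨InverseCompound.recoverProg, 12000, fun n m k A hk hr => ?_⟩,
    ⟨InverseCompound.fullOrderProg, 7800, fun n m k A hk hr => ?_⟩⟩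
  · obtain ⟨c, hc, hck, t, s, ht, hs, hB⟩ := InverseCompound.runs_recoverProg A hk hr
    have hp : k < max n m := lt_max_of_lt_left (hr.trans_le A.rank_le_height)
    have hcost : (t : ℝ) ≤ 12000 * ((max n m).choose k : ℝ) ^ 3 := by
      have := InverseCompound.recoverCost_le hk hp (le_max_left n m) (le_max_right n m)
      exact_mod_cast (by omega : t ≤ 12000 * (max n m).choose k ^ 3)
    -- The cube at max(n,m) is a summand of the bound (a), which in turn is dominated by (b).
    have hsmall := (InverseCompound.cube_le_smallOrderTime (max n m) k A.rank).trans
      (InverseCompound.apply_max_le (f := (InverseCompound.smallOrderTime · k A.rank)) n m)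
    have hlarge := hsmall.trans (max_le_max
      (InverseCompound.smallOrderTime_le_largeOrderTime n k A.rank)
      (InverseCompound.smallOrderTime_le_largeOrderTime m k A.rank))
    exact ⟨c, t, hc, hck, ⟨s, hs, hB⟩,
      fun _ => hcost.trans (mul_le_mul_of_nonneg_left hsmall (by norm_num)),
      fun _ => hcost.trans (mul_le_mul_of_nonneg_left hlarge (by norm_num))⟩
  · obtain ⟨B, hBA, t, s, ht, hs, hB⟩ := InverseCompound.runs_fullOrderProg A hk hr
    refine ⟨B, t, hBA, ⟨s, hs, hB⟩, fun hp => ?_, fun hp => ?_⟩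
    · have hcost : (t : ℝ) ≤ 7800 * ((max n m).choose k : ℝ) ^ 2 := by
        have := InverseCompound.fullCost_le hk hp (le_max_left n m) (le_max_right n m)
        exact_mod_cast (by omega : t ≤ 7800 * (max n m).choose k ^ 2)
      have hfull := InverseCompound.apply_max_le
        (f := (InverseCompound.fullOrderTime · k A.rank)) n m
      refine hcost.trans (mul_le_mul_of_nonneg_left (le_trans ?_ hfull) (by norm_num))
      -- At k = r the factor C(r,k) equals 1, so the bound is the plain square.
      simp [InverseCompound.fullOrderTime, ← hr]
    -- The rank is at most both n and m, so k = max(n,m) forces n = m = k.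
    · have hn : k = n := le_antisymm (hr.trans_le A.rank_le_height) (hp ▸ le_max_left n m)
      have hm : k = m := le_antisymm (hr.trans_le A.rank_le_width) (hp ▸ le_max_right n m)
      subst hn hm
      have := InverseCompound.fullCost_self_le hk
      exact_mod_cast (by omega : t ≤ 7800 * (k * k))
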